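/- Let $N$ be either a smooth real $4$-manifold with a conformal structure $c$ of definite or split signature, or a complex $4$-manifold with a holomorphic conformal structure $c$ (that is, a smooth, respectively holomorphic, line subbundle of $S^2T^*N$ whose non-vanishing local sections are nondegenerate metrics); suppose that $(N,c)$ is oriented and self-dual, i.e. the component $W^-$ of its Weyl tensor vanishes identically. Let $M\to N$ be an (immersed) hypersurface, of dimension $3$, on which $c$ induces a nondegenerate conformal structure, and which is umbilic: for every local metric $g$ in $c$, the second fundamental form of $M$ is at each point $g|_M\otimes H$ for some normal vector $H$. For a metric $g$ in dimension $n\in\{3,4\}$ put $h=\frac{1}{2n(n-1)}\mathrm{Scal}\cdot g+\frac1{n-2}\mathrm{Ric}_0$, and let $C(X,Y)(Z)=(\nabla_Xh)(Y,Z)-(\nabla_Yh)(X,Z)$ be its Cotton–York tensor; if $n=4$, let $C^+$ be the component of $C$ in $\Lambda^+\otimes\Lambda^1$. Regard $W^+$ as an endomorphism of bivectors, with the sign for which the curvature operator of the round unit sphere is the identity. Then for every local metric $g$ in $c$ (with $C^M$ the Cotton–York tensor of $g|_M$), at every point $x\in M$ in its domain: (i) $W^+_x=0$. (ii) For every $\nu\in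 T_xN$ with $\nu\perp T_xM$ and $g(\nu,\nu)=1$, and all $A,B\in\Lambda^2T_xM$, $$g\big((\nabla_\nu W^+)(A),B\big)=-C^M(A)(*^MB),$$ where $*^M:\Lambda^2T_xM\to T_xM$ is the Hodge operator of $g|_M$ and of the orientation of $T_xM$ for which $(X,Y,Z)$ is oriented if and only if $(X,Y,Z,\nu)$ is an oriented basis of $T_xN$; that is, $g(*^MB,Z)\,=\mathrm{vol}_g(B\wedge Z\wedge\nu)$ for all $Z\in T_xM$, where $\mathrm{vol}_g$ is the oriented volume form of norm $1$ of $g$. (iii) For all $X,Y,Z\in T_xM$, $C^+(X,Y)(Z)=C^M(X,Y)(Z)$. -/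

import Mathlib

open scoped Manifold ContDiff

noncomputable section

namespace SelfDualUmbilic

/-! ### Tensors of a metric in coordinates

Throughout, `𝕜` is `ℝ` or `ℂ`.  A metric is a field of nondegenerate symmetric `𝕜`-bilinear forms,
of any signature if `𝕜 = ℝ`, and holomorphic if `𝕜 = ℂ`. -/

/-- The coordinate space `𝕜ⁿ`. -/
abbrev Coord (𝕜 : Type*) (n : ℕ) : Type _ := EuclideanSpace 𝕜 (Fin n)

/-- Continuous bilinear forms on a (topological) vector space. -/
abbrev Bilin (𝕜 : Type*) [RCLike 𝕜] (V : Type*) [TopologicalSpace V] [AddCommGroup V] [Module 𝕜 V]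
    [IsTopologicalAddGroup V] : Type _ := V →L[𝕜] V →L[𝕜] 𝕜

section Coordinates

variable {𝕜 : Type*} [RCLike 𝕜] {n : ℕ}

/-- The `i`-th coordinate vector. -/
def stdVec (i : Fin n) : Coord 𝕜 n := EuclideanSpace.single i 1

/-- The vector `eⁱ = g^{ij} e_j` at `p`, that is, `g (eⁱ, v) = vⁱ` for every `v`. -/
def dualVec (g : Coord 𝕜 n → Bilin 𝕜 (Coord 𝕜 n)) (p : Coord 𝕜 n) (i : Fin n) : Coord 𝕜 n :=
  (g p).inverse (EuclideanSpace.proj i)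

/-- The derivative `D_X (g (Y, Z))` at `p`, for constant `Y`, `Z`. -/
def dMetric (g : Coord 𝕜 n → Bilin 𝕜 (Coord 𝕜 n)) (p X Y Z : Coord 𝕜 n) : 𝕜 :=
  fderiv 𝕜 (fun q => g q Y Z) p X

/-- The Levi-Civita connection in coordinates: `∇_X Y = D_X Y + christoffel g p X Y`. -/
def christoffel (g : Coord 𝕜 n → Bilin 𝕜 (Coord 𝕜 n)) (p X Y : Coord 𝕜 n) : Coord 𝕜 n :=
  ∑ i : Fin n, ((1 / 2 : 𝕜) * (dMetric g p X Y (stdVec i) + dMetric g p Y X (stdVec i)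
    - dMetric g p (stdVec i) X Y)) • dualVec g p i

/-- The curvature `R(X, Y)Z = ∇_X ∇_Y Z - ∇_Y ∇_X Z - ∇_[X,Y] Z`. -/
def curvature (g : Coord 𝕜 n → Bilin 𝕜 (Coord 𝕜 n)) (p X Y Z : Coord 𝕜 n) : Coord 𝕜 n :=
  fderiv 𝕜 (fun q => christoffel g q Y Z) p X - fderiv 𝕜 (fun q => christoffel g q X Z) p Y
    + christoffel g p X (christoffel g p Y Z) - christoffel g p Y (christoffel g p X Z)

/-- The curvature operator on bivectors as a tensor with four arguments:
`curvatureForm g p X Y Z T = g(R(X ∧ Y), Z ∧ T)`, where `R` is the identity on the unit sphere and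
`g(X ∧ Y, Z ∧ T) = g(X, Z) g(Y, T) - g(X, T) g(Y, Z)`. -/
def curvatureForm (g : Coord 𝕜 n → Bilin 𝕜 (Coord 𝕜 n)) (p X Y Z T : Coord 𝕜 n) : 𝕜 :=
  g p (curvature g p X Y T) Z

/-- The Ricci tensor `Ric(Y, Z) = tr (X ↦ R(X, Y)Z)`. -/
def ricci (g : Coord 𝕜 n → Bilin 𝕜 (Coord 𝕜 n)) (p Y Z : Coord 𝕜 n) : 𝕜 :=
  ∑ i : Fin n, (curvature g p (stdVec i) Y Z) i

/-- The scalar curvature. -/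
def scal (g : Coord 𝕜 n → Bilin 𝕜 (Coord 𝕜 n)) (p : Coord 𝕜 n) : 𝕜 :=
  ∑ i : Fin n, ricci g p (stdVec i) (dualVec g p i)

/-- The normalized Ricci (Schouten) tensor `h = Scal / (2n(n-1)) g + Ric₀ / (n-2)`, where `Ric₀` is
the trace-free Ricci tensor. -/
def schouten (g : Coord 𝕜 n → Bilin 𝕜 (Coord 𝕜 n)) (p X Y : Coord 𝕜 n) : 𝕜 :=
  scal g p / (2 * n * ((n : 𝕜) - 1)) * g p X Y
    + (ricci g p X Y - scal g p / n * g p X Y) / ((n : 𝕜) - 2)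

/-- The Weyl tensor `W = R - h ∧ I`, with the index convention of `curvatureForm`. -/
def weyl (g : Coord 𝕜 n → Bilin 𝕜 (Coord 𝕜 n)) (p X Y Z T : Coord 𝕜 n) : 𝕜 :=
  curvatureForm g p X Y Z T
    - (schouten g p X Z * g p Y T + schouten g p Y T * g p X Z
      - schouten g p X T * g p Y Z - schouten g p Y Z * g p X T)

/-- The Cotton–York tensor `C(X, Y)(Z) = (∇_X h)(Y, Z) - (∇_Y h)(X, Z)`, where
`(∇_X h)(Y, Z) = D_X (h(Y, Z)) - h(Γ(X, Y), Z) - h(Y, Γ(X, Z))` for constant `Y`, `Z`. -/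
def cotton (g : Coord 𝕜 n → Bilin 𝕜 (Coord 𝕜 n)) (p X Y Z : Coord 𝕜 n) : 𝕜 :=
  (fderiv 𝕜 (fun q => schouten g q Y Z) p X
      - schouten g p (christoffel g p X Y) Z - schouten g p Y (christoffel g p X Z))
    - (fderiv 𝕜 (fun q => schouten g q X Z) p Y
      - schouten g p (christoffel g p Y X) Z - schouten g p X (christoffel g p Y Z))

/-- The covariant derivative `(∇_V S)(X, Y, Z, T)` at `p` of a field `S` of 4-linear forms. -/
def covDeriv4 (g : Coord 𝕜 n → Bilin 𝕜 (Coord 𝕜 n))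
    (S : Coord 𝕜 n → Coord 𝕜 n → Coord 𝕜 n → Coord 𝕜 n → Coord 𝕜 n → 𝕜)
    (p V X Y Z T : Coord 𝕜 n) : 𝕜 :=
  fderiv 𝕜 (fun q => S q X Y Z T) p V
    - S p (christoffel g p V X) Y Z T - S p X (christoffel g p V Y) Z T
    - S p X Y (christoffel g p V Z) T - S p X Y Z (christoffel g p V T)

/-! ### Dimension four: the Hodge operator and the (anti-)self-dual parts -/

/-- `hodge g μ p β X Y = β(*(X ∧ Y))` for a bilinear alternating `β`, where `*` is the Hodge operator
on bivectors of the metric `g` with volume form `μ`, given by `g(*(X ∧ Y), Z ∧ T) = μ(X, Y, Z, T)`,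
that is, `*(X ∧ Y) = ½ ∑ μ(X, Y, e_a, e_b) e^a ∧ e^b`. -/
def hodge (g : Coord 𝕜 4 → Bilin 𝕜 (Coord 𝕜 4)) (μ : Coord 𝕜 4 → Coord 𝕜 4 [⋀^Fin 4]→L[𝕜] 𝕜)
    (p : Coord 𝕜 4) (β : Coord 𝕜 4 → Coord 𝕜 4 → 𝕜) (X Y : Coord 𝕜 4) : 𝕜 :=
  (1 / 2 : 𝕜) * ∑ a : Fin 4, ∑ b : Fin 4,
    μ p ![X, Y, stdVec a, stdVec b] * β (dualVec g p a) (dualVec g p b)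

/-- The component in `Λ^ε ⊗ Λ^ε` of the Weyl tensor, where `ε = 1` gives `W⁺` and `ε = -1` gives
`W⁻`: both pairs of arguments are projected by `(1 + ε *) / 2`. -/
def weylPart (ε : 𝕜) (g : Coord 𝕜 4 → Bilin 𝕜 (Coord 𝕜 4))
    (μ : Coord 𝕜 4 → Coord 𝕜 4 [⋀^Fin 4]→L[𝕜] 𝕜) (p X Y Z T : Coord 𝕜 4) : 𝕜 :=
  (1 / 4 : 𝕜) * (weyl g p X Y Z T
    + ε * hodge g μ p (fun A B => weyl g p A B Z T) X Y
    + ε * hodge g μ p (fun A B => weyl g p X Y A B) Z T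
    + ε ^ 2 * hodge g μ p (fun A B => hodge g μ p (fun A' B' => weyl g p A B A' B') Z T) X Y)

/-- The self-dual Weyl tensor `W⁺`. -/
def weylPlus (g : Coord 𝕜 4 → Bilin 𝕜 (Coord 𝕜 4)) (μ : Coord 𝕜 4 → Coord 𝕜 4 [⋀^Fin 4]→L[𝕜] 𝕜) :
    Coord 𝕜 4 → Coord 𝕜 4 → Coord 𝕜 4 → Coord 𝕜 4 → Coord 𝕜 4 → 𝕜 :=
  weylPart 1 g μ

/-- The anti-self-dual Weyl tensor `W⁻`. -/
def weylMinus (g : Coord 𝕜 4 → Bilin 𝕜 (Coord 𝕜 4)) (μ : Coord 𝕜 4 → Coord 𝕜 4 [⋀^Fin 4]→L[𝕜] 𝕜) :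
    Coord 𝕜 4 → Coord 𝕜 4 → Coord 𝕜 4 → Coord 𝕜 4 → Coord 𝕜 4 → 𝕜 :=
  weylPart (-1) g μ

/-- The self-dual Cotton–York tensor: the component `C⁺` of `C` in `Λ⁺ ⊗ Λ¹`. -/
def cottonPlus (g : Coord 𝕜 4 → Bilin 𝕜 (Coord 𝕜 4))
    (μ : Coord 𝕜 4 → Coord 𝕜 4 [⋀^Fin 4]→L[𝕜] 𝕜) (p X Y Z : Coord 𝕜 4) : 𝕜 :=
  (1 / 2 : 𝕜) * (cotton g p X Y Z + hodge g μ p (fun A B => cotton g p A B Z) X Y)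

end Coordinates

/-! ### Conformal manifolds -/

section Manifolds

variable {𝕜 : Type*} [RCLike 𝕜] {n : ℕ}

/-- The pull-back of a bilinear form by a linear map. -/
def pullForm {V W : Type*} [TopologicalSpace V] [AddCommGroup V] [Module 𝕜 V]
    [IsTopologicalAddGroup V] [ContinuousConstSMul 𝕜 V]
    [TopologicalSpace W] [AddCommGroup W] [Module 𝕜 W]
    [IsTopologicalAddGroup W] [ContinuousConstSMul 𝕜 W] (b : Bilin 𝕜 W) (A : V →L[𝕜] W) :
    Bilin 𝕜 V :=
  (ContinuousLinearMap.precomp 𝕜 A).comp (b.comp A)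

/-- Tangent spaces of a manifold modelled on `𝕜ⁿ`. -/
abbrev Tan (𝕜 : Type*) [RCLike 𝕜] (n : ℕ) {N : Type*} [TopologicalSpace N]
    [ChartedSpace (Coord 𝕜 n) N] (x : N) : Type _ :=
  TangentSpace 𝓘(𝕜, Coord 𝕜 n) x

/-- The smooth (if `𝕜 = ℝ`) or holomorphic (if `𝕜 = ℂ`) charts of a manifold. -/
abbrev charts (𝕜 : Type*) [RCLike 𝕜] (n : ℕ) (N : Type*) [TopologicalSpace N]
    [ChartedSpace (Coord 𝕜 n) N] : Set (OpenPartialHomeomorph N (Coord 𝕜 n)) :=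
  IsManifold.maximalAtlas 𝓘(𝕜, Coord 𝕜 n) ∞ N

variable {N : Type*} [TopologicalSpace N] [ChartedSpace (Coord 𝕜 n) N]

/-- The differential of a chart at a point `x` of its source. -/
def dChart (φ : OpenPartialHomeomorph N (Coord 𝕜 n)) (x : N) : Tan 𝕜 n x →L[𝕜] Coord 𝕜 n :=
  mfderiv 𝓘(𝕜, Coord 𝕜 n) 𝓘(𝕜, Coord 𝕜 n) φ x

/-- The differential of the inverse of a chart at a point `p` of its target. -/
def dChartSymm (φ : OpenPartialHomeomorph N (Coord 𝕜 n)) (p : Coord 𝕜 n) :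
    Coord 𝕜 n →L[𝕜] Tan 𝕜 n (φ.symm p) :=
  mfderiv 𝓘(𝕜, Coord 𝕜 n) 𝓘(𝕜, Coord 𝕜 n) φ.symm p

/-- The expression in a chart of a field of bilinear forms. -/
def coordForm (φ : OpenPartialHomeomorph N (Coord 𝕜 n)) (g : (x : N) → Bilin 𝕜 (Tan 𝕜 n x)) :
    Coord 𝕜 n → Bilin 𝕜 (Coord 𝕜 n) :=
  fun p => pullForm (g (φ.symm p)) (dChartSymm φ p)

/-- The expression in a chart of an `n`-form. -/
def coordVol (φ : OpenPartialHomeomorph N (Coord 𝕜 n))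
    (μ : (x : N) → Tan 𝕜 n x [⋀^Fin n]→L[𝕜] 𝕜) :
    Coord 𝕜 n → Coord 𝕜 n [⋀^Fin n]→L[𝕜] 𝕜 :=
  fun p => (μ (φ.symm p)).compContinuousLinearMap (dChartSymm φ p)

/-- `g` is a metric on the open set `U`: a smooth (holomorphic if `𝕜 = ℂ`) field of nondegenerate
symmetric bilinear forms. Values outside `U` are irrelevant. -/
structure IsMetricOn (U : Set N) (g : (x : N) → Bilin 𝕜 (Tan 𝕜 n x)) : Prop where
  isOpen : IsOpen U
  symm : ∀ x ∈ U, ∀ u v, g x u v = g x v u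
  nondegenerate : ∀ x ∈ U, ∀ u, (∀ v, g x u v = 0) → u = 0
  smooth : ∀ φ ∈ charts 𝕜 n N, ContDiffOn 𝕜 ∞ (coordForm φ g) (φ.target ∩ φ.symm ⁻¹' U)

variable (𝕜 n N) in
/-- A conformal structure on `N`: a line subbundle of the bundle of symmetric bilinear forms on `TN`
that is locally spanned by a metric. -/
structure ConformalStructure where
  line : (x : N) → Submodule 𝕜 (Bilin 𝕜 (Tan 𝕜 n x))
  exists_metric : ∀ x : N, ∃ (U : Set N) (g : (x : N) → Bilin 𝕜 (Tan 𝕜 n x)),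
    x ∈ U ∧ IsMetricOn U g ∧ ∀ y ∈ U, line y = Submodule.span 𝕜 {g y}

/-- `g` is a metric on the open set `U` that belongs to the conformal structure. -/
def ConformalStructure.IsLocalMetric (c : ConformalStructure 𝕜 n N) (U : Set N)
    (g : (x : N) → Bilin 𝕜 (Tan 𝕜 n x)) : Prop :=
  IsMetricOn U g ∧ ∀ x ∈ U, g x ∈ c.line x

end Manifolds

section DimensionFour

variable {𝕜 : Type*} [RCLike 𝕜] {N : Type*} [TopologicalSpace N] [ChartedSpace (Coord 𝕜 4) N]

/-- An orientation of a conformal 4-manifold: a choice, for each local metric `g` of the conformal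
structure, of one of the two volume forms of norm 1, smooth in the base point and compatible with
rescaling. For `𝕜 = ℝ` this is an orientation in the usual sense, and it requires that the
determinant of the metric be positive, that is, definite or split signature. -/
structure ConformalStructure.Orientation (c : ConformalStructure 𝕜 4 N) where
  vol : (x : N) → Bilin 𝕜 (Tan 𝕜 4 x) → Tan 𝕜 4 x [⋀^Fin 4]→L[𝕜] 𝕜
  vol_smul : ∀ (x : N), ∀ b ∈ c.line x, ∀ a : 𝕜, vol x (a • b) = a ^ 2 • vol x b
  vol_sq : ∀ (x : N), ∀ b ∈ c.line x, ∀ v : Fin 4 → Tan 𝕜 4 x,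
    vol x b v ^ 2 = Matrix.det (Matrix.of fun i j => b (v i) (v j))
  smooth : ∀ (U : Set N) (g : (x : N) → Bilin 𝕜 (Tan 𝕜 4 x)), c.IsLocalMetric U g →
    ∀ φ ∈ charts 𝕜 4 N, ∀ v : Fin 4 → Coord 𝕜 4,
      ContDiffOn 𝕜 ∞ (fun p => coordVol φ (fun x => vol x (g x)) p v) (φ.target ∩ φ.symm ⁻¹' U)

variable {c : ConformalStructure 𝕜 4 N}

/-- The volume form of a local metric `g` of an oriented conformal structure. -/
def ConformalStructure.Orientation.volForm (o : c.Orientation)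
    (g : (x : N) → Bilin 𝕜 (Tan 𝕜 4 x)) (x : N) : Tan 𝕜 4 x [⋀^Fin 4]→L[𝕜] 𝕜 :=
  o.vol x (g x)

/-- The oriented conformal 4-manifold is self-dual: `W⁻ = 0` identically. -/
def ConformalStructure.Orientation.IsSelfDual (o : c.Orientation) : Prop :=
  ∀ (U : Set N) (g : (x : N) → Bilin 𝕜 (Tan 𝕜 4 x)), c.IsLocalMetric U g →
    ∀ φ ∈ charts 𝕜 4 N, ∀ x ∈ U ∩ φ.source, ∀ X Y Z T : Coord 𝕜 4,
      weylMinus (coordForm φ g) (coordVol φ (o.volForm g)) (φ x) X Y Z T = 0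

/-! ### Hypersurfaces -/

variable {M : Type*} [TopologicalSpace M] [ChartedSpace (Coord 𝕜 3) M]

/-- The differential of `ι : M → N` at `y`. -/
def diff (ι : M → N) (y : M) : Tan 𝕜 3 y →L[𝕜] Tan 𝕜 4 (ι y) :=
  mfderiv 𝓘(𝕜, Coord 𝕜 3) 𝓘(𝕜, Coord 𝕜 4) ι y

/-- The metric induced on `M` by a metric of `N`. -/
def inducedMetric (ι : M → N) (g : (x : N) → Bilin 𝕜 (Tan 𝕜 4 x)) :
    (y : M) → Bilin 𝕜 (Tan 𝕜 3 y) :=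
  fun y => pullForm (g (ι y)) (diff ι y)

/-- `∇_X Y = D²F(X, Y) + Γ(DF X, DF Y)`: the covariant derivative at `p`, for the metric `g` on `𝕜⁴`,
of the field `DF Y` along `F : 𝕜³ → 𝕜⁴` in the direction of the constant field `X`. Its component
normal to the image of `DF` is the second fundamental form. -/
def secondDeriv (g : Coord 𝕜 4 → Bilin 𝕜 (Coord 𝕜 4)) (F : Coord 𝕜 3 → Coord 𝕜 4)
    (p X Y : Coord 𝕜 3) : Coord 𝕜 4 :=
  fderiv 𝕜 (fun q => fderiv 𝕜 F q Y) p X + christoffel g (F p) (fderiv 𝕜 F p X) (fderiv 𝕜 F p Y)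

/-- `ι : M → N` is an umbilic hypersurface of the conformal manifold `(N, c)`: an immersion on which
`c` induces nondegenerate forms, and whose second fundamental form, for every local metric `g` in
`c`, is at each point the product of `g` restricted to `M` with a normal vector, that is,
`∇_X Y` equals `g(X, Y) H` modulo vectors tangent to `M`, for some vector `H`. -/
structure IsUmbilicHypersurface (c : ConformalStructure 𝕜 4 N) (ι : M → N) : Prop where
  smooth : ContMDiff 𝓘(𝕜, Coord 𝕜 3) 𝓘(𝕜, Coord 𝕜 4) ∞ ι
  immersion : ∀ y : M, Function.Injective (diff (𝕜 := 𝕜) ι y)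
  nondegenerate : ∀ y : M, ∀ b ∈ c.line (ι y), b ≠ 0 →
    ∀ u : Tan 𝕜 3 y, (∀ v : Tan 𝕜 3 y, b (diff ι y u) (diff ι y v) = 0) → u = 0
  umbilic : ∀ (U : Set N) (g : (x : N) → Bilin 𝕜 (Tan 𝕜 4 x)), c.IsLocalMetric U g →
    ∀ φ ∈ charts 𝕜 4 N, ∀ ψ ∈ charts 𝕜 3 M, ∀ y ∈ ψ.source, ι y ∈ U ∩ φ.source →
      ∃ H : Coord 𝕜 4, ∀ X Y : Coord 𝕜 3,
        secondDeriv (coordForm φ g) (φ ∘ ι ∘ ψ.symm) (ψ y) X Y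
            - coordForm ψ (inducedMetric ι g) (ψ y) X Y • H
          ∈ LinearMap.range (fderiv 𝕜 (φ ∘ ι ∘ ψ.symm) (ψ y)).toLinearMap

/-- The Hodge operator `*ᴹ : Λ²T_yM → T_yM` on `u ∧ v`, for the metric induced by `b` on `T_yM` and the
volume form `μ(·, ·, ·, ν)` on `T_yM`, where `μ` is the volume form of `N` and `ν` is normal to `M`:
`w = *ᴹ(u ∧ v)` is the vector with `b(w, z) = μ(u, v, z, ν)` for every `z` in `T_yM`. As `T_yM` is
3-dimensional, every bivector on it has the form `u ∧ v`. -/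
def hodgeM (ι : M → N) (y : M) (b : Bilin 𝕜 (Tan 𝕜 4 (ι y)))
    (μ : Tan 𝕜 4 (ι y) [⋀^Fin 4]→L[𝕜] 𝕜) (ν : Tan 𝕜 4 (ι y)) (u v : Tan 𝕜 3 y) : Tan 𝕜 3 y :=
  (pullForm b (diff ι y)).inverse
    ((μ.toContinuousMultilinearMap.toContinuousLinearMap
      ![diff ι y u, diff ι y v, 0, ν] 2).comp (diff ι y))

/-! ### The tensors at a point of a manifold, evaluated on tangent vectors through a chart -/

/-- `W⁺(X, Y, Z, T) = g(W⁺(X ∧ Y), Z ∧ T)` at `x`, computed in the chart `φ`. -/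
def weylPlusAt (φ : OpenPartialHomeomorph N (Coord 𝕜 4)) (o : c.Orientation)
    (g : (x : N) → Bilin 𝕜 (Tan 𝕜 4 x)) (x : N) (X Y Z T : Tan 𝕜 4 x) : 𝕜 :=
  weylPlus (coordForm φ g) (coordVol φ (o.volForm g)) (φ x)
    (dChart φ x X) (dChart φ x Y) (dChart φ x Z) (dChart φ x T)

/-- `(∇_V W⁺)(X, Y, Z, T) = g((∇_V W⁺)(X ∧ Y), Z ∧ T)` at `x`, computed in the chart `φ`. -/
def covDerivWeylPlusAt (φ : OpenPartialHomeomorph N (Coord 𝕜 4)) (o : c.Orientation)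
    (g : (x : N) → Bilin 𝕜 (Tan 𝕜 4 x)) (x : N) (V X Y Z T : Tan 𝕜 4 x) : 𝕜 :=
  covDeriv4 (coordForm φ g) (weylPlus (coordForm φ g) (coordVol φ (o.volForm g))) (φ x)
    (dChart φ x V) (dChart φ x X) (dChart φ x Y) (dChart φ x Z) (dChart φ x T)

/-- `C⁺(X, Y)(Z)` at `x`, computed in the chart `φ`. -/
def cottonPlusAt (φ : OpenPartialHomeomorph N (Coord 𝕜 4)) (o : c.Orientation)
    (g : (x : N) → Bilin 𝕜 (Tan 𝕜 4 x)) (x : N) (X Y Z : Tan 𝕜 4 x) : 𝕜 :=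
  cottonPlus (coordForm φ g) (coordVol φ (o.volForm g)) (φ x)
    (dChart φ x X) (dChart φ x Y) (dChart φ x Z)

/-- The Cotton–York tensor `C(X, Y)(Z)` of a 3-manifold with metric `k` at `y`, computed in the
chart `ψ`. -/
def cottonAt (ψ : OpenPartialHomeomorph M (Coord 𝕜 3)) (k : (y : M) → Bilin 𝕜 (Tan 𝕜 3 y)) (y : M)
    (X Y Z : Tan 𝕜 3 y) : 𝕜 :=
  cotton (coordForm ψ k) (ψ y) (dChart ψ y X) (dChart ψ y Y) (dChart ψ y Z)

end DimensionFour

end SelfDualUmbilic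

end

/-! Everything is computed in charts, in orthogonal frames `a, b, c, ν` of nonisotropic vectors with
`a, b, c` tangent to M. The vectors are not normalized, so no square root is taken and one argument
serves real metrics and holomorphic ones.

Vanishing of W. For an umbilic hypersurface the Codazzi equation reads W(X, Y, ν, Z) = β(X) g(Y, Z)
- β(Y) g(X, Z) for some 1-form β (`CoordUmbilic.weyl_normal`). Self-duality means that W is fixed by
the Hodge operator, which exchanges a ∧ b with a multiple of c ∧ ν. Hence W is determined by the
symmetric form W(·, ν, ν, ·) on TM, and Codazzi makes this same form skew, so it is zero
(`codazzi_algebra`, `CoordUmbilic.weyl_eq_zero`).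

Restriction of C. Once W = 0 on M, the ambient curvature there is the product of h with g, and the
Gauss equation turns the curvature of M into the product of h + ½ g(H, H) g with g|_M. This modified
form is therefore the Schouten tensor of M (`CoordUmbilic.schouten_induced`). On skew-symmetrizing
its covariant derivative, the terms involving H add up to W(X, Y, H, Z) = 0, so C^M is the
restriction of C (`CoordUmbilic.cotton_induced`).

The normal derivative. As W vanishes on M, so do its tangential derivatives, and only S = ∇_ν W is
left in the second Bianchi identity, besides terms in C. S inherits the curvature symmetries, and it
is again fixed by the Hodge operator (`CoordMetricOn.hodge_fderiv_weyl`). Solving the Bianchi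
identity in a frame (`bianchi_algebra`) gives g(ν, ν) C(X, Y)(Z) = -S(X, Y, Z, ν) on TM, and shows
that C is self-dual on tangent bivectors; the latter is (iii). For (ii), B is replaced by its Hodge
dual, which is *ᴹB ∧ ν when g(ν, ν) = 1 (`IsCurvatureLike.apply_hodge`). -/

noncomputable section

namespace SelfDualUmbilic

open Filter Topology

/-! ### Nondegenerate forms and orthogonal frames. -/

section LinearAlgebra

variable {𝕜 : Type*} [RCLike 𝕜]

/-- Nondegeneracy of a bilinear form. -/
def Nondeg {V : Type*} [NormedAddCommGroup V] [NormedSpace 𝕜 V] (b : Bilin 𝕜 V) : Prop :=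
  ∀ u, (∀ v, b u v = 0) → u = 0

/-- Symmetry of a bilinear form. -/
def Symm {V : Type*} [NormedAddCommGroup V] [NormedSpace 𝕜 V] (b : Bilin 𝕜 V) : Prop :=
  ∀ u v, b u v = b v u

/-- A nondegenerate form, as an isomorphism onto the dual space. -/
def Nondeg.toEquiv {V : Type*} [NormedAddCommGroup V] [NormedSpace 𝕜 V] [FiniteDimensional 𝕜 V]
    {b : Bilin 𝕜 V} (hb : Nondeg b) : V ≃L[𝕜] (V →L[𝕜] 𝕜) :=
  -- Identifying the dual with V through a basis makes `b` an injective endomorphism of a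
  -- finite-dimensional space, hence bijective; the identification is undone afterwards.
  (LinearEquiv.ofInjectiveEndo
    ((((Module.finBasis 𝕜 V).toDualEquiv.trans LinearMap.toContinuousLinearMap).symm :
      (V →L[𝕜] 𝕜) →ₗ[𝕜] V) ∘ₗ (b : V →ₗ[𝕜] (V →L[𝕜] 𝕜)))
    (by
      rw [← LinearMap.ker_eq_bot, LinearMap.ker_eq_bot']
      intro u hu
      apply hb u
      have h : ((b u : V →L[𝕜] 𝕜) : V →ₗ[𝕜] 𝕜) = 0 := by simpa using hu
      exact fun v => LinearMap.congr_fun h v)).toContinuousLinearEquiv.trans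
    ((Module.finBasis 𝕜 V).toDualEquiv.trans
      LinearMap.toContinuousLinearMap).toContinuousLinearEquiv

lemma Nondeg.coe_toEquiv {V : Type*} [NormedAddCommGroup V] [NormedSpace 𝕜 V]
    [FiniteDimensional 𝕜 V] {b : Bilin 𝕜 V} (hb : Nondeg b) :
    (hb.toEquiv : V →L[𝕜] (V →L[𝕜] 𝕜)) = b := by
  ext u v
  simp [Nondeg.toEquiv]

lemma Nondeg.apply_inverse {V : Type*} [NormedAddCommGroup V] [NormedSpace 𝕜 V]
    [FiniteDimensional 𝕜 V] {b : Bilin 𝕜 V} (hb : Nondeg b) (l : V →L[𝕜] 𝕜) :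
    b (b.inverse l) = l := by
  have h := hb.coe_toEquiv
  rw [← h, ContinuousLinearMap.inverse_equiv]
  simp

variable {n : ℕ}

lemma sum_coord_smul_stdVec (x : Coord 𝕜 n) : ∑ i, x i • (stdVec i : Coord 𝕜 n) = x := by
  ext j
  simp [stdVec, Finset.sum_apply, Pi.single_apply]

lemma dualVec_spec {g : Coord 𝕜 n → Bilin 𝕜 (Coord 𝕜 n)} {p : Coord 𝕜 n} (h : Nondeg (g p))
    (i : Fin n) (v : Coord 𝕜 n) : g p (dualVec g p i) v = v i := by
  rw [dualVec, h.apply_inverse]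
  rfl

/-- The continuous linear map that agrees with `f` on the standard basis. -/
def toCLM {G : Type*} [NormedAddCommGroup G] [NormedSpace 𝕜 G] (f : Coord 𝕜 n → G) :
    Coord 𝕜 n →L[𝕜] G :=
  ∑ i, (EuclideanSpace.proj i : Coord 𝕜 n →L[𝕜] 𝕜).smulRight (f (stdVec i))

lemma toCLM_apply {G : Type*} [NormedAddCommGroup G] [NormedSpace 𝕜 G] {f : Coord 𝕜 n → G}
    (hf : IsLinearMap 𝕜 f) (x : Coord 𝕜 n) : toCLM f x = f x := by
  conv_rhs => rw [← sum_coord_smul_stdVec x]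
  have := map_sum (hf.mk' f) (fun i => x i • (stdVec i : Coord 𝕜 n)) Finset.univ
  simp only [IsLinearMap.mk'_apply] at this
  rw [this]
  simp [toCLM, hf.map_smul]

/-- Only the values on the standard basis enter `toCLM`, so no linearity of `T q` is required. This
is how tensors given as plain functions become smooth fields of bundled maps. -/
lemma contDiffAt_toCLM {E G : Type*} [NormedAddCommGroup E] [NormedSpace 𝕜 E]
    [NormedAddCommGroup G] [NormedSpace 𝕜 G] {T : E → Coord 𝕜 n → G} {p : E} {m : WithTop ℕ∞}
    (h : ∀ X, ContDiffAt 𝕜 m (fun q => T q X) p) : ContDiffAt 𝕜 m (fun q => toCLM (T q)) p := by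
  unfold toCLM
  apply ContDiffAt.sum
  intro i _
  exact ContDiffAt.smulRight contDiffAt_const (h _)

/-- `f` is an orthogonal basis of nonisotropic vectors. -/
structure IsFrame (b : Bilin 𝕜 (Coord 𝕜 n)) (f : Fin n → Coord 𝕜 n) : Prop where
  ortho : ∀ i j, i ≠ j → b (f i) (f j) = 0
  ne : ∀ i, b (f i) (f i) ≠ 0

/-- Lets an identity proved for the first vectors of every frame be used for any choice of indices.
-/
lemma IsFrame.comp {b : Bilin 𝕜 (Coord 𝕜 n)} {f : Fin n → Coord 𝕜 n} (hf : IsFrame b f)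
    (σ : Equiv.Perm (Fin n)) : IsFrame b (f ∘ σ) :=
  ⟨fun _ _ h => hf.ortho _ _ (fun h' => h (σ.injective h')), fun _ => hf.ne _⟩

/-- The bilinear form without its topology. -/
def algForm {V : Type*} [NormedAddCommGroup V] [NormedSpace 𝕜 V] (b : Bilin 𝕜 V) :
    LinearMap.BilinForm 𝕜 V :=
  LinearMap.mk₂ 𝕜 (fun u v => b u v) (by simp) (by simp) (by simp) (by simp)

lemma IsFrame.linearIndependent {b : Bilin 𝕜 (Coord 𝕜 n)} {f : Fin n → Coord 𝕜 n}
    (hf : IsFrame b f) : LinearIndependent 𝕜 f := by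
  apply LinearMap.linearIndependent_of_isOrthoᵢ (B := algForm b)
  · intro i j hij
    exact hf.ortho i j hij
  · intro i
    exact hf.ne i

/-- The basis underlying a frame. -/
def IsFrame.basis {b : Bilin 𝕜 (Coord 𝕜 n)} {f : Fin n → Coord 𝕜 n}
    (hf : IsFrame b f) : Module.Basis (Fin n) 𝕜 (Coord 𝕜 n) :=
  (Module.Basis.mk hf.linearIndependent
    (hf.linearIndependent.span_eq_top_of_card_eq_finrank' (by simp)).ge)

lemma IsFrame.basis_apply {b : Bilin 𝕜 (Coord 𝕜 n)} {f : Fin n → Coord 𝕜 n}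
    (hf : IsFrame b f) (i : Fin n) : hf.basis i = f i := by
  simp [IsFrame.basis]

lemma IsFrame.expand {b : Bilin 𝕜 (Coord 𝕜 n)} {f : Fin n → Coord 𝕜 n}
    (hf : IsFrame b f) (x : Coord 𝕜 n) : x = ∑ a, (b x (f a) / b (f a) (f a)) • f a := by
  have h := hf.basis.sum_repr x
  simp only [hf.basis_apply] at h
  have h2 : ∀ a, b x (f a) = hf.basis.repr x a * b (f a) (f a) := by
    intro a
    conv_lhs => rw [← h]
    rw [map_sum, sum_apply, Finset.sum_eq_single a]
    · simp
    · intro i _ hi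
      simp [hf.ortho i a hi]
    · simp
  conv_lhs => rw [← h]
  refine Finset.sum_congr rfl fun a _ => ?_
  rw [h2, mul_div_cancel_right₀ _ (hf.ne a)]

/-- Two linear functions that agree on a frame are equal. -/
lemma IsFrame.ext {b : Bilin 𝕜 (Coord 𝕜 n)} {f : Fin n → Coord 𝕜 n}
    (hf : IsFrame b f) {G : Type*} [AddCommGroup G] [Module 𝕜 G] {S T : Coord 𝕜 n → G}
    (hS : IsLinearMap 𝕜 S) (hT : IsLinearMap 𝕜 T)
    (h : ∀ a, S (f a) = T (f a)) (x : Coord 𝕜 n) : S x = T x := by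
  have : hS.mk' S = hT.mk' T := hf.basis.ext fun i => by simp [hf.basis_apply, h]
  exact congrArg (fun l => l x) this

/-- Traces can be computed in any frame. -/
lemma IsFrame.sum_stdVec_dualVec {g : Coord 𝕜 n → Bilin 𝕜 (Coord 𝕜 n)} {p : Coord 𝕜 n}
    {f : Fin n → Coord 𝕜 n} (hf : IsFrame (g p) f) (h : Nondeg (g p))
    {T : Coord 𝕜 n → Coord 𝕜 n → 𝕜} (h1 : ∀ y, IsLinearMap 𝕜 (fun x => T x y))
    (h2 : ∀ x, IsLinearMap 𝕜 (T x)) :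
    ∑ i, T (stdVec i) (dualVec g p i) = ∑ a, T (f a) (f a) / g p (f a) (f a) := by
  -- The dual vector is expanded in the frame: its product with `f a` is the `i`-th coordinate of `f
  -- a`.
  have key : ∀ i, T (stdVec i) (dualVec g p i)
      = ∑ a, (f a i / g p (f a) (f a)) * T (stdVec i) (f a) := by
    intro i
    conv_lhs => rw [hf.expand (dualVec g p i)]
    have := map_sum ((h2 (stdVec i)).mk' _)
      (fun a => (g p (dualVec g p i) (f a) / g p (f a) (f a)) • f a) Finset.univ
    simp only [IsLinearMap.mk'_apply, (h2 _).map_smul, smul_eq_mul] at this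
    rw [this]
    simp only [dualVec_spec h]
  simp only [key]
  rw [Finset.sum_comm]
  refine Finset.sum_congr rfl fun a _ => ?_
  have e : T (f a) (f a) = ∑ i, f a i * T (stdVec i) (f a) := by
    conv_lhs => arg 1; rw [← sum_coord_smul_stdVec (f a)]
    have := map_sum ((h1 (f a)).mk' _) (fun i => f a i • (stdVec i : Coord 𝕜 n)) Finset.univ
    simp only [IsLinearMap.mk'_apply, (h1 _).map_smul, smul_eq_mul] at this
    rw [this]
  rw [e, Finset.sum_div]
  refine Finset.sum_congr rfl fun i _ => ?_
  ring

/-- A symmetric form can be diagonalized when 2 is invertible, and nondegeneracy excludes isotropic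
vectors from an orthogonal basis. -/
lemma exists_isFrame {b : Bilin 𝕜 (Coord 𝕜 n)} (hs : Symm b) (hb : Nondeg b) :
    ∃ f, IsFrame b f := by
  have : Invertible (2 : 𝕜) := invertibleOfNonzero two_ne_zero
  have hsymm : LinearMap.IsSymm (algForm b) := ⟨fun u v => hs u v⟩
  obtain ⟨v, hv⟩ := LinearMap.BilinForm.exists_orthogonal_basis hsymm
  have hn : Module.finrank 𝕜 (Coord 𝕜 n) = n := by simp
  have hsep : (algForm b).SeparatingLeft := fun u hu => hb u hu
  have hne := hv.not_isOrtho_basis_self_of_separatingLeft hsep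
  refine ⟨fun i => v (Fin.cast hn.symm i), fun i j hij => ?_, fun i => hne _⟩
  exact hv (fun h => hij (Fin.cast_injective _ h))

end LinearAlgebra

/-! ### Connections as bilinear-map-valued functions: curvature and Bianchi identity. -/

section Calculus

variable {𝕜 : Type*} [RCLike 𝕜]
variable {E F G H : Type*} [NormedAddCommGroup E] [NormedSpace 𝕜 E]
  [NormedAddCommGroup F] [NormedSpace 𝕜 F] [NormedAddCommGroup G] [NormedSpace 𝕜 G]
  [NormedAddCommGroup H] [NormedSpace 𝕜 H]

lemma two_le_infty : (2 : WithTop ℕ∞) ≤ ∞ :=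
  WithTop.coe_le_coe.2 (le_top : (2 : ℕ∞) ≤ ⊤)

lemma _root_.DifferentiableAt.apply_const {A : E → F →L[𝕜] G} {p : E}
    (hA : DifferentiableAt 𝕜 A p) (u : F) : DifferentiableAt 𝕜 (fun q => A q u) p :=
  hA.clm_apply (differentiableAt_const u)

lemma _root_.ContDiffAt.apply_const {A : E → F →L[𝕜] G} {p : E} {m : WithTop ℕ∞}
    (hA : ContDiffAt 𝕜 m A p) (u : F) : ContDiffAt 𝕜 m (fun q => A q u) p :=
  hA.clm_apply contDiffAt_const

lemma fderiv_clm_apply_const {A : E → F →L[𝕜] G} {p : E} (hA : DifferentiableAt 𝕜 A p)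
    (u : F) (v : E) : fderiv 𝕜 (fun q => A q u) p v = fderiv 𝕜 A p v u := by
  rw [fderiv_clm_apply hA (differentiableAt_const u)]
  simp

lemma fderiv_clm_apply_const₂ {A : E → F →L[𝕜] G →L[𝕜] H} {p : E} (hA : DifferentiableAt 𝕜 A p)
    (u : F) (w : G) (v : E) : fderiv 𝕜 (fun q => A q u w) p v = fderiv 𝕜 A p v u w := by
  rw [fderiv_clm_apply_const (A := fun q => A q u) (hA.apply_const u), fderiv_clm_apply_const hA]

lemma fderiv_clm_apply' {A : E → F →L[𝕜] G} {u : E → F} {p : E} (hA : DifferentiableAt 𝕜 A p)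
    (hu : DifferentiableAt 𝕜 u p) (v : E) :
    fderiv 𝕜 (fun q => A q (u q)) p v = fderiv 𝕜 A p v (u p) + A p (fderiv 𝕜 u p v) := by
  rw [fderiv_clm_apply hA hu]
  simp [add_comm]

lemma fderiv_clm_apply₂ {A : E → F →L[𝕜] G →L[𝕜] H} {u : E → F} {w : E → G} {p : E}
    (hA : DifferentiableAt 𝕜 A p) (hu : DifferentiableAt 𝕜 u p) (hw : DifferentiableAt 𝕜 w p)
    (v : E) :
    fderiv 𝕜 (fun q => A q (u q) (w q)) p v = fderiv 𝕜 A p v (u p) (w p)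
      + A p (fderiv 𝕜 u p v) (w p) + A p (u p) (fderiv 𝕜 w p v) := by
  rw [fderiv_clm_apply' (hA.clm_apply hu) hw, fderiv_clm_apply' hA hu]
  simp

lemma contDiffAt_fderiv {f : E → F} {p : E} (hf : ContDiffAt 𝕜 ∞ f p) :
    ContDiffAt 𝕜 ∞ (fderiv 𝕜 f) p :=
  hf.fderiv_right (by simp)

lemma diffAt {f : E → F} {p : E} (hf : ContDiffAt 𝕜 ∞ f p) : DifferentiableAt 𝕜 f p :=
  hf.differentiableAt (by simp)

lemma eventually_diffAt {f : E → F} {p : E} (hf : ContDiffAt 𝕜 ∞ f p) :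
    ∀ᶠ q in 𝓝 p, DifferentiableAt 𝕜 f q := by
  filter_upwards [(hf.of_le (m := 1) (by simp)).eventually (by simp)] with q hq
  exact hq.differentiableAt (by simp)

lemma fderiv_fderiv_comm {f : E → F} {p : E} (hf : ContDiffAt 𝕜 ∞ f p) (u v : E) :
    fderiv 𝕜 (fun q => fderiv 𝕜 f q v) p u = fderiv 𝕜 (fun q => fderiv 𝕜 f q u) p v := by
  have h := diffAt (contDiffAt_fderiv hf)
  rw [fderiv_clm_apply_const h, fderiv_clm_apply_const h]
  exact (hf.isSymmSndFDerivAt (by simpa using two_le_infty)) u v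

lemma fderiv_sub_add_sub {a b c d : E → F} {p : E} (ha : DifferentiableAt 𝕜 a p)
    (hb : DifferentiableAt 𝕜 b p) (hc : DifferentiableAt 𝕜 c p) (hd : DifferentiableAt 𝕜 d p)
    (v : E) : fderiv 𝕜 (fun q => a q - b q + c q - d q) p v
      = fderiv 𝕜 a p v - fderiv 𝕜 b p v + fderiv 𝕜 c p v - fderiv 𝕜 d p v := by
  rw [fderiv_fun_sub (by fun_prop) hd, fderiv_fun_add (by fun_prop) hc, fderiv_fun_sub ha hb]
  rfl

/-- The curvature tensor of a bilinear-map-valued function. -/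
def connCurv (Γ : E → E →L[𝕜] E →L[𝕜] E)
    (p X Y Z : E) : E :=
  fderiv 𝕜 (fun q => Γ q Y Z) p X - fderiv 𝕜 (fun q => Γ q X Z) p Y
    + Γ p X (Γ p Y Z) - Γ p Y (Γ p X Z)

lemma contDiffAt_connCurv {Γ : E → E →L[𝕜] E →L[𝕜] E} {p : E}
    (h : ContDiffAt 𝕜 ∞ Γ p) (X Y Z : E) :
    ContDiffAt 𝕜 ∞ (fun q => connCurv Γ q X Y Z) p := by
  have h1 : ∀ X Y, ContDiffAt 𝕜 ∞ (fun q => Γ q X Y) p := fun X Y =>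
    (h.apply_const X).apply_const Y
  have h2 : ∀ X Y Z, ContDiffAt 𝕜 ∞ (fun q => fderiv 𝕜 (fun q => Γ q Y Z) q X) p :=
    fun X Y Z => (contDiffAt_fderiv (h1 Y Z)).apply_const X
  have h3 : ∀ X Y Z, ContDiffAt 𝕜 ∞ (fun q => Γ q X (Γ q Y Z)) p :=
    fun X Y Z => (h.apply_const X).clm_apply (h1 Y Z)
  exact (((h2 X Y Z).sub (h2 Y X Z)).add (h3 X Y Z)).sub (h3 Y X Z)

lemma fderiv_connCurv {Γ : E → E →L[𝕜] E →L[𝕜] E} {p : E}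
    (h : ContDiffAt 𝕜 ∞ Γ p) (U X Y Z : E) :
    fderiv 𝕜 (fun q => connCurv Γ q X Y Z) p U
      = fderiv 𝕜 (fun q => fderiv 𝕜 (fun q => Γ q Y Z) q X) p U
        - fderiv 𝕜 (fun q => fderiv 𝕜 (fun q => Γ q X Z) q Y) p U
        + (fderiv 𝕜 Γ p U X (Γ p Y Z) + Γ p X (fderiv 𝕜 Γ p U Y Z))
        - (fderiv 𝕜 Γ p U Y (Γ p X Z) + Γ p Y (fderiv 𝕜 Γ p U X Z)) := by
  have h0 := diffAt h
  have h1 : ∀ X Y, ContDiffAt 𝕜 ∞ (fun q => Γ q X Y) p := fun X Y =>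
    (h.apply_const X).apply_const Y
  have h2 : ∀ X Y Z, DifferentiableAt 𝕜 (fun q => fderiv 𝕜 (fun q => Γ q Y Z) q X) p :=
    fun X Y Z => diffAt ((contDiffAt_fderiv (h1 Y Z)).apply_const X)
  have h3 : ∀ X Y Z, DifferentiableAt 𝕜 (fun q => Γ q X (Γ q Y Z)) p :=
    fun X Y Z => diffAt ((h.apply_const X).clm_apply (h1 Y Z))
  have e2 : ∀ X Y Z, fderiv 𝕜 (fun q => Γ q X (Γ q Y Z)) p U
      = fderiv 𝕜 Γ p U X (Γ p Y Z) + Γ p X (fderiv 𝕜 Γ p U Y Z) := by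
    intro X Y Z
    rw [fderiv_clm_apply' (A := fun q => Γ q X) (h0.apply_const X) (diffAt (h1 Y Z)),
      fderiv_clm_apply_const h0, fderiv_clm_apply_const₂ h0]
  unfold connCurv
  rw [fderiv_sub_add_sub (h2 X Y Z) (h2 Y X Z) (h3 X Y Z) (h3 Y X Z), e2, e2]

/-- The second Bianchi identity for a symmetric connection. -/
lemma second_bianchi_connCurv
    {Γ : E → E →L[𝕜] E →L[𝕜] E} {p : E}
    (h : ContDiffAt 𝕜 ∞ Γ p) (hs : ∀ X Y, Γ p X Y = Γ p Y X) (X Y Z T : E) :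
    let D : E → E → E → E := fun U X Y =>
      fderiv 𝕜 (fun q => connCurv Γ q X Y T) p U + Γ p U (connCurv Γ p X Y T)
        - connCurv Γ p (Γ p U X) Y T - connCurv Γ p X (Γ p U Y) T - connCurv Γ p X Y (Γ p U T)
    D X Y Z + D Y Z X + D Z X Y = 0 := by
  intro D
  have h1 : ∀ X Y, ContDiffAt 𝕜 ∞ (fun q => Γ q X Y) p := fun X Y =>
    (h.apply_const X).apply_const Y
  simp only [D, fderiv_connCurv h]
  -- Second derivatives of Γ cancel because they commute. Symmetry of Γ then pairs each term with
  -- Γ(X, Y) with one with Γ(Y, X), of opposite sign since the curvature is skew in its first two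
  -- arguments.
  rw [fderiv_fderiv_comm (h1 Z T) Y X, fderiv_fderiv_comm (h1 Y T) Z X,
    fderiv_fderiv_comm (h1 X T) Z Y, hs Y X, hs Z X, hs Z Y]
  simp only [connCurv, map_add, map_sub, fderiv_clm_apply_const₂ (diffAt h)]
  abel

lemma isLinearMap_connCurv {Γ : E → E →L[𝕜] E →L[𝕜] E} {p : E}
    (h : DifferentiableAt 𝕜 Γ p) (Y Z : E) :
    IsLinearMap 𝕜 (fun X => connCurv Γ p X Y Z) := by
  have e : ∀ X, connCurv Γ p X Y Z = fderiv 𝕜 (fun q => Γ q Y Z) p X - fderiv 𝕜 Γ p Y X Z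
      + Γ p X (Γ p Y Z) - Γ p Y (Γ p X Z) := fun X => by
    rw [connCurv, fderiv_clm_apply_const₂ h X]
  constructor
  · intro X X'
    simp only [e, map_add, add_apply]
    abel
  · intro c X
    simp only [e, map_smul, smul_apply, smul_sub, smul_add]

lemma fderiv_metric_apply {g : E → E →L[𝕜] E →L[𝕜] 𝕜} {Γ : E → E →L[𝕜] E →L[𝕜] E} {p : E}
    (hg : DifferentiableAt 𝕜 g p)
    (hc : ∀ X Y Z, fderiv 𝕜 g p X Y Z = g p (Γ p X Y) Z + g p Y (Γ p X Z))
    {u w : E → E} (hu : DifferentiableAt 𝕜 u p) (hw : DifferentiableAt 𝕜 w p) (X : E) :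
    fderiv 𝕜 (fun q => g q (u q) (w q)) p X
      = g p (fderiv 𝕜 u p X + Γ p X (u p)) (w p) + g p (u p) (fderiv 𝕜 w p X + Γ p X (w p)) := by
  rw [fderiv_clm_apply₂ hg hu hw, hc]
  simp only [map_add, add_apply]
  ring

/-- The curvature of a metric connection is skew-symmetric. -/
lemma connCurv_anti {g : E → E →L[𝕜] E →L[𝕜] 𝕜} {Γ : E → E →L[𝕜] E →L[𝕜] E} {p : E}
    (hg : ContDiffAt 𝕜 ∞ g p) (hΓ : ContDiffAt 𝕜 ∞ Γ p)
    (hc : ∀ᶠ q in 𝓝 p, ∀ X Y Z, fderiv 𝕜 g q X Y Z = g q (Γ q X Y) Z + g q Y (Γ q X Z))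
    (X Y Z T : E) : g p (connCurv Γ p X Y Z) T + g p Z (connCurv Γ p X Y T) = 0 := by
  have hgd := diffAt hg
  have hΓd := diffAt hΓ
  have d1 : ∀ Y Z, DifferentiableAt 𝕜 (fun q => Γ q Y Z) p := fun Y Z =>
    (hΓd.apply_const Y).apply_const Z
  have e : ∀ X Y, fderiv 𝕜 (fun q => fderiv 𝕜 (fun q => g q Z T) q Y) p X
      = g p (fderiv 𝕜 (fun q => Γ q Y Z) p X + Γ p X (Γ p Y Z)) T + g p (Γ p Y Z) (Γ p X T)
        + (g p (Γ p X Z) (Γ p Y T)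
        + g p Z (fderiv 𝕜 (fun q => Γ q Y T) p X + Γ p X (Γ p Y T))) := by
    intro X Y
    have e1 : fderiv 𝕜 (fun q => fderiv 𝕜 (fun q => g q Z T) q Y) p
        = fderiv 𝕜 (fun q => g q (Γ q Y Z) T + g q Z (Γ q Y T)) p := by
      apply EventuallyEq.fderiv_eq
      filter_upwards [hc, eventually_diffAt hg] with q hq hgq
      rw [fderiv_clm_apply_const₂ hgq, hq Y Z T]
    rw [e1,
      fderiv_fun_add ((hgd.clm_apply (d1 Y Z)).clm_apply (differentiableAt_const T))
        ((hgd.clm_apply (differentiableAt_const Z)).clm_apply (d1 Y T)), add_apply,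
      fderiv_metric_apply hgd hc.self_of_nhds (d1 Y Z) (differentiableAt_const T),
      fderiv_metric_apply hgd hc.self_of_nhds (differentiableAt_const Z) (d1 Y T)]
    simp
  -- The second derivatives of g(Z, T) commute. The mixed terms g(Γ(Y, Z), Γ(X, T)) + g(Γ(X, Z),
  -- Γ(Y, T)) are symmetric in X, Y, so what remains is the skew-symmetry.
  have hcomm := fderiv_fderiv_comm ((hg.apply_const Z).apply_const T) X Y
  simp only [e] at hcomm
  simp only [connCurv, map_add, map_sub, add_apply, sub_apply] at hcomm ⊢
  linear_combination hcomm

end Calculus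

/-! ### The Levi-Civita connection and its curvature. -/

section Metric

variable {𝕜 : Type*} [RCLike 𝕜] {n : ℕ}

/-- A metric on an open subset of the coordinate space. -/
structure CoordMetricOn (V : Set (Coord 𝕜 n)) (g : Coord 𝕜 n → Bilin 𝕜 (Coord 𝕜 n)) : Prop where
  isOpen : IsOpen V
  symm : ∀ p ∈ V, Symm (g p)
  nondeg : ∀ p ∈ V, Nondeg (g p)
  smooth : ∀ p ∈ V, ContDiffAt 𝕜 ∞ g p

variable {V : Set (Coord 𝕜 n)} {g : Coord 𝕜 n → Bilin 𝕜 (Coord 𝕜 n)} {p : Coord 𝕜 n}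

lemma CoordMetricOn.mem_nhds (hg : CoordMetricOn V g) (hp : p ∈ V) : V ∈ 𝓝 p :=
  hg.isOpen.mem_nhds hp

lemma CoordMetricOn.contDiffAt_dualVec (hg : CoordMetricOn V g) (hp : p ∈ V) (i : Fin n) :
    ContDiffAt 𝕜 ∞ (fun q => dualVec g q i) p := by
  unfold dualVec
  refine ContDiffAt.clm_apply ?_ contDiffAt_const
  have h := contDiffAt_map_inverse (𝕜 := 𝕜) (n := ∞) (hg.nondeg p hp).toEquiv
  rw [(hg.nondeg p hp).coe_toEquiv] at h
  exact ContDiffAt.comp (𝕜 := 𝕜) p h (hg.smooth p hp)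

lemma CoordMetricOn.dMetric_eq (hg : CoordMetricOn V g) (hp : p ∈ V) (X Y Z : Coord 𝕜 n) :
    dMetric g p X Y Z = fderiv 𝕜 g p X Y Z := by
  have h := diffAt (hg.smooth p hp)
  rw [dMetric, fderiv_clm_apply_const₂ h]

lemma CoordMetricOn.fderiv_symm (hg : CoordMetricOn V g) (hp : p ∈ V) (X Y Z : Coord 𝕜 n) :
    fderiv 𝕜 g p X Y Z = fderiv 𝕜 g p X Z Y := by
  rw [← hg.dMetric_eq hp, ← hg.dMetric_eq hp, dMetric, dMetric]
  congr 1
  apply EventuallyEq.fderiv_eq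
  filter_upwards [hg.mem_nhds hp] with q hq using hg.symm q hq Y Z

/-- The Koszul formula. -/
lemma CoordMetricOn.koszul (hg : CoordMetricOn V g) (hp : p ∈ V) (X Y Z : Coord 𝕜 n) :
    g p (christoffel g p X Y) Z
      = (1 / 2 : 𝕜) * (fderiv 𝕜 g p X Y Z + fderiv 𝕜 g p Y X Z - fderiv 𝕜 g p Z X Y) := by
  simp only [christoffel, map_sum, map_smul, sum_apply, smul_apply,
    dualVec_spec (hg.nondeg p hp), hg.dMetric_eq hp, smul_eq_mul]
  conv_rhs => rw [← sum_coord_smul_stdVec Z]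
  simp only [map_sum, map_smul, sum_apply, smul_apply, smul_eq_mul,
    ← Finset.sum_add_distrib, ← Finset.sum_sub_distrib, Finset.mul_sum]
  refine Finset.sum_congr rfl fun i _ => ?_
  ring

lemma CoordMetricOn.eq_of_forall (hg : CoordMetricOn V g) (hp : p ∈ V) {u v : Coord 𝕜 n}
    (h : ∀ w, g p u w = g p v w) : u = v := by
  rw [← sub_eq_zero]
  apply hg.nondeg p hp
  intro w
  simp [h w]

/-- The Levi-Civita connection as a bilinear map. -/
def conn (g : Coord 𝕜 n → Bilin 𝕜 (Coord 𝕜 n)) (q : Coord 𝕜 n) :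
    Coord 𝕜 n →L[𝕜] Coord 𝕜 n →L[𝕜] Coord 𝕜 n :=
  toCLM fun X => toCLM fun Y => christoffel g q X Y

/-- Bilinearity of the Christoffel symbols is read off from the Koszul formula, which needs the
metric to be differentiable and nondegenerate at the point; hence the restriction to `V`. -/
lemma CoordMetricOn.conn_apply (hg : CoordMetricOn V g) (hp : p ∈ V) (X Y : Coord 𝕜 n) :
    conn g p X Y = christoffel g p X Y := by
  have h2 : ∀ X, IsLinearMap 𝕜 (fun Y => christoffel g p X Y) := by
    intro X
    refine ⟨fun Y Y' => hg.eq_of_forall hp fun w => ?_, fun c Y => hg.eq_of_forall hp fun w => ?_⟩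
    · simp only [map_add, add_apply, hg.koszul hp]
      ring
    · simp only [map_smul, smul_apply, hg.koszul hp, smul_eq_mul]
      ring
  have h1 : IsLinearMap 𝕜 (fun X => (toCLM fun Y => christoffel g p X Y)) := by
    refine ⟨fun X X' => ?_, fun c X => ?_⟩
    · ext1 Y
      simp only [add_apply, toCLM_apply (h2 _)]
      refine hg.eq_of_forall hp fun w => ?_
      simp only [map_add, add_apply, hg.koszul hp]
      ring
    · ext1 Y
      simp only [smul_apply, toCLM_apply (h2 _)]
      refine hg.eq_of_forall hp fun w => ?_
      simp only [map_smul, smul_apply, hg.koszul hp, smul_eq_mul]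
      ring
  rw [conn, toCLM_apply h1, toCLM_apply (h2 X)]

lemma CoordMetricOn.contDiffAt_conn (hg : CoordMetricOn V g) (hp : p ∈ V) :
    ContDiffAt 𝕜 ∞ (conn g) p := by
  refine contDiffAt_toCLM fun X => contDiffAt_toCLM fun Y => ?_
  unfold christoffel
  have h : ∀ X Y Z, ContDiffAt 𝕜 ∞ (fun q => dMetric g q X Y Z) p := by
    intro X Y Z
    unfold dMetric
    exact (contDiffAt_fderiv
      (((hg.smooth p hp).apply_const Y).apply_const Z)).apply_const X
  refine ContDiffAt.sum fun i _ => ?_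
  have h1 := h X Y (stdVec i)
  have h2 := h Y X (stdVec i)
  have h3 := h (stdVec i) X Y
  have h4 : ContDiffAt 𝕜 ∞ (fun q => (1 / 2 : 𝕜) * (dMetric g q X Y (stdVec i)
      + dMetric g q Y X (stdVec i) - dMetric g q (stdVec i) X Y)) p :=
    contDiffAt_const.mul ((h1.add h2).sub h3)
  exact h4.smul (hg.contDiffAt_dualVec hp i)

lemma CoordMetricOn.conn_comm (hg : CoordMetricOn V g) (hp : p ∈ V) (X Y : Coord 𝕜 n) :
    conn g p X Y = conn g p Y X := by
  simp only [hg.conn_apply hp]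
  refine hg.eq_of_forall hp fun w => ?_
  rw [hg.koszul hp, hg.koszul hp, hg.fderiv_symm hp w]
  ring

/-- The Levi-Civita connection is metric. -/
lemma CoordMetricOn.compat (hg : CoordMetricOn V g) (hp : p ∈ V) (X Y Z : Coord 𝕜 n) :
    fderiv 𝕜 g p X Y Z = g p (conn g p X Y) Z + g p Y (conn g p X Z) := by
  rw [hg.symm p hp Y]
  simp only [hg.conn_apply hp, hg.koszul hp]
  rw [hg.fderiv_symm hp X Z Y]
  ring

lemma CoordMetricOn.fderiv_conn_comm (hg : CoordMetricOn V g) (hp : p ∈ V) (U X Y : Coord 𝕜 n) :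
    fderiv 𝕜 (fun q => conn g q X Y) p U = fderiv 𝕜 (fun q => conn g q Y X) p U := by
  congr 1
  apply EventuallyEq.fderiv_eq
  filter_upwards [hg.mem_nhds hp] with q hq using hg.conn_comm hq X Y

lemma CoordMetricOn.curvature_eq_connCurv (hg : CoordMetricOn V g) (hp : p ∈ V)
    (X Y Z : Coord 𝕜 n) : curvature g p X Y Z = connCurv (conn g) p X Y Z := by
  have e : ∀ X Y Z, fderiv 𝕜 (fun q => christoffel g q Y Z) p X
      = fderiv 𝕜 (fun q => conn g q Y Z) p X := by
    intro X Y Z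
    congr 1
    apply EventuallyEq.fderiv_eq
    filter_upwards [hg.mem_nhds hp] with q hq using (hg.conn_apply hq Y Z).symm
  rw [curvature, connCurv, e, e]
  simp only [← hg.conn_apply hp]

lemma CoordMetricOn.contDiffAt_curvature (hg : CoordMetricOn V g) (hp : p ∈ V)
    (X Y Z : Coord 𝕜 n) : ContDiffAt 𝕜 ∞ (fun q => curvature g q X Y Z) p := by
  apply (contDiffAt_connCurv (hg.contDiffAt_conn hp) X Y Z).congr_of_eventuallyEq
  filter_upwards [hg.mem_nhds hp] with q hq using hg.curvature_eq_connCurv hq X Y Z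

/-- The second Bianchi identity. -/
lemma CoordMetricOn.second_bianchi (hg : CoordMetricOn V g) (hp : p ∈ V) (U X Y Z T : Coord 𝕜 n) :
    covDeriv4 g (curvatureForm g) p U X Y Z T + covDeriv4 g (curvatureForm g) p X Y U Z T
      + covDeriv4 g (curvatureForm g) p Y U X Z T = 0 := by
  have hc := hg.contDiffAt_conn hp
  -- The metric is parallel, so lowering an index commutes with covariant differentiation.
  have key : ∀ U X Y, covDeriv4 g (curvatureForm g) p U X Y Z T
      = g p (fderiv 𝕜 (fun q => connCurv (conn g) q X Y T) p U
        + conn g p U (connCurv (conn g) p X Y T)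
        - connCurv (conn g) p (conn g p U X) Y T - connCurv (conn g) p X (conn g p U Y) T
        - connCurv (conn g) p X Y (conn g p U T)) Z := by
    intro U X Y
    have e : fderiv 𝕜 (fun q => curvatureForm g q X Y Z T) p
        = fderiv 𝕜 (fun q => g q (connCurv (conn g) q X Y T) Z) p := by
      apply EventuallyEq.fderiv_eq
      filter_upwards [hg.mem_nhds hp] with q hq
      rw [curvatureForm, hg.curvature_eq_connCurv hq]
    rw [covDeriv4, e, fderiv_metric_apply (diffAt (hg.smooth p hp)) (hg.compat hp)
      (diffAt (contDiffAt_connCurv hc X Y T))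
      (differentiableAt_const _)]
    simp only [curvatureForm, hg.curvature_eq_connCurv hp, hg.conn_apply hp, map_add, map_sub,
      add_apply, sub_apply]
    simp
    ring
  have hb := second_bianchi_connCurv hc (hg.conn_comm hp) U X Y T
  simp only at hb
  rw [key, key, key, ← add_apply, ← map_add, ← add_apply, ← map_add, hb]
  simp

/-! ### Symmetries of the curvature -/

/-- The algebraic symmetries of a curvature tensor. -/
structure IsCurvatureLike (R : Coord 𝕜 n → Coord 𝕜 n → Coord 𝕜 n → Coord 𝕜 n → 𝕜) : Prop where
  linear : ∀ Y Z T, IsLinearMap 𝕜 (fun X => R X Y Z T)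
  anti : ∀ X Y Z T, R Y X Z T = -R X Y Z T
  pair : ∀ X Y Z T, R Z T X Y = R X Y Z T
  cyclic : ∀ X Y Z T, R X Y Z T + R Y Z X T + R Z X Y T = 0

lemma IsCurvatureLike.anti' {R : Coord 𝕜 n → Coord 𝕜 n → Coord 𝕜 n → Coord 𝕜 n → 𝕜}
    (hR : IsCurvatureLike R) (X Y Z T : Coord 𝕜 n) : R X Y T Z = -R X Y Z T := by
  rw [← hR.pair, hR.anti, hR.pair]

lemma IsCurvatureLike.linear₂ {R : Coord 𝕜 n → Coord 𝕜 n → Coord 𝕜 n → Coord 𝕜 n → 𝕜}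
    (hR : IsCurvatureLike R) (X Z T : Coord 𝕜 n) : IsLinearMap 𝕜 (fun Y => R X Y Z T) := by
  have : (fun Y => R X Y Z T) = fun Y => -R Y X Z T := funext fun Y => by rw [hR.anti]
  rw [this]
  exact ((hR.linear X Z T).mk' _ |> Neg.neg).isLinear

lemma IsCurvatureLike.linear₃ {R : Coord 𝕜 n → Coord 𝕜 n → Coord 𝕜 n → Coord 𝕜 n → 𝕜}
    (hR : IsCurvatureLike R) (X Y T : Coord 𝕜 n) : IsLinearMap 𝕜 (fun Z => R X Y Z T) := by
  have : (fun Z => R X Y Z T) = fun Z => R Z T X Y := funext fun Z => by rw [hR.pair]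
  rw [this]
  exact hR.linear T X Y

/-- The classical octahedron argument: four instances of the cyclic identity, combined with signs,
leave twice the pair symmetry. -/
lemma isCurvatureLike_of_anti {R : Coord 𝕜 n → Coord 𝕜 n → Coord 𝕜 n → Coord 𝕜 n → 𝕜}
    (hl : ∀ Y Z T, IsLinearMap 𝕜 (fun X => R X Y Z T))
    (h1 : ∀ X Y Z T, R Y X Z T = -R X Y Z T) (h2 : ∀ X Y Z T, R X Y T Z = -R X Y Z T)
    (hc : ∀ X Y Z T, R X Y Z T + R Y Z X T + R Z X Y T = 0) : IsCurvatureLike R := by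
  refine ⟨hl, h1, fun X Y Z T => ?_, hc⟩
  have two : (2 : 𝕜) ≠ 0 := two_ne_zero
  apply mul_left_cancel₀ two
  linear_combination -hc X Y Z T - hc Y Z T X + hc Z T X Y + hc T X Y Z + h2 Y Z X T + h2 Z T X Y
    + h1 Y T Z X - h1 X T Z Y + h2 X T Y Z - h1 Z X T Y + h2 Z X Y T - h1 X T Y Z - h2 X Y Z T
    - h2 Y T Z X

lemma CoordMetricOn.curvatureForm_anti' (hg : CoordMetricOn V g) (hp : p ∈ V)
    (X Y Z T : Coord 𝕜 n) : curvatureForm g p X Y T Z = -curvatureForm g p X Y Z T := by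
  have h := connCurv_anti (hg.smooth p hp) (hg.contDiffAt_conn hp)
    (by filter_upwards [hg.mem_nhds hp] with q hq using hg.compat hq) X Y Z T
  rw [curvatureForm, curvatureForm, hg.curvature_eq_connCurv hp, hg.curvature_eq_connCurv hp,
    hg.symm p hp _ Z]
  exact eq_neg_of_add_eq_zero_left h

lemma CoordMetricOn.isCurvatureLike (hg : CoordMetricOn V g) (hp : p ∈ V) :
    IsCurvatureLike (curvatureForm g p) := by
  refine isCurvatureLike_of_anti ?_ ?_ ?_ ?_
  · intro Y Z T
    have hl := isLinearMap_connCurv (diffAt (hg.contDiffAt_conn hp)) Y T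
    constructor
    · intro X X'
      simp only [curvatureForm, hg.curvature_eq_connCurv hp, hl.map_add, map_add, add_apply]
    · intro c X
      simp only [curvatureForm, hg.curvature_eq_connCurv hp, hl.map_smul, map_smul, smul_apply]
  · intro X Y Z T
    simp only [curvatureForm, curvature, map_add, map_sub, add_apply, sub_apply]
    ring
  · exact hg.curvatureForm_anti' hp
  · intro X Y Z T
    have h : ∀ X Y Z, g p (curvature g p X Y Z) T + g p (curvature g p Y Z X) T
        + g p (curvature g p Z X Y) T = 0 := by
      intro X Y Z
      simp only [hg.curvature_eq_connCurv hp, connCurv, map_add, map_sub, add_apply, sub_apply]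
      rw [hg.fderiv_conn_comm hp X Z Y, hg.fderiv_conn_comm hp Y Z X, hg.fderiv_conn_comm hp Z Y X,
        hg.conn_comm hp Z Y, hg.conn_comm hp Z X, hg.conn_comm hp Y X]
      ring
    -- The vector acted upon is the last argument of `curvatureForm`; exchanging the last two brings
    -- it next to X and Y, as the cyclic identity requires.
    have h1 : ∀ X Y Z, curvatureForm g p X Y Z T = -g p (curvature g p X Y Z) T := by
      intro X Y Z
      exact hg.curvatureForm_anti' hp X Y T Z
    rw [h1, h1, h1]
    linear_combination -h X Y Z

end Metric

/-! ### Ricci, Schouten, Weyl and Cotton–York tensors. -/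

section Weyl

variable {𝕜 : Type*} [RCLike 𝕜] {n : ℕ}

/-- The bilinear map that agrees with `f` on the standard basis. -/
def toCLM₂ {G : Type*} [NormedAddCommGroup G] [NormedSpace 𝕜 G] (f : Coord 𝕜 n → Coord 𝕜 n → G) :
    Coord 𝕜 n →L[𝕜] Coord 𝕜 n →L[𝕜] G :=
  toCLM fun X => toCLM (f X)

lemma toCLM₂_apply {G : Type*} [NormedAddCommGroup G] [NormedSpace 𝕜 G]
    {f : Coord 𝕜 n → Coord 𝕜 n → G} (h1 : ∀ Y, IsLinearMap 𝕜 (fun X => f X Y))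
    (h2 : ∀ X, IsLinearMap 𝕜 (f X)) (X Y : Coord 𝕜 n) : toCLM₂ f X Y = f X Y := by
  rw [toCLM₂, toCLM_apply, toCLM_apply (h2 X)]
  constructor
  · intro X X'
    ext1 Y
    simp only [add_apply, toCLM_apply (h2 _), (h1 Y).map_add]
  · intro c X
    ext1 Y
    simp only [smul_apply, toCLM_apply (h2 _), (h1 Y).map_smul]

lemma contDiffAt_toCLM₂ {E G : Type*} [NormedAddCommGroup E] [NormedSpace 𝕜 E]
    [NormedAddCommGroup G] [NormedSpace 𝕜 G] {T : E → Coord 𝕜 n → Coord 𝕜 n → G} {p : E}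
    {m : WithTop ℕ∞} (h : ∀ X Y, ContDiffAt 𝕜 m (fun q => T q X Y) p) :
    ContDiffAt 𝕜 m (fun q => toCLM₂ (T q)) p :=
  contDiffAt_toCLM fun X => contDiffAt_toCLM fun Y => h X Y

/-- Symmetric bilinear forms, as functions. -/
structure IsSymmForm (h : Coord 𝕜 n → Coord 𝕜 n → 𝕜) : Prop where
  linear : ∀ Y, IsLinearMap 𝕜 (fun X => h X Y)
  symm : ∀ X Y, h X Y = h Y X

lemma IsSymmForm.linear₂ {h : Coord 𝕜 n → Coord 𝕜 n → 𝕜} (hh : IsSymmForm h) (X : Coord 𝕜 n) :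
    IsLinearMap 𝕜 (h X) := by
  have : h X = fun Y => h Y X := funext fun Y => hh.symm X Y
  rw [this]
  exact hh.linear X

lemma Symm.isSymmForm {b : Bilin 𝕜 (Coord 𝕜 n)} (hb : Symm b) : IsSymmForm fun X Y => b X Y :=
  ⟨fun Y => ⟨fun X X' => by simp, fun c X => by simp⟩, hb⟩

/-- The Kulkarni–Nomizu product, with the index convention of `curvatureForm`. -/
def kn (h b : Coord 𝕜 n → Coord 𝕜 n → 𝕜) (X Y Z T : Coord 𝕜 n) : 𝕜 :=
  h X Z * b Y T + h Y T * b X Z - h X T * b Y Z - h Y Z * b X T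

lemma isCurvatureLike_kn {h b : Coord 𝕜 n → Coord 𝕜 n → 𝕜} (hh : IsSymmForm h)
    (hb : IsSymmForm b) : IsCurvatureLike (kn h b) := by
  refine ⟨fun Y Z T => ⟨fun X X' => ?_, fun c X => ?_⟩, fun X Y Z T => ?_, fun X Y Z T => ?_,
    fun X Y Z T => ?_⟩
  · simp only [kn, (hh.linear _).map_add, (hb.linear _).map_add]
    ring
  · simp only [kn, (hh.linear _).map_smul, (hb.linear _).map_smul, smul_eq_mul]
    ring
  · simp only [kn]
    ring
  · simp only [kn]
    rw [hh.symm Z X, hh.symm T Y, hh.symm Z Y, hh.symm T X, hb.symm Z X, hb.symm T Y,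
      hb.symm Z Y, hb.symm T X]
    ring
  · simp only [kn]
    rw [hh.symm Z X, hh.symm Z Y, hh.symm Y X, hb.symm Z X, hb.symm Z Y, hb.symm Y X]
    ring

lemma IsCurvatureLike.sub {R S : Coord 𝕜 n → Coord 𝕜 n → Coord 𝕜 n → Coord 𝕜 n → 𝕜}
    (hR : IsCurvatureLike R) (hS : IsCurvatureLike S) :
    IsCurvatureLike (fun X Y Z T => R X Y Z T - S X Y Z T) := by
  refine ⟨fun Y Z T => ⟨fun X X' => ?_, fun c X => ?_⟩, fun X Y Z T => ?_, fun X Y Z T => ?_,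
    fun X Y Z T => ?_⟩
  · simp only [(hR.linear _ _ _).map_add, (hS.linear _ _ _).map_add]
    ring
  · simp only [(hR.linear _ _ _).map_smul, (hS.linear _ _ _).map_smul, smul_eq_mul]
    ring
  · simp only [hR.anti X Y, hS.anti X Y]
    ring
  · simp only [hR.pair X Y, hS.pair X Y]
  · linear_combination hR.cyclic X Y Z T - hS.cyclic X Y Z T

/-- The trace of a bilinear form in a frame. -/
def frameTrace (b : Bilin 𝕜 (Coord 𝕜 n)) (f : Fin n → Coord 𝕜 n)
    (T : Coord 𝕜 n → Coord 𝕜 n → 𝕜) : 𝕜 :=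
  ∑ a, T (f a) (f a) / b (f a) (f a)

lemma IsFrame.frameTrace_self {b : Bilin 𝕜 (Coord 𝕜 n)} {f : Fin n → Coord 𝕜 n}
    (hf : IsFrame b f) : frameTrace b f (fun X Y => b X Y) = n := by
  simp [frameTrace, div_self (hf.ne _)]

lemma IsFrame.frameTrace_mul {b : Bilin 𝕜 (Coord 𝕜 n)} {f : Fin n → Coord 𝕜 n}
    (hf : IsFrame b f) {l : Coord 𝕜 n → 𝕜} (hl : IsLinearMap 𝕜 l) (Y : Coord 𝕜 n) :
    frameTrace b f (fun X X' => l X * b Y X') = l Y := by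
  conv_rhs => rw [hf.expand Y]
  have := map_sum (hl.mk' l) (fun a => (b Y (f a) / b (f a) (f a)) • f a) Finset.univ
  simp only [IsLinearMap.mk'_apply] at this
  rw [this, frameTrace]
  refine Finset.sum_congr rfl fun a _ => ?_
  rw [hl.map_smul, smul_eq_mul]
  ring

/-- The four terms of the product contribute tr(h) b, n h, -h and -h. Both the trace-freeness of W
and the recovery of h from the curvature rest on this. -/
lemma IsFrame.frameTrace_kn {b : Bilin 𝕜 (Coord 𝕜 n)} {f : Fin n → Coord 𝕜 n}
    (hf : IsFrame b f) (hb : Symm b) {h : Coord 𝕜 n → Coord 𝕜 n → 𝕜} (hh : IsSymmForm h)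
    (Y T : Coord 𝕜 n) :
    frameTrace b f (fun X X' => kn h (fun X Y => b X Y) X Y X' T)
      = frameTrace b f h * b Y T + ((n : 𝕜) - 2) * h Y T := by
  have e1 := hf.frameTrace_mul (hh.linear T) Y
  have e2 := hf.frameTrace_mul (hh.linear Y) T
  have e3 := hf.frameTrace_self
  rw [hh.symm T Y] at e2
  simp only [frameTrace] at *
  have : ∀ a, kn h (fun X Y => b X Y) (f a) Y (f a) T / b (f a) (f a)
      = h (f a) (f a) / b (f a) (f a) * b Y T + h Y T * (b (f a) (f a) / b (f a) (f a))
        - h (f a) T * b Y (f a) / b (f a) (f a) - h (f a) Y * b T (f a) / b (f a) (f a) := by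
    intro a
    rw [kn, hh.symm Y (f a), hb (f a) T]
    ring
  simp only [this, Finset.sum_add_distrib, Finset.sum_sub_distrib, ← Finset.sum_mul,
    ← Finset.mul_sum, e1, e2, e3]
  ring

variable {V : Set (Coord 𝕜 n)} {g : Coord 𝕜 n → Bilin 𝕜 (Coord 𝕜 n)} {p : Coord 𝕜 n}

/-- The Ricci tensor computed in a frame. -/
lemma CoordMetricOn.ricci_eq_frameTrace (hg : CoordMetricOn V g) (hp : p ∈ V)
    {f : Fin n → Coord 𝕜 n} (hf : IsFrame (g p) f) (Y T : Coord 𝕜 n) :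
    ricci g p Y T = frameTrace (g p) f (fun X X' => curvatureForm g p X Y X' T) := by
  have hR := hg.isCurvatureLike hp
  rw [frameTrace, ← hf.sum_stdVec_dualVec (hg.nondeg p hp) (fun _ => hR.linear _ _ _)
    (fun _ => hR.linear₃ _ _ _), ricci]
  refine Finset.sum_congr rfl fun i _ => ?_
  rw [curvatureForm, hg.symm p hp, dualVec_spec (hg.nondeg p hp)]

lemma CoordMetricOn.isSymmForm_ricci (hg : CoordMetricOn V g) (hp : p ∈ V) :
    IsSymmForm (ricci g p) := by
  obtain ⟨f, hf⟩ := exists_isFrame (hg.symm p hp) (hg.nondeg p hp)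
  have hR := hg.isCurvatureLike hp
  refine ⟨fun T => ⟨fun Y Y' => ?_, fun c Y => ?_⟩, fun Y T => ?_⟩
  · simp only [hg.ricci_eq_frameTrace hp hf, frameTrace, (hR.linear₂ _ _ _).map_add, add_div,
      Finset.sum_add_distrib]
  · simp only [hg.ricci_eq_frameTrace hp hf, frameTrace, (hR.linear₂ _ _ _).map_smul,
      smul_eq_mul, mul_div_assoc, Finset.mul_sum]
  · simp only [hg.ricci_eq_frameTrace hp hf, frameTrace, hR.pair _ Y]

lemma CoordMetricOn.scal_eq_frameTrace (hg : CoordMetricOn V g) (hp : p ∈ V)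
    {f : Fin n → Coord 𝕜 n} (hf : IsFrame (g p) f) :
    scal g p = frameTrace (g p) f (ricci g p) := by
  have hR := hg.isSymmForm_ricci hp
  rw [frameTrace, ← hf.sum_stdVec_dualVec (hg.nondeg p hp) hR.linear hR.linear₂, scal]

lemma CoordMetricOn.contDiffAt_ricci (hg : CoordMetricOn V g) (hp : p ∈ V) (X Y : Coord 𝕜 n) :
    ContDiffAt 𝕜 ∞ (fun q => ricci g q X Y) p := by
  unfold ricci
  refine ContDiffAt.sum fun i _ => ?_
  exact (EuclideanSpace.proj (𝕜 := 𝕜) i).contDiff.contDiffAt.comp (𝕜 := 𝕜) p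
    (hg.contDiffAt_curvature hp _ _ _)

lemma CoordMetricOn.contDiffAt_scal (hg : CoordMetricOn V g) (hp : p ∈ V) :
    ContDiffAt 𝕜 ∞ (scal g) p := by
  -- The second argument of Ricci moves with the point, so the bundled form is needed.
  have h : ContDiffAt 𝕜 ∞
      (fun q => ∑ i : Fin n, toCLM₂ (ricci g q) (stdVec i) (dualVec g q i)) p := by
    refine ContDiffAt.sum fun i _ => ?_
    exact ((contDiffAt_toCLM₂ (hg.contDiffAt_ricci hp)).apply_const _).clm_apply
      (hg.contDiffAt_dualVec hp i)
  apply h.congr_of_eventuallyEq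
  filter_upwards [hg.mem_nhds hp] with q hq
  have hR := hg.isSymmForm_ricci hq
  simp only [toCLM₂_apply hR.linear hR.linear₂, scal]

lemma CoordMetricOn.isSymmForm_schouten (hg : CoordMetricOn V g) (hp : p ∈ V) :
    IsSymmForm (schouten g p) := by
  have hR := hg.isSymmForm_ricci hp
  refine ⟨fun T => ⟨fun Y Y' => ?_, fun c Y => ?_⟩, fun Y T => ?_⟩
  · simp only [schouten, (hR.linear T).map_add, map_add, add_apply]
    ring
  · simp only [schouten, (hR.linear T).map_smul, map_smul, smul_apply, smul_eq_mul]
    ring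
  · rw [schouten, hR.symm Y T, hg.symm p hp Y T, schouten]

lemma CoordMetricOn.contDiffAt_metric_apply (hg : CoordMetricOn V g) (hp : p ∈ V)
    (X Y : Coord 𝕜 n) : ContDiffAt 𝕜 ∞ (fun q => g q X Y) p :=
  ((hg.smooth p hp).apply_const X).apply_const Y

lemma CoordMetricOn.contDiffAt_schouten (hg : CoordMetricOn V g) (hp : p ∈ V) (X Y : Coord 𝕜 n) :
    ContDiffAt 𝕜 ∞ (fun q => schouten g q X Y) p := by
  have h1 := hg.contDiffAt_scal hp
  have h2 := hg.contDiffAt_ricci hp X Y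
  have h3 := hg.contDiffAt_metric_apply hp X Y
  unfold schouten
  fun_prop

lemma CoordMetricOn.contDiffAt_curvatureForm (hg : CoordMetricOn V g) (hp : p ∈ V)
    (X Y Z T : Coord 𝕜 n) : ContDiffAt 𝕜 ∞ (fun q => curvatureForm g q X Y Z T) p :=
  ((hg.smooth p hp).clm_apply (hg.contDiffAt_curvature hp X Y T)).apply_const Z

lemma CoordMetricOn.contDiffAt_kn (hg : CoordMetricOn V g) (hp : p ∈ V)
    (X Y Z T : Coord 𝕜 n) :
    ContDiffAt 𝕜 ∞ (fun q => kn (schouten g q) (fun X Y => g q X Y) X Y Z T) p := by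
  have h1 := hg.contDiffAt_schouten hp
  have h2 := hg.contDiffAt_metric_apply hp
  unfold kn
  exact ((((h1 X Z).mul (h2 Y T)).add ((h1 Y T).mul (h2 X Z))).sub
    ((h1 X T).mul (h2 Y Z))).sub ((h1 Y Z).mul (h2 X T))

lemma weyl_eq (X Y Z T : Coord 𝕜 n) : weyl g p X Y Z T
    = curvatureForm g p X Y Z T - kn (schouten g p) (fun X Y => g p X Y) X Y Z T := rfl

lemma CoordMetricOn.contDiffAt_weyl (hg : CoordMetricOn V g) (hp : p ∈ V)
    (X Y Z T : Coord 𝕜 n) : ContDiffAt 𝕜 ∞ (fun q => weyl g q X Y Z T) p :=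
  (hg.contDiffAt_curvatureForm hp X Y Z T).sub (hg.contDiffAt_kn hp X Y Z T)

lemma CoordMetricOn.isCurvatureLike_weyl (hg : CoordMetricOn V g) (hp : p ∈ V) :
    IsCurvatureLike (weyl g p) :=
  (hg.isCurvatureLike hp).sub
    (isCurvatureLike_kn (hg.isSymmForm_schouten hp) (hg.symm p hp).isSymmForm)

/-- The trace-free part of Ricci drops out whatever its coefficient; that is why `n ≠ 0` suffices.
-/
lemma frameTrace_schouten (hg : CoordMetricOn V g) (hp : p ∈ V)
    {f : Fin n → Coord 𝕜 n} (hf : IsFrame (g p) f) (h0 : (n : 𝕜) ≠ 0) :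
    frameTrace (g p) f (schouten g p) = scal g p / (2 * ((n : 𝕜) - 1)) := by
  have e1 := hg.scal_eq_frameTrace hp hf
  have e2 := hf.frameTrace_self
  have : frameTrace (g p) f (schouten g p)
      = scal g p / (2 * n * ((n : 𝕜) - 1)) * frameTrace (g p) f (fun X Y => g p X Y)
        + (frameTrace (g p) f (ricci g p)
          - scal g p / n * frameTrace (g p) f (fun X Y => g p X Y)) / ((n : 𝕜) - 2) := by
    simp only [frameTrace, schouten, Finset.mul_sum, ← Finset.sum_sub_distrib, Finset.sum_div,
      ← Finset.sum_add_distrib]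
    refine Finset.sum_congr rfl fun a _ => ?_
    ring
  rw [this, e2, ← e1, div_mul_cancel₀ _ h0, sub_self, zero_div, add_zero, mul_assoc,
    mul_comm (n : 𝕜), ← mul_assoc, ← div_div, div_mul_cancel₀ _ h0]

/-- The Weyl tensor is trace-free. -/
lemma CoordMetricOn.frameTrace_weyl (hg : CoordMetricOn V g) (hp : p ∈ V)
    {f : Fin n → Coord 𝕜 n} (hf : IsFrame (g p) f) (h0 : (n : 𝕜) ≠ 0) (h1 : (n : 𝕜) - 1 ≠ 0)
    (h2 : (n : 𝕜) - 2 ≠ 0) (Y T : Coord 𝕜 n) :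
    frameTrace (g p) f (fun X X' => weyl g p X Y X' T) = 0 := by
  have e : frameTrace (g p) f (fun X X' => weyl g p X Y X' T)
      = frameTrace (g p) f (fun X X' => curvatureForm g p X Y X' T)
        - frameTrace (g p) f (fun X X' => kn (schouten g p) (fun X Y => g p X Y) X Y X' T) := by
    simp only [frameTrace, weyl_eq, sub_div, Finset.sum_sub_distrib]
  rw [e, hf.frameTrace_kn (hg.symm p hp) (hg.isSymmForm_schouten hp),
    ← hg.ricci_eq_frameTrace hp hf, frameTrace_schouten hg hp hf h0, schouten]
  field_simp
  ring

/-- If the curvature is the product of the metric with a symmetric form, that form is the Schouten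
tensor. -/
lemma CoordMetricOn.schouten_eq_of_curvatureForm (hg : CoordMetricOn V g) (hp : p ∈ V)
    (h0 : (n : 𝕜) ≠ 0) (h1 : (n : 𝕜) - 1 ≠ 0) (h2 : (n : 𝕜) - 2 ≠ 0)
    {k : Coord 𝕜 n → Coord 𝕜 n → 𝕜} (hk : IsSymmForm k)
    (h : ∀ X Y Z T, curvatureForm g p X Y Z T = kn k (fun X Y => g p X Y) X Y Z T)
    (X Y : Coord 𝕜 n) : schouten g p X Y = k X Y := by
  obtain ⟨f, hf⟩ := exists_isFrame (hg.symm p hp) (hg.nondeg p hp)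
  have e1 : ∀ Y T, ricci g p Y T = frameTrace (g p) f k * g p Y T + ((n : 𝕜) - 2) * k Y T := by
    intro Y T
    rw [hg.ricci_eq_frameTrace hp hf]
    simp only [h]
    exact hf.frameTrace_kn (hg.symm p hp) hk Y T
  have e2 : scal g p = 2 * ((n : 𝕜) - 1) * frameTrace (g p) f k := by
    rw [hg.scal_eq_frameTrace hp hf]
    have : frameTrace (g p) f (ricci g p)
        = frameTrace (g p) f k * frameTrace (g p) f (fun X Y => g p X Y)
          + ((n : 𝕜) - 2) * frameTrace (g p) f k := by
      conv_lhs => rw [frameTrace]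
      conv_rhs => arg 2; rw [frameTrace]
      conv_rhs => arg 1; arg 2; rw [frameTrace]
      rw [Finset.mul_sum, Finset.mul_sum, ← Finset.sum_add_distrib]
      refine Finset.sum_congr rfl fun a _ => ?_
      rw [e1]
      ring
    rw [this, hf.frameTrace_self]
    ring
  -- Ric = tr(k) g + (n - 2) k and Scal = 2(n - 1) tr(k); the normalization of the Schouten tensor
  -- inverts these relations.
  rw [schouten, e1, e2]
  field_simp
  ring

/-- The covariant derivative of the Schouten tensor. -/
def covSchouten (g : Coord 𝕜 n → Bilin 𝕜 (Coord 𝕜 n)) (p X Y Z : Coord 𝕜 n) : 𝕜 :=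
  fderiv 𝕜 (fun q => schouten g q Y Z) p X
    - schouten g p (conn g p X Y) Z - schouten g p Y (conn g p X Z)

lemma CoordMetricOn.cotton_eq (hg : CoordMetricOn V g) (hp : p ∈ V) (X Y Z : Coord 𝕜 n) :
    cotton g p X Y Z = covSchouten g p X Y Z - covSchouten g p Y X Z := by
  simp only [cotton, covSchouten, hg.conn_apply hp]

lemma fderiv_mul_add_mul_sub_sub {E : Type*} [NormedAddCommGroup E] [NormedSpace 𝕜 E]
    {a a' b b' c c' d d' : E → 𝕜} {p : E} (ha : DifferentiableAt 𝕜 a p)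
    (ha' : DifferentiableAt 𝕜 a' p) (hb : DifferentiableAt 𝕜 b p) (hb' : DifferentiableAt 𝕜 b' p)
    (hc : DifferentiableAt 𝕜 c p) (hc' : DifferentiableAt 𝕜 c' p) (hd : DifferentiableAt 𝕜 d p)
    (hd' : DifferentiableAt 𝕜 d' p) (v : E) :
    fderiv 𝕜 (fun q => a q * a' q + b q * b' q - c q * c' q - d q * d' q) p v
      = a p * fderiv 𝕜 a' p v + fderiv 𝕜 a p v * a' p + b p * fderiv 𝕜 b' p v
        + fderiv 𝕜 b p v * b' p - (c p * fderiv 𝕜 c' p v + fderiv 𝕜 c p v * c' p)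
        - (d p * fderiv 𝕜 d' p v + fderiv 𝕜 d p v * d' p) := by
  rw [fderiv_fun_sub (by fun_prop) (by fun_prop), fderiv_fun_sub (by fun_prop) (by fun_prop),
    fderiv_fun_add (by fun_prop) (by fun_prop), fderiv_fun_mul ha ha', fderiv_fun_mul hb hb',
    fderiv_fun_mul hc hc', fderiv_fun_mul hd hd']
  simp only [sub_apply, add_apply, smul_apply, smul_eq_mul]
  ring

/-- The metric is parallel, so the Leibniz rule only sees the Schouten factor. -/
lemma CoordMetricOn.covDeriv4_kn (hg : CoordMetricOn V g) (hp : p ∈ V) (U X Y Z T : Coord 𝕜 n) :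
    covDeriv4 g (fun q => kn (schouten g q) (fun X Y => g q X Y)) p U X Y Z T
      = kn (covSchouten g p U) (fun X Y => g p X Y) X Y Z T := by
  have h1 : ∀ X Y, DifferentiableAt 𝕜 (fun q => schouten g q X Y) p :=
    fun X Y => diffAt (hg.contDiffAt_schouten hp X Y)
  have h2 : ∀ X Y, DifferentiableAt 𝕜 (fun q => g q X Y) p :=
    fun X Y => diffAt (hg.contDiffAt_metric_apply hp X Y)
  have e : ∀ Y Z, fderiv 𝕜 (fun q => g q Y Z) p U
      = g p (conn g p U Y) Z + g p Y (conn g p U Z) := by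
    intro Y Z
    rw [fderiv_clm_apply_const₂ (diffAt (hg.smooth p hp)), hg.compat hp]
  simp only [covDeriv4, kn, covSchouten, ← hg.conn_apply hp]
  rw [fderiv_mul_add_mul_sub_sub (h1 X Z) (h2 Y T) (h1 Y T) (h2 X Z) (h1 X T) (h2 Y Z) (h1 Y Z)
    (h2 X T), e, e, e, e]
  ring

lemma covDeriv4_sub {R S : Coord 𝕜 n → Coord 𝕜 n → Coord 𝕜 n → Coord 𝕜 n → Coord 𝕜 n → 𝕜}
    {U X Y Z T : Coord 𝕜 n} (hR : DifferentiableAt 𝕜 (fun q => R q X Y Z T) p)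
    (hS : DifferentiableAt 𝕜 (fun q => S q X Y Z T) p) :
    covDeriv4 g (fun q X Y Z T => R q X Y Z T - S q X Y Z T) p U X Y Z T
      = covDeriv4 g R p U X Y Z T - covDeriv4 g S p U X Y Z T := by
  simp only [covDeriv4]
  rw [fderiv_fun_sub hR hS]
  simp only [sub_apply]
  ring

/-- The second Bianchi identity in terms of the Weyl and Cotton–York tensors. -/
lemma CoordMetricOn.second_bianchi_weyl (hg : CoordMetricOn V g) (hp : p ∈ V)
    (U X Y Z T : Coord 𝕜 n) :
    covDeriv4 g (weyl g) p U X Y Z T + covDeriv4 g (weyl g) p X Y U Z T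
      + covDeriv4 g (weyl g) p Y U X Z T
      + (cotton g p U X Z * g p Y T - cotton g p U X T * g p Y Z
        + (cotton g p X Y Z * g p U T - cotton g p X Y T * g p U Z)
        + (cotton g p Y U Z * g p X T - cotton g p Y U T * g p X Z)) = 0 := by
  have key : ∀ U X Y, covDeriv4 g (weyl g) p U X Y Z T = covDeriv4 g (curvatureForm g) p U X Y Z T
      - kn (covSchouten g p U) (fun X Y => g p X Y) X Y Z T := by
    intro U X Y
    rw [← hg.covDeriv4_kn hp]
    exact covDeriv4_sub (diffAt (hg.contDiffAt_curvatureForm hp X Y Z T))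
      (diffAt (hg.contDiffAt_kn hp X Y Z T))
  -- With R = W + h ∧ I, the cyclic sum of the derivatives of h groups into the skew-symmetrized
  -- differences that define C.
  have hb := hg.second_bianchi hp U X Y Z T
  simp only [key, hg.cotton_eq hp, kn]
  linear_combination hb

end Weyl

/-! ### The Hodge operator on bivectors and self-dual Weyl tensors. -/

section Hodge

variable {𝕜 : Type*} [RCLike 𝕜]

section Volume

variable (m : Coord 𝕜 4 [⋀^Fin 4]→L[𝕜] 𝕜)

lemma vol_swap₀₁ (X Y Z T : Coord 𝕜 4) : m ![Y, X, Z, T] = -m ![X, Y, Z, T] := by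
  have h := m.toAlternatingMap.map_swap ![X, Y, Z, T] (i := 0) (j := 1) (by decide)
  have e : (![X, Y, Z, T] ∘ Equiv.swap (0 : Fin 4) 1) = ![Y, X, Z, T] := by
    ext i : 1
    fin_cases i <;> rfl
  rw [e] at h
  exact h

lemma vol_swap₂₃ (X Y Z T : Coord 𝕜 4) : m ![X, Y, T, Z] = -m ![X, Y, Z, T] := by
  have h := m.toAlternatingMap.map_swap ![X, Y, Z, T] (i := 2) (j := 3) (by decide)
  have e : (![X, Y, Z, T] ∘ Equiv.swap (2 : Fin 4) 3) = ![X, Y, T, Z] := by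
    ext i : 1
    fin_cases i <;> rfl
  rw [e] at h
  exact h

lemma vol_linear₀ (Y Z T : Coord 𝕜 4) : IsLinearMap 𝕜 fun X => m ![X, Y, Z, T] := by
  have e : ∀ X, ![X, Y, Z, T] = Function.update ![0, Y, Z, T] 0 X := by
    intro X
    ext i : 1
    fin_cases i <;> rfl
  constructor
  · intro X X'
    have h := m.toMultilinearMap.map_update_add ![0, Y, Z, T] 0 X X'
    rw [← e, ← e, ← e] at h
    exact h
  · intro c X
    have h := m.toMultilinearMap.map_update_smul ![0, Y, Z, T] 0 c X
    rw [← e, ← e] at h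
    exact h

lemma vol_linear₂ (X Y T : Coord 𝕜 4) : IsLinearMap 𝕜 fun Z => m ![X, Y, Z, T] := by
  have e : ∀ Z, ![X, Y, Z, T] = Function.update ![X, Y, 0, T] 2 Z := by
    intro X
    ext i : 1
    fin_cases i <;> rfl
  constructor
  · intro Z Z'
    have h := m.toMultilinearMap.map_update_add ![X, Y, 0, T] 2 Z Z'
    rw [← e, ← e, ← e] at h
    exact h
  · intro c Z
    have h := m.toMultilinearMap.map_update_smul ![X, Y, 0, T] 2 c Z
    rw [← e, ← e] at h
    exact h

lemma vol_linear₃ (X Y Z : Coord 𝕜 4) : IsLinearMap 𝕜 fun T => m ![X, Y, Z, T] := by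
  have e : (fun T => m ![X, Y, Z, T]) = fun T => -m ![X, Y, T, Z] :=
    funext fun T => vol_swap₂₃ m X Y T Z
  have h := vol_linear₂ m X Y Z
  rw [e]
  exact ⟨fun a b => by rw [h.map_add]; ring, fun c a => by rw [h.map_smul]; simp⟩

lemma vol_eq_zero {X : Fin 4 → Coord 𝕜 4} (i j : Fin 4) (hij : i ≠ j) (h : X i = X j) :
    m X = 0 :=
  m.toAlternatingMap.map_eq_zero_of_eq X h hij

end Volume

/-- Alternating bilinear forms, as functions. -/
structure IsAltForm {n : ℕ} (β : Coord 𝕜 n → Coord 𝕜 n → 𝕜) : Prop where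
  linear : ∀ Y, IsLinearMap 𝕜 (fun X => β X Y)
  anti : ∀ X Y, β Y X = -β X Y

lemma IsAltForm.linear₂ {n : ℕ} {β : Coord 𝕜 n → Coord 𝕜 n → 𝕜} (hβ : IsAltForm β)
    (X : Coord 𝕜 n) : IsLinearMap 𝕜 (β X) := by
  have e : β X = fun Y => -β Y X := funext fun Y => hβ.anti Y X
  have h := hβ.linear X
  rw [e]
  exact ⟨fun a b => by rw [h.map_add]; ring, fun c a => by rw [h.map_smul]; simp⟩

lemma IsAltForm.self {n : ℕ} {β : Coord 𝕜 n → Coord 𝕜 n → 𝕜} (hβ : IsAltForm β)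
    (X : Coord 𝕜 n) : β X X = 0 :=
  self_eq_neg.1 (hβ.anti X X)

lemma IsAltForm.comp {m n : ℕ} {β : Coord 𝕜 n → Coord 𝕜 n → 𝕜} (hβ : IsAltForm β)
    (L : Coord 𝕜 m →L[𝕜] Coord 𝕜 n) : IsAltForm fun X Y => β (L X) (L Y) := by
  refine ⟨fun Y => ⟨fun a b => ?_, fun c a => ?_⟩, fun X Y => hβ.anti _ _⟩
  · rw [map_add, (hβ.linear _).map_add]
  · rw [map_smul, (hβ.linear _).map_smul]

lemma IsCurvatureLike.isAltForm {n : ℕ} {R : Coord 𝕜 n → Coord 𝕜 n → Coord 𝕜 n → Coord 𝕜 n → 𝕜}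
    (hR : IsCurvatureLike R) (Z T : Coord 𝕜 n) : IsAltForm (fun X Y => R X Y Z T) :=
  ⟨fun _ => hR.linear _ _ _, fun _ _ => hR.anti _ _ _ _⟩

lemma IsCurvatureLike.isAltForm' {n : ℕ} {R : Coord 𝕜 n → Coord 𝕜 n → Coord 𝕜 n → Coord 𝕜 n → 𝕜}
    (hR : IsCurvatureLike R) (X Y : Coord 𝕜 n) : IsAltForm (R X Y) :=
  ⟨fun _ => hR.linear₃ _ _ _, fun _ _ => hR.anti' _ _ _ _⟩

lemma exists_perm_eq (i j : Fin 4) (h : i ≠ j) :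
    ∃ σ : Equiv.Perm (Fin 4), σ 0 = i ∧ σ 1 = j := by
  revert i j
  decide

/-- Any two distinct indices are the first two after a reordering, so frame computations may be
confined to the pair (0, 1). -/
lemma IsFrame.altForm_ext {b : Bilin 𝕜 (Coord 𝕜 4)} {f : Fin 4 → Coord 𝕜 4} (hf : IsFrame b f)
    {β γ : Coord 𝕜 4 → Coord 𝕜 4 → 𝕜} (hβ : IsAltForm β) (hγ : IsAltForm γ)
    (h : ∀ σ : Equiv.Perm (Fin 4), β (f (σ 0)) (f (σ 1)) = γ (f (σ 0)) (f (σ 1)))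
    (X Y : Coord 𝕜 4) : β X Y = γ X Y := by
  refine hf.ext (S := fun X => β X Y) (T := fun X => γ X Y) (hβ.linear Y) (hγ.linear Y)
    (fun i => ?_) X
  refine hf.ext (S := β (f i)) (T := γ (f i)) (hβ.linear₂ _) (hγ.linear₂ _) (fun j => ?_) Y
  by_cases hij : i = j
  · rw [hij, hβ.self, hγ.self]
  · obtain ⟨σ, rfl, rfl⟩ := exists_perm_eq i j hij
    exact h σ

/-- The version for one fixed frame, when its vectors play different roles. -/
lemma IsFrame.altForm_ext_six {b : Bilin 𝕜 (Coord 𝕜 4)} {f : Fin 4 → Coord 𝕜 4}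
    (hf : IsFrame b f) {β γ : Coord 𝕜 4 → Coord 𝕜 4 → 𝕜} (hβ : IsAltForm β) (hγ : IsAltForm γ)
    (h01 : β (f 0) (f 1) = γ (f 0) (f 1)) (h02 : β (f 0) (f 2) = γ (f 0) (f 2))
    (h03 : β (f 0) (f 3) = γ (f 0) (f 3)) (h12 : β (f 1) (f 2) = γ (f 1) (f 2))
    (h13 : β (f 1) (f 3) = γ (f 1) (f 3)) (h23 : β (f 2) (f 3) = γ (f 2) (f 3))
    (X Y : Coord 𝕜 4) : β X Y = γ X Y := by
  have lt : ∀ i j : Fin 4, i < j → β (f i) (f j) = γ (f i) (f j) := by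
    intro i j hij
    fin_cases i <;> fin_cases j <;> first | assumption | exact absurd hij (by decide)
  refine hf.altForm_ext hβ hγ (fun σ => ?_) X Y
  rcases lt_trichotomy (σ 0) (σ 1) with h | h | h
  · exact lt _ _ h
  · exact absurd (σ.injective h) (by decide)
  · rw [hβ.anti, hγ.anti, lt _ _ h]

variable {V : Set (Coord 𝕜 4)} {g : Coord 𝕜 4 → Bilin 𝕜 (Coord 𝕜 4)}
  {μ : Coord 𝕜 4 → Coord 𝕜 4 [⋀^Fin 4]→L[𝕜] 𝕜} {p : Coord 𝕜 4}

/-- The skew-symmetry comes from the volume form, so nothing is asked of `β`. -/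
lemma isAltForm_hodge (β : Coord 𝕜 4 → Coord 𝕜 4 → 𝕜) : IsAltForm (hodge g μ p β) := by
  refine ⟨fun Y => ⟨fun X X' => ?_, fun c X => ?_⟩, fun X Y => ?_⟩
  · simp only [hodge, (vol_linear₀ (μ p) _ _ _).map_add, add_mul, Finset.sum_add_distrib, mul_add]
  · simp only [hodge, (vol_linear₀ (μ p) _ _ _).map_smul, smul_eq_mul, mul_assoc,
      ← Finset.mul_sum]
    ring
  · simp only [hodge, vol_swap₀₁ (μ p) X Y, neg_mul, Finset.sum_neg_distrib, mul_neg]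

/-- The Hodge operator in a frame. -/
lemma IsFrame.hodge_apply {f : Fin 4 → Coord 𝕜 4} (hf : IsFrame (g p) f) (hg : Nondeg (g p))
    {β : Coord 𝕜 4 → Coord 𝕜 4 → 𝕜} (hβ : IsAltForm β) :
    hodge g μ p β (f 0) (f 1)
      = μ p f * β (f 2) (f 3) / (g p (f 2) (f 2) * g p (f 3) (f 3)) := by
  have e1 : ∀ x y, ∑ b, μ p ![f 0, f 1, x, stdVec b] * β y (dualVec g p b)
      = ∑ b, μ p ![f 0, f 1, x, f b] * β y (f b) / g p (f b) (f b) := by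
    intro x y
    have h1 := vol_linear₃ (μ p) (f 0) (f 1) x
    have h2 := hβ.linear₂ y
    refine hf.sum_stdVec_dualVec hg (T := fun a b => μ p ![f 0, f 1, x, a] * β y b) ?_ ?_
    · exact fun b => ⟨fun a a' => by rw [h1.map_add]; ring,
        fun c a => by rw [h1.map_smul]; simp [mul_assoc]⟩
    · exact fun a => ⟨fun b b' => by rw [h2.map_add]; ring,
        fun c b => by rw [h2.map_smul]; simp; ring⟩
  have e2 : ∑ a, ∑ b, μ p ![f 0, f 1, stdVec a, f b] * β (dualVec g p a) (f b) / g p (f b) (f b)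
      = ∑ a, (∑ b, μ p ![f 0, f 1, f a, f b] * β (f a) (f b) / g p (f b) (f b))
        / g p (f a) (f a) := by
    refine hf.sum_stdVec_dualVec hg
      (T := fun x y => ∑ b, μ p ![f 0, f 1, x, f b] * β y (f b) / g p (f b) (f b)) ?_ ?_
    · refine fun y => ⟨fun a a' => ?_, fun c a => ?_⟩
      · simp only [(vol_linear₂ (μ p) _ _ _).map_add, add_mul, add_div, Finset.sum_add_distrib]
      · simp only [(vol_linear₂ (μ p) _ _ _).map_smul, smul_eq_mul, mul_assoc, mul_div_assoc,
          Finset.mul_sum]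
    · refine fun x => ⟨fun a a' => ?_, fun c a => ?_⟩
      · simp only [(hβ.linear _).map_add, mul_add, add_div, Finset.sum_add_distrib]
      · simp only [(hβ.linear _).map_smul, smul_eq_mul, Finset.mul_sum]
        exact Finset.sum_congr rfl fun _ _ => by ring
  -- Of the sixteen terms only those with indices (2, 3) and (3, 2) survive; they are equal, which
  -- absorbs the factor ½.
  have z1 : ∀ b, μ p ![f 0, f 1, f 0, f b] = 0 := fun b => vol_eq_zero _ 0 2 (by decide) rfl
  have z2 : ∀ b, μ p ![f 0, f 1, f 1, f b] = 0 := fun b => vol_eq_zero _ 1 2 (by decide) rfl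
  have z3 : ∀ b, μ p ![f 0, f 1, f b, f 0] = 0 := fun b => vol_eq_zero _ 0 3 (by decide) rfl
  have z4 : ∀ b, μ p ![f 0, f 1, f b, f 1] = 0 := fun b => vol_eq_zero _ 1 3 (by decide) rfl
  have z5 : ∀ b, μ p ![f 0, f 1, f b, f b] = 0 := fun b => vol_eq_zero _ 2 3 (by decide) rfl
  have e4 : μ p ![f 0, f 1, f 2, f 3] = μ p f := by
    congr 1
    ext i : 1
    fin_cases i <;> rfl
  have e5 : μ p ![f 0, f 1, f 3, f 2] = -μ p f := by rw [vol_swap₂₃, e4]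
  simp only [hodge, e1]
  rw [e2]
  simp only [Fin.sum_univ_four, z1, z2, z3, z4, z5, e4, e5, hβ.anti (f 2) (f 3)]
  have := hf.ne 2
  have := hf.ne 3
  field_simp
  ring

/-- The Gram matrix of a frame is diagonal. This square is the only normalization of the volume form
that the frame computations use. -/
lemma IsFrame.vol_sq {f : Fin 4 → Coord 𝕜 4} (hf : IsFrame (g p) f)
    (hμ : ∀ v, μ p v ^ 2 = Matrix.det (Matrix.of fun i j => g p (v i) (v j))) :
    μ p f ^ 2 = g p (f 0) (f 0) * g p (f 1) (f 1) * g p (f 2) (f 2) * g p (f 3) (f 3) := by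
  have e : (Matrix.of fun i j => g p (f i) (f j)) = Matrix.diagonal fun i => g p (f i) (f i) := by
    ext i j
    by_cases h : i = j
    · simp [h]
    · simp [h, hf.ortho i j h]
  rw [hμ, e, Matrix.det_diagonal, Fin.prod_univ_four]

/-- Even reorderings keep `m f`, so the formula for the Hodge operator on the pair (0, 1) carries
over to the other pairs without a sign. -/
lemma vol_perm (m : Coord 𝕜 4 [⋀^Fin 4]→L[𝕜] 𝕜) (f : Fin 4 → Coord 𝕜 4)
    (σ : Equiv.Perm (Fin 4)) (h : Equiv.Perm.sign σ = 1) : m (f ∘ σ) = m f := by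
  have := m.toAlternatingMap.map_perm f σ
  rw [h, one_smul] at this
  exact this

/-- The permutation `0 ↦ 2, 1 ↦ 3, 2 ↦ 0, 3 ↦ 1`. -/
def swapPairs : Equiv.Perm (Fin 4) := Equiv.swap 0 2 * Equiv.swap 1 3

/-- The permutation `0 ↦ 0, 1 ↦ 2, 2 ↦ 3, 3 ↦ 1`. -/
def rotate : Equiv.Perm (Fin 4) := Equiv.swap 1 3 * Equiv.swap 1 2

lemma IsFrame.hodge_apply₂₃ {f : Fin 4 → Coord 𝕜 4} (hf : IsFrame (g p) f) (hg : Nondeg (g p))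
    {β : Coord 𝕜 4 → Coord 𝕜 4 → 𝕜} (hβ : IsAltForm β) :
    hodge g μ p β (f 2) (f 3)
      = μ p f * β (f 0) (f 1) / (g p (f 0) (f 0) * g p (f 1) (f 1)) := by
  have h := (hf.comp swapPairs).hodge_apply hg hβ (μ := μ)
  rw [vol_perm _ _ _ (by decide)] at h
  simpa only [Function.comp_apply, show swapPairs 0 = 2 by decide, show swapPairs 1 = 3 by decide,
    show swapPairs 2 = 0 by decide, show swapPairs 3 = 1 by decide] using h

lemma IsFrame.hodge_apply₀₂ {f : Fin 4 → Coord 𝕜 4} (hf : IsFrame (g p) f) (hg : Nondeg (g p))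
    {β : Coord 𝕜 4 → Coord 𝕜 4 → 𝕜} (hβ : IsAltForm β) :
    hodge g μ p β (f 0) (f 2)
      = μ p f * β (f 3) (f 1) / (g p (f 3) (f 3) * g p (f 1) (f 1)) := by
  have h := (hf.comp rotate).hodge_apply hg hβ (μ := μ)
  rw [vol_perm _ _ _ (by decide)] at h
  simpa only [Function.comp_apply, show rotate 0 = 0 by decide, show rotate 1 = 2 by decide,
    show rotate 2 = 3 by decide, show rotate 3 = 1 by decide] using h

/-- Two applications multiply by μ(f)² over the product of all g(fᵢ, fᵢ), which is 1. The sign is +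
because the square of μ equals the Gram determinant, not its negative. -/
lemma hodge_hodge (hs : Symm (g p)) (hg : Nondeg (g p))
    (hμ : ∀ v, μ p v ^ 2 = Matrix.det (Matrix.of fun i j => g p (v i) (v j)))
    {β : Coord 𝕜 4 → Coord 𝕜 4 → 𝕜} (hβ : IsAltForm β) (X Y : Coord 𝕜 4) :
    hodge g μ p (hodge g μ p β) X Y = β X Y := by
  obtain ⟨f, hf⟩ := exists_isFrame hs hg
  have key : ∀ f, IsFrame (g p) f → hodge g μ p (hodge g μ p β) (f 0) (f 1) = β (f 0) (f 1) := by
    intro f hf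
    rw [hf.hodge_apply hg (isAltForm_hodge β), hf.hodge_apply₂₃ hg hβ]
    have h2 := hf.vol_sq hμ
    have := hf.ne 0
    have := hf.ne 1
    have := hf.ne 2
    have := hf.ne 3
    field_simp
    linear_combination β (f 0) (f 1) * h2
  exact hf.altForm_ext (isAltForm_hodge _) hβ (fun σ => key (f ∘ σ) (hf.comp σ)) X Y

/-- A trace-free curvature tensor commutes with the Hodge operator. -/
lemma hodge_comm (hs : Symm (g p)) (hg : Nondeg (g p))
    {W : Coord 𝕜 4 → Coord 𝕜 4 → Coord 𝕜 4 → Coord 𝕜 4 → 𝕜} (hW : IsCurvatureLike W)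
    (htr : ∀ f, IsFrame (g p) f → ∀ Y T, frameTrace (g p) f (fun X X' => W X Y X' T) = 0)
    (X Y Z T : Coord 𝕜 4) :
    hodge g μ p (fun A B => W A B Z T) X Y = hodge g μ p (W X Y) Z T := by
  obtain ⟨f, hf⟩ := exists_isFrame hs hg
  have hself : ∀ X Z T, W X X Z T = 0 := fun X Z T => (hW.isAltForm Z T).self X
  have hself' : ∀ X Z T, W Z T X X = 0 := fun X Z T => (hW.isAltForm' Z T).self X
  -- the common index
  have k02 : ∀ f, IsFrame (g p) f → hodge g μ p (fun A B => W A B (f 0) (f 2)) (f 0) (f 1)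
      = hodge g μ p (W (f 0) (f 1)) (f 0) (f 2) := by
    intro f hf
    rw [hf.hodge_apply hg (hW.isAltForm _ _), hf.hodge_apply₀₂ hg (hW.isAltForm' _ _)]
    -- In this trace only `f 1` and `f 2` contribute, and these two terms are the two sides of the
    -- claim up to symmetries of W.
    have h := htr f hf (f 3) (f 0)
    simp only [frameTrace, Fin.sum_univ_four, hself, hself', zero_div, add_zero, zero_add] at h
    rw [hW.anti' (f 2) (f 3) (f 2) (f 0), hW.anti (f 1) (f 0), hW.anti' (f 1) (f 0) (f 1) (f 3),
      hW.pair (f 1) (f 3) (f 1) (f 0)]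
    linear_combination -(μ p f / g p (f 3) (f 3)) * h
  have k23 : ∀ f, IsFrame (g p) f → hodge g μ p (fun A B => W A B (f 2) (f 3)) (f 0) (f 1)
      = hodge g μ p (W (f 0) (f 1)) (f 2) (f 3) := by
    intro f hf
    rw [hf.hodge_apply hg (hW.isAltForm _ _), hf.hodge_apply₂₃ hg (hW.isAltForm' _ _)]
    -- With kᵢⱼ = W(fᵢ, fⱼ, fᵢ, fⱼ) / (g(fᵢ, fᵢ) g(fⱼ, fⱼ)), each trace says ∑ⱼ kᵢⱼ = 0. The rows 0
    -- and 1 minus the rows 2 and 3 give 2k₀₁ = 2k₂₃, the equality for complementary planes.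
    have h := fun i => htr f hf (f i) (f i)
    simp only [frameTrace, Fin.sum_univ_four] at h
    have h0 := h 0
    have h1 := h 1
    have h2 := h 2
    have h3 := h 3
    have sw : ∀ X Y, W X Y X Y = W Y X Y X := fun X Y => by rw [hW.anti, hW.anti']; ring
    simp only [hself, sw (f 1) (f 0), sw (f 2) (f 0), sw (f 3) (f 0), sw (f 2) (f 1),
      sw (f 3) (f 1), sw (f 3) (f 2)] at h0 h1 h2 h3
    linear_combination -(μ p f / 2) * (h0 / g p (f 0) (f 0) + h1 / g p (f 1) (f 1)
      - h2 / g p (f 2) (f 2) - h3 / g p (f 3) (f 3))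
  have k01 : ∀ f, IsFrame (g p) f → hodge g μ p (fun A B => W A B (f 0) (f 1)) (f 0) (f 1)
      = hodge g μ p (W (f 0) (f 1)) (f 0) (f 1) := by
    intro f hf
    rw [hf.hodge_apply hg (hW.isAltForm _ _), hf.hodge_apply hg (hW.isAltForm' _ _), hW.pair]
  have alt : ∀ X Y, IsAltForm fun Z T => hodge g μ p (fun A B => W A B Z T) X Y := by
    refine fun X Y => ⟨fun T => ⟨fun a b => ?_, fun c a => ?_⟩, fun Z T => ?_⟩
    · simp only [hodge, (hW.linear₃ _ _ _).map_add, mul_add, Finset.sum_add_distrib]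
    · simp only [hodge, (hW.linear₃ _ _ _).map_smul, smul_eq_mul, Finset.mul_sum]
      exact Finset.sum_congr rfl fun _ _ => Finset.sum_congr rfl fun _ _ => by ring
    · simp only [hodge, hW.anti' _ _ Z T, mul_neg, Finset.sum_neg_distrib]
  have alt' : ∀ Z T, IsAltForm fun X Y => hodge g μ p (W X Y) Z T := by
    refine fun X Y => ⟨fun T => ⟨fun a b => ?_, fun c a => ?_⟩, fun Z T => ?_⟩
    · simp only [hodge, (hW.linear _ _ _).map_add, mul_add, Finset.sum_add_distrib]
    · simp only [hodge, (hW.linear _ _ _).map_smul, smul_eq_mul, Finset.mul_sum]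
      exact Finset.sum_congr rfl fun _ _ => Finset.sum_congr rfl fun _ _ => by ring
    · simp only [hodge, hW.anti Z T, mul_neg, Finset.sum_neg_distrib]
  have key : ∀ f, IsFrame (g p) f → hodge g μ p (fun A B => W A B Z T) (f 0) (f 1)
      = hodge g μ p (W (f 0) (f 1)) Z T := by
    intro f hf
    have sw : ∀ Z T, hodge g μ p (fun A B => W A B Z T) (f 1) (f 0)
        = hodge g μ p (W (f 1) (f 0)) Z T → hodge g μ p (fun A B => W A B Z T) (f 0) (f 1)
        = hodge g μ p (W (f 0) (f 1)) Z T := by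
      intro Z T h
      rw [(isAltForm_hodge _).anti, h, ← (alt' Z T).anti]
    -- The pairs that share one index with {0, 1} all reduce to `k02`, by exchanging 0 with 1 or 2
    -- with 3.
    refine hf.altForm_ext_six (alt (f 0) (f 1)) (isAltForm_hodge _) (k01 f hf) (k02 f hf) ?_
      (sw _ _ ?_) (sw _ _ ?_) (k23 f hf) Z T
    · simpa only [Function.comp_apply, show Equiv.swap (2 : Fin 4) 3 0 = 0 by decide,
        show Equiv.swap (2 : Fin 4) 3 1 = 1 by decide,
        show Equiv.swap (2 : Fin 4) 3 2 = 3 by decide] using k02 (f ∘ Equiv.swap 2 3) (hf.comp _)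
    · simpa only [Function.comp_apply, show Equiv.swap (0 : Fin 4) 1 0 = 1 by decide,
        show Equiv.swap (0 : Fin 4) 1 1 = 0 by decide,
        show Equiv.swap (0 : Fin 4) 1 2 = 2 by decide] using k02 (f ∘ Equiv.swap 0 1) (hf.comp _)
    · simpa only [Function.comp_apply,
        show Equiv.swap (2 : Fin 4) 3 0 = 0 by decide,
        show Equiv.swap (2 : Fin 4) 3 1 = 1 by decide,
        show Equiv.swap (2 : Fin 4) 3 2 = 3 by decide,
        show Equiv.swap (0 : Fin 4) 1 0 = 1 by decide,
        show Equiv.swap (0 : Fin 4) 1 1 = 0 by decide,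
        show Equiv.swap (0 : Fin 4) 1 3 = 3 by decide]
        using k02 ((f ∘ Equiv.swap 0 1) ∘ Equiv.swap 2 3) ((hf.comp _).comp _)
  exact hf.altForm_ext (isAltForm_hodge _) (alt' Z T) (fun σ => key (f ∘ σ) (hf.comp σ)) X Y

/-- The volume form of a metric on an open set. -/
structure IsVolOn (V : Set (Coord 𝕜 4)) (g : Coord 𝕜 4 → Bilin 𝕜 (Coord 𝕜 4))
    (μ : Coord 𝕜 4 → Coord 𝕜 4 [⋀^Fin 4]→L[𝕜] 𝕜) : Prop where
  sq : ∀ p ∈ V, ∀ v, μ p v ^ 2 = Matrix.det (Matrix.of fun i j => g p (v i) (v j))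
  smooth : ∀ p ∈ V, ∀ v, ContDiffAt 𝕜 ∞ (fun q => μ q v) p

lemma CoordMetricOn.frameTrace_weyl_four (hg : CoordMetricOn V g) (hp : p ∈ V)
    {f : Fin 4 → Coord 𝕜 4} (hf : IsFrame (g p) f) (Y T : Coord 𝕜 4) :
    frameTrace (g p) f (fun X X' => weyl g p X Y X' T) = 0 := by
  apply hg.frameTrace_weyl hp hf <;> norm_num

/-- On a self-dual manifold, the Weyl tensor is invariant under the Hodge operator. -/
lemma CoordMetricOn.hodge_weyl (hg : CoordMetricOn V g) (hμ : IsVolOn V g μ) (hp : p ∈ V)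
    (h : ∀ X Y Z T, weylMinus g μ p X Y Z T = 0) (X Y Z T : Coord 𝕜 4) :
    hodge g μ p (fun A B => weyl g p A B Z T) X Y = weyl g p X Y Z T := by
  have hW := hg.isCurvatureLike_weyl hp
  have hc := hodge_comm (μ := μ) (hg.symm p hp) (hg.nondeg p hp) hW
    (fun f hf => hg.frameTrace_weyl_four hp hf)
  have hh := hodge_hodge (hg.symm p hp) (hg.nondeg p hp) (hμ.sq p hp) (hW.isAltForm Z T) X Y
  have h := h X Y Z T
  have e : (fun A B => hodge g μ p (fun A' B' => weyl g p A B A' B') Z T)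
      = fun A B => hodge g μ p (fun A' B' => weyl g p A' B' Z T) A B := by
    funext A B
    exact (hc A B Z T).symm
  -- The star acts equally on both pairs and has square 1, so 4W⁻ collapses to 2(W - *W).
  rw [weylMinus, weylPart, e, hh, ← hc] at h
  have two : (2 : 𝕜) ≠ 0 := two_ne_zero
  apply mul_left_cancel₀ two
  linear_combination -4 * h

/-- Both projections onto Λ⁺ act trivially on W when W⁻ = 0. As this holds on an open set,
derivatives of W⁺ are derivatives of W. -/
lemma CoordMetricOn.weylPlus_eq (hg : CoordMetricOn V g) (hμ : IsVolOn V g μ) (hp : p ∈ V)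
    (h : ∀ X Y Z T, weylMinus g μ p X Y Z T = 0) (X Y Z T : Coord 𝕜 4) :
    weylPlus g μ p X Y Z T = weyl g p X Y Z T := by
  have hW := hg.isCurvatureLike_weyl hp
  have h1 := hg.hodge_weyl hμ hp h
  have h2 : ∀ X Y Z T, hodge g μ p (fun A B => weyl g p X Y A B) Z T = weyl g p X Y Z T := by
    intro X Y Z T
    have e : (fun A B => weyl g p X Y A B) = fun A B => weyl g p A B X Y := by
      funext A B
      rw [hW.pair]
    rw [e, h1, hW.pair]
  simp only [weylPlus, weylPart, h2, h1]
  ring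

/-- The derivative of the Weyl tensor at a point where the Weyl tensor vanishes. -/
lemma CoordMetricOn.isCurvatureLike_fderiv_weyl {n : ℕ} {V : Set (Coord 𝕜 n)}
    {g : Coord 𝕜 n → Bilin 𝕜 (Coord 𝕜 n)} {p : Coord 𝕜 n} (hg : CoordMetricOn V g) (hp : p ∈ V)
    (ν : Coord 𝕜 n) :
    IsCurvatureLike (fun X Y Z T => fderiv 𝕜 (fun q => weyl g q X Y Z T) p ν) := by
  have hd : ∀ X Y Z T, DifferentiableAt 𝕜 (fun q => weyl g q X Y Z T) p :=
    fun X Y Z T => diffAt (hg.contDiffAt_weyl hp X Y Z T)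
  -- The symmetries are linear identities in constant vectors, valid near the point, so they pass to
  -- the derivative.
  have hev : ∀ᶠ q in 𝓝 p, IsCurvatureLike (weyl g q) := by
    filter_upwards [hg.mem_nhds hp] with q hq using hg.isCurvatureLike_weyl hq
  refine ⟨fun Y Z T => ⟨fun X X' => ?_, fun c X => ?_⟩, fun X Y Z T => ?_, fun X Y Z T => ?_,
    fun X Y Z T => ?_⟩
  · rw [← add_apply, ← fderiv_fun_add (hd _ _ _ _) (hd _ _ _ _)]
    congr 1
    apply EventuallyEq.fderiv_eq
    filter_upwards [hev] with q hq using (hq.linear Y Z T).map_add X X'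
  · rw [← smul_apply, ← fderiv_fun_const_smul (hd _ _ _ _)]
    congr 1
    apply EventuallyEq.fderiv_eq
    filter_upwards [hev] with q hq using (hq.linear Y Z T).map_smul c X
  · rw [← neg_apply, ← fderiv_fun_neg]
    congr 1
    apply EventuallyEq.fderiv_eq
    filter_upwards [hev] with q hq using hq.anti X Y Z T
  · congr 1
    apply EventuallyEq.fderiv_eq
    filter_upwards [hev] with q hq using hq.pair X Y Z T
  · have e : fderiv 𝕜 (fun q => weyl g q X Y Z T + weyl g q Y Z X T + weyl g q Z X Y T) p
        = fderiv 𝕜 (fun _ => (0 : 𝕜)) p := by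
      apply EventuallyEq.fderiv_eq
      filter_upwards [hev] with q hq using hq.cyclic X Y Z T
    rw [fderiv_fun_add ((hd _ _ _ _).fun_add (hd _ _ _ _)) (hd _ _ _ _),
      fderiv_fun_add (hd _ _ _ _) (hd _ _ _ _)] at e
    have e := congrArg (fun l => l ν) e
    simpa using e

/-- Differentiate W = *W. The derivatives of the volume form and of the dual vectors come multiplied
by the value of W, which is zero at the point, so the star passes through the derivative. -/
lemma CoordMetricOn.hodge_fderiv_weyl (hg : CoordMetricOn V g) (hμ : IsVolOn V g μ) (hp : p ∈ V)
    (h : ∀ q ∈ V, ∀ X Y Z T, weylMinus g μ q X Y Z T = 0) (h0 : ∀ X Y Z T, weyl g p X Y Z T = 0)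
    (ν X Y Z T : Coord 𝕜 4) :
    hodge g μ p (fun A B => fderiv 𝕜 (fun q => weyl g q A B Z T) p ν) X Y
      = fderiv 𝕜 (fun q => weyl g q X Y Z T) p ν := by
  set Ω : Coord 𝕜 4 → Bilin 𝕜 (Coord 𝕜 4) := fun q => toCLM₂ fun A B => weyl g q A B Z T with hΩ
  have hΩs : ContDiffAt 𝕜 ∞ Ω p := contDiffAt_toCLM₂ fun A B => hg.contDiffAt_weyl hp A B Z T
  have hΩa : ∀ q ∈ V, ∀ A B, Ω q A B = weyl g q A B Z T := by
    intro q hq A B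
    have hW := hg.isCurvatureLike_weyl hq
    exact toCLM₂_apply (fun _ => hW.linear _ _ _) (fun _ => hW.linear₂ _ _ _) A B
  have hΩ0 : Ω p = 0 := by
    ext A B
    rw [hΩa p hp, h0]
    rfl
  have hΩd := diffAt hΩs
  have e0 : ∀ A B, fderiv 𝕜 (fun q => weyl g q A B Z T) p ν = fderiv 𝕜 Ω p ν A B := by
    intro A B
    rw [← fderiv_clm_apply_const₂ hΩd]
    congr 1
    apply EventuallyEq.fderiv_eq
    filter_upwards [hg.mem_nhds hp] with q hq using (hΩa q hq A B).symm
  have e1 : fderiv 𝕜 (fun q => weyl g q X Y Z T) p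
      = fderiv 𝕜 (fun q => (1 / 2 : 𝕜) * ∑ a : Fin 4, ∑ b : Fin 4,
        μ q ![X, Y, stdVec a, stdVec b] * Ω q (dualVec g q a) (dualVec g q b)) p := by
    apply EventuallyEq.fderiv_eq
    filter_upwards [hg.mem_nhds hp] with q hq
    rw [← hg.hodge_weyl hμ hq (h q hq), hodge]
    simp only [hΩa q hq]
  have d1 : ∀ a b, DifferentiableAt 𝕜 (fun q => μ q ![X, Y, stdVec a, stdVec b]) p :=
    fun a b => diffAt (hμ.smooth p hp _)
  have d2 : ∀ a, DifferentiableAt 𝕜 (fun q => dualVec g q a) p :=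
    fun a => diffAt (hg.contDiffAt_dualVec hp a)
  have d3 : ∀ a b, DifferentiableAt 𝕜 (fun q => Ω q (dualVec g q a) (dualVec g q b)) p :=
    fun a b => (hΩd.clm_apply (d2 a)).clm_apply (d2 b)
  have e2 : ∀ a b, fderiv 𝕜 (fun q => μ q ![X, Y, stdVec a, stdVec b]
      * Ω q (dualVec g q a) (dualVec g q b)) p ν
      = μ p ![X, Y, stdVec a, stdVec b] * fderiv 𝕜 Ω p ν (dualVec g p a) (dualVec g p b) := by
    intro a b
    rw [fderiv_fun_mul (d1 a b) (d3 a b), add_apply, smul_apply, smul_apply,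
      fderiv_clm_apply₂ hΩd (d2 a) (d2 b), hΩ0]
    simp
  have d4 : ∀ a b, DifferentiableAt 𝕜 (fun q => μ q ![X, Y, stdVec a, stdVec b]
      * Ω q (dualVec g q a) (dualVec g q b)) p := fun a b => (d1 a b).fun_mul (d3 a b)
  have d5 : ∀ a, DifferentiableAt 𝕜 (fun q => ∑ b, μ q ![X, Y, stdVec a, stdVec b]
      * Ω q (dualVec g q a) (dualVec g q b)) p := fun a => DifferentiableAt.fun_sum fun b _ => d4 a b
  rw [e1, fderiv_const_mul (DifferentiableAt.fun_sum fun a _ => d5 a),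
    fderiv_fun_sum (fun a _ => d5 a)]
  simp only [smul_apply, sum_apply, fderiv_fun_sum (fun b (_ : b ∈ Finset.univ) => d4 _ b), e2,
    hodge, e0, smul_eq_mul]

end Hodge

/-! ### Covariant derivatives along a map. -/

section Along

variable {𝕜 : Type*} [RCLike 𝕜]
variable {E E' : Type*} [NormedAddCommGroup E] [NormedSpace 𝕜 E]
  [NormedAddCommGroup E'] [NormedSpace 𝕜 E']

/-- The covariant derivative along a map `F` of a field `u` along `F`. -/
def alongD (Γ : E' → E' →L[𝕜] E' →L[𝕜] E') (F u : E → E') (p X : E) : E' :=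
  fderiv 𝕜 u p X + Γ (F p) (fderiv 𝕜 F p X) (u p)

variable {Γ : E' → E' →L[𝕜] E' →L[𝕜] E'} {F : E → E'} {p : E}

lemma alongD_congr {u w : E → E'} (h : u =ᶠ[𝓝 p] w) (X : E) :
    alongD Γ F u p X = alongD Γ F w p X := by
  rw [alongD, alongD, h.fderiv_eq, h.self_of_nhds]

lemma alongD_add {u w : E → E'} (hu : DifferentiableAt 𝕜 u p) (hw : DifferentiableAt 𝕜 w p)
    (X : E) : alongD Γ F (fun q => u q + w q) p X = alongD Γ F u p X + alongD Γ F w p X := by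
  rw [alongD, alongD, alongD, fderiv_fun_add hu hw, add_apply, map_add]
  abel

lemma alongD_smul {a : E → 𝕜} {u : E → E'} (ha : DifferentiableAt 𝕜 a p)
    (hu : DifferentiableAt 𝕜 u p) (X : E) :
    alongD Γ F (fun q => a q • u q) p X = fderiv 𝕜 a p X • u p + a p • alongD Γ F u p X := by
  rw [alongD, alongD, fderiv_fun_smul ha hu, map_smul, smul_add]
  simp only [add_apply, smul_apply, ContinuousLinearMap.smulRight_apply]
  abel

lemma alongD_fderiv_apply (hF : ContDiffAt 𝕜 ∞ F p) {u : E → E} (hu : DifferentiableAt 𝕜 u p)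
    (X : E) : alongD Γ F (fun q => fderiv 𝕜 F q (u q)) p X
      = alongD Γ F (fun q => fderiv 𝕜 F q (u p)) p X + fderiv 𝕜 F p (fderiv 𝕜 u p X) := by
  have h := diffAt (contDiffAt_fderiv hF)
  rw [alongD, alongD, fderiv_clm_apply' h hu, fderiv_clm_apply_const h]
  abel

lemma contDiffAt_alongD (hF : ContDiffAt 𝕜 ∞ F p) (hΓ : ContDiffAt 𝕜 ∞ Γ (F p)) {u : E → E'}
    (hu : ContDiffAt 𝕜 ∞ u p) (X : E) : ContDiffAt 𝕜 ∞ (fun q => alongD Γ F u q X) p := by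
  have h1 : ContDiffAt 𝕜 ∞ (fun q => Γ (F q)) p := hΓ.comp (𝕜 := 𝕜) p hF
  exact ((contDiffAt_fderiv hu).apply_const X).add
    ((h1.clm_apply ((contDiffAt_fderiv hF).apply_const X)).clm_apply hu)

lemma alongD_fderiv_comm (hF : ContDiffAt 𝕜 ∞ F p) (hs : ∀ X Y, Γ (F p) X Y = Γ (F p) Y X)
    (X Y : E) : alongD Γ F (fun q => fderiv 𝕜 F q Y) p X
      = alongD Γ F (fun q => fderiv 𝕜 F q X) p Y := by
  rw [alongD, alongD, fderiv_fderiv_comm hF, hs]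

lemma fderiv_form_along {S : E' → E' →L[𝕜] E' →L[𝕜] 𝕜} (hF : DifferentiableAt 𝕜 F p)
    (hS : DifferentiableAt 𝕜 S (F p)) {u w : E → E'} (hu : DifferentiableAt 𝕜 u p)
    (hw : DifferentiableAt 𝕜 w p) (X : E) :
    fderiv 𝕜 (fun q => S (F q) (u q) (w q)) p X
      = fderiv 𝕜 S (F p) (fderiv 𝕜 F p X) (u p) (w p) + S (F p) (fderiv 𝕜 u p X) (w p)
        + S (F p) (u p) (fderiv 𝕜 w p X) := by
  have h1 : DifferentiableAt 𝕜 (fun q => S (F q)) p := DifferentiableAt.comp (g := S) p hS hF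
  rw [fderiv_clm_apply₂ (A := fun q => S (F q)) h1 hu hw,
    show fderiv 𝕜 (fun q => S (F q)) p = (fderiv 𝕜 S (F p)).comp (fderiv 𝕜 F p) from
      fderiv_fun_comp (g := S) p hS hF]
  rfl

lemma differentiableAt_form_along {S : E' → E' →L[𝕜] E' →L[𝕜] 𝕜} (hF : DifferentiableAt 𝕜 F p)
    (hS : DifferentiableAt 𝕜 S (F p)) {u w : E → E'} (hu : DifferentiableAt 𝕜 u p)
    (hw : DifferentiableAt 𝕜 w p) : DifferentiableAt 𝕜 (fun q => S (F q) (u q) (w q)) p :=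
  ((DifferentiableAt.comp (g := S) p hS hF).clm_apply hu).clm_apply hw

/-- Tailored to the expression h + ½ g(H, H) K for the Schouten tensor of the hypersurface. -/
lemma fderiv_add_half_mul_mul {a b c : E → 𝕜} (ha : DifferentiableAt 𝕜 a p)
    (hb : DifferentiableAt 𝕜 b p) (hc : DifferentiableAt 𝕜 c p) (X : E) :
    fderiv 𝕜 (fun q => a q + 1 / 2 * b q * c q) p X = fderiv 𝕜 a p X
      + (1 / 2 * b p * fderiv 𝕜 c p X + 1 / 2 * fderiv 𝕜 b p X * c p) := by
  rw [fderiv_fun_add ha ((hb.const_mul _).fun_mul hc), fderiv_fun_mul (hb.const_mul _) hc,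
    fderiv_const_mul hb]
  simp only [add_apply, smul_apply, smul_eq_mul]
  ring

/-- A metric connection differentiates products along a map. -/
lemma fderiv_metric_along {g : E' → E' →L[𝕜] E' →L[𝕜] 𝕜} (hF : DifferentiableAt 𝕜 F p)
    (hg : DifferentiableAt 𝕜 g (F p))
    (hc : ∀ X Y Z, fderiv 𝕜 g (F p) X Y Z = g (F p) (Γ (F p) X Y) Z + g (F p) Y (Γ (F p) X Z))
    {u w : E → E'} (hu : DifferentiableAt 𝕜 u p) (hw : DifferentiableAt 𝕜 w p) (X : E) :
    fderiv 𝕜 (fun q => g (F q) (u q) (w q)) p X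
      = g (F p) (alongD Γ F u p X) (w p) + g (F p) (u p) (alongD Γ F w p X) := by
  rw [fderiv_form_along hF hg hu hw, alongD, alongD, hc]
  simp only [map_add, add_apply]
  ring

/-- The Ricci identity along a map. -/
lemma alongD_alongD_sub (hF : ContDiffAt 𝕜 ∞ F p) (hΓ : ContDiffAt 𝕜 ∞ Γ (F p)) {u : E → E'}
    (hu : ContDiffAt 𝕜 ∞ u p) (X Y : E) :
    alongD Γ F (fun q => alongD Γ F u q Y) p X - alongD Γ F (fun q => alongD Γ F u q X) p Y
      = connCurv Γ (F p) (fderiv 𝕜 F p X) (fderiv 𝕜 F p Y) (u p) := by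
  have hΓd := diffAt hΓ
  have hFd := diffAt hF
  have h1 : ContDiffAt 𝕜 ∞ (fun q => Γ (F q)) p := hΓ.comp (𝕜 := 𝕜) p hF
  have e : ∀ X Y, fderiv 𝕜 (fun q => alongD Γ F u q Y) p X
      = fderiv 𝕜 (fun q => fderiv 𝕜 u q Y) p X
        + (fderiv 𝕜 Γ (F p) (fderiv 𝕜 F p X) (fderiv 𝕜 F p Y) (u p)
        + Γ (F p) (fderiv 𝕜 (fun q => fderiv 𝕜 F q Y) p X) (u p)
        + Γ (F p) (fderiv 𝕜 F p Y) (fderiv 𝕜 u p X)) := by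
    intro X Y
    have d1 := diffAt ((contDiffAt_fderiv hu).apply_const Y)
    have d2 := diffAt ((contDiffAt_fderiv hF).apply_const Y)
    have d3 := ((diffAt h1).clm_apply d2).clm_apply (diffAt hu)
    unfold alongD
    rw [fderiv_fun_add d1 d3, add_apply, fderiv_clm_apply₂ (diffAt h1) d2 (diffAt hu),
      show fderiv 𝕜 (fun q => Γ (F q)) p = (fderiv 𝕜 Γ (F p)).comp (fderiv 𝕜 F p) from
      fderiv_fun_comp p hΓd hFd]
    rfl
  have o : ∀ X Y, alongD Γ F (fun q => alongD Γ F u q Y) p X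
      = fderiv 𝕜 (fun q => alongD Γ F u q Y) p X
        + Γ (F p) (fderiv 𝕜 F p X) (alongD Γ F u p Y) := fun _ _ => rfl
  -- Second derivatives of `u` and of `F` are symmetric and drop out of the commutator.
  rw [o, o, e, e, fderiv_fderiv_comm hu, fderiv_fderiv_comm hF, connCurv,
    fderiv_clm_apply_const₂ hΓd, fderiv_clm_apply_const₂ hΓd, alongD, alongD, map_add, map_add]
  abel

/-- The equations of Gauss and Codazzi for an umbilic immersion. -/
lemma connCurv_along_umbilic {Γ' : E → E →L[𝕜] E →L[𝕜] E} {K : E → E →L[𝕜] E →L[𝕜] 𝕜}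
    {H : E → E'} (hF : ContDiffAt 𝕜 ∞ F p) (hΓ : ContDiffAt 𝕜 ∞ Γ (F p))
    (hΓ' : ContDiffAt 𝕜 ∞ Γ' p) (hK : ContDiffAt 𝕜 ∞ K p) (hH : ContDiffAt 𝕜 ∞ H p)
    (hs : ∀ X Y, Γ' p X Y = Γ' p Y X)
    (hc : ∀ X Y Z, fderiv 𝕜 K p X Y Z = K p (Γ' p X Y) Z + K p Y (Γ' p X Z))
    (hu : ∀ᶠ q in 𝓝 p, ∀ X Y, alongD Γ F (fun q => fderiv 𝕜 F q Y) q X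
      = fderiv 𝕜 F q (Γ' q X Y) + K q X Y • H q) (X Y Z : E) :
    connCurv Γ (F p) (fderiv 𝕜 F p X) (fderiv 𝕜 F p Y) (fderiv 𝕜 F p Z)
      = fderiv 𝕜 F p (connCurv Γ' p X Y Z) + K p Y Z • alongD Γ F H p X
        - K p X Z • alongD Γ F H p Y := by
  have key : ∀ X Y, alongD Γ F (fun q => alongD Γ F (fun q => fderiv 𝕜 F q Z) q Y) p X
      = fderiv 𝕜 F p (Γ' p X (Γ' p Y Z)) + K p X (Γ' p Y Z) • H p
        + fderiv 𝕜 F p (fderiv 𝕜 (fun q => Γ' q Y Z) p X)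
        + ((K p (Γ' p X Y) Z + K p Y (Γ' p X Z)) • H p + K p Y Z • alongD Γ F H p X) := by
    intro X Y
    have h1 : (fun q => alongD Γ F (fun q => fderiv 𝕜 F q Z) q Y)
        =ᶠ[𝓝 p] fun q => fderiv 𝕜 F q (Γ' q Y Z) + K q Y Z • H q := by
      filter_upwards [hu] with q hq using hq Y Z
    have d1 := (hΓ'.apply_const Y).apply_const Z
    have d2 := (hK.apply_const Y).apply_const Z
    rw [alongD_congr h1, alongD_add (diffAt ((contDiffAt_fderiv hF).clm_apply d1))
      ((diffAt d2).fun_smul (diffAt hH)), alongD_fderiv_apply hF (diffAt d1), alongD_smul (diffAt d2)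
      (diffAt hH), hu.self_of_nhds, fderiv_clm_apply_const₂ (diffAt hK), hc]
  -- The coefficient K(X, Γ'(Y, Z)) + K(Γ'(X, Y), Z) + K(Y, Γ'(X, Z)) of H is symmetric in X, Y, so
  -- only the derivative of H survives.
  rw [← alongD_alongD_sub hF hΓ ((contDiffAt_fderiv hF).apply_const Z), key, key, connCurv, hs Y X]
  simp only [map_add, map_sub, add_smul]
  abel

end Along

/-! ### Umbilic hypersurfaces: Gauss and Codazzi equations, induced Schouten and Cotton–York
tensors. -/

section Hypersurface

variable {𝕜 : Type*} [RCLike 𝕜]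

/-- An immersed hypersurface with its induced metric `K`, in coordinates. -/
structure CoordImmersion (V : Set (Coord 𝕜 4)) (g : Coord 𝕜 4 → Bilin 𝕜 (Coord 𝕜 4))
    (O : Set (Coord 𝕜 3)) (F : Coord 𝕜 3 → Coord 𝕜 4)
    (K : Coord 𝕜 3 → Bilin 𝕜 (Coord 𝕜 3)) : Prop where
  metric : CoordMetricOn V g
  induced : CoordMetricOn O K
  maps : ∀ p ∈ O, F p ∈ V
  smooth : ∀ p ∈ O, ContDiffAt 𝕜 ∞ F p
  pull : ∀ p ∈ O, ∀ X Y, K p X Y = g (F p) (fderiv 𝕜 F p X) (fderiv 𝕜 F p Y)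

variable {V : Set (Coord 𝕜 4)} {g : Coord 𝕜 4 → Bilin 𝕜 (Coord 𝕜 4)}
  {O : Set (Coord 𝕜 3)} {F : Coord 𝕜 3 → Coord 𝕜 4} {K : Coord 𝕜 3 → Bilin 𝕜 (Coord 𝕜 3)}
  {p : Coord 𝕜 3}

/-- The covariant derivative `∇_X Y` along an immersion. -/
def secondForm (g : Coord 𝕜 4 → Bilin 𝕜 (Coord 𝕜 4)) (F : Coord 𝕜 3 → Coord 𝕜 4)
    (p X Y : Coord 𝕜 3) : Coord 𝕜 4 :=
  alongD (conn g) F (fun q => fderiv 𝕜 F q Y) p X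

lemma CoordImmersion.secondDeriv_eq (h : CoordImmersion V g O F K) (hp : p ∈ O)
    (X Y : Coord 𝕜 3) : secondDeriv g F p X Y = secondForm g F p X Y := by
  rw [secondDeriv, secondForm, alongD, h.metric.conn_apply (h.maps p hp)]

lemma CoordImmersion.fderiv_along (h : CoordImmersion V g O F K) (hp : p ∈ O)
    {u w : Coord 𝕜 3 → Coord 𝕜 4} (hu : DifferentiableAt 𝕜 u p) (hw : DifferentiableAt 𝕜 w p)
    (X : Coord 𝕜 3) :
    fderiv 𝕜 (fun q => g (F q) (u q) (w q)) p X
      = g (F p) (alongD (conn g) F u p X) (w p) + g (F p) (u p) (alongD (conn g) F w p X) :=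
  fderiv_metric_along (diffAt (h.smooth p hp)) (diffAt (h.metric.smooth _ (h.maps p hp)))
    (h.metric.compat (h.maps p hp)) hu hw X

lemma CoordImmersion.differentiableAt_fderiv (h : CoordImmersion V g O F K) (hp : p ∈ O)
    (X : Coord 𝕜 3) : DifferentiableAt 𝕜 (fun q => fderiv 𝕜 F q X) p :=
  diffAt ((contDiffAt_fderiv (h.smooth p hp)).apply_const X)

lemma CoordImmersion.secondForm_comm (h : CoordImmersion V g O F K) (hp : p ∈ O)
    (X Y : Coord 𝕜 3) : secondForm g F p X Y = secondForm g F p Y X :=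
  alongD_fderiv_comm (h.smooth p hp) (h.metric.conn_comm (h.maps p hp)) X Y

/-- The tangential part of `∇_X Y` is the Levi-Civita connection of the induced metric. -/
lemma CoordImmersion.metric_secondForm (h : CoordImmersion V g O F K) (hp : p ∈ O)
    (X Y Z : Coord 𝕜 3) :
    g (F p) (secondForm g F p X Y) (fderiv 𝕜 F p Z) = K p (conn K p X Y) Z := by
  have hs := h.metric.symm _ (h.maps p hp)
  have key : ∀ X Y Z, fderiv 𝕜 K p X Y Z
      = g (F p) (secondForm g F p X Y) (fderiv 𝕜 F p Z)
        + g (F p) (fderiv 𝕜 F p Y) (secondForm g F p X Z) := by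
    intro X Y Z
    have hd := diffAt (h.induced.smooth p hp)
    rw [← fderiv_clm_apply_const₂ hd]
    have e : (fun q => K q Y Z) =ᶠ[𝓝 p] fun q => g (F q) (fderiv 𝕜 F q Y) (fderiv 𝕜 F q Z) := by
      filter_upwards [h.induced.mem_nhds hp] with q hq using h.pull q hq Y Z
    rw [e.fderiv_eq, h.fderiv_along hp (h.differentiableAt_fderiv hp Y)
      (h.differentiableAt_fderiv hp Z)]
    rfl
  rw [h.induced.conn_apply hp, h.induced.koszul hp, key, key, key, h.secondForm_comm hp Y X,
    h.secondForm_comm hp Z X, h.secondForm_comm hp Z Y, hs _ (secondForm g F p X Z),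
    hs _ (secondForm g F p Y Z)]
  ring

/-- An umbilic immersion with its mean curvature vector field `H`. -/
structure CoordUmbilic (V : Set (Coord 𝕜 4)) (g : Coord 𝕜 4 → Bilin 𝕜 (Coord 𝕜 4))
    (O : Set (Coord 𝕜 3)) (F : Coord 𝕜 3 → Coord 𝕜 4)
    (K : Coord 𝕜 3 → Bilin 𝕜 (Coord 𝕜 3)) (H : Coord 𝕜 3 → Coord 𝕜 4) : Prop
    extends CoordImmersion V g O F K where
  smooth_mean : ∀ p ∈ O, ContDiffAt 𝕜 ∞ H p
  normal : ∀ p ∈ O, ∀ X, g (F p) (H p) (fderiv 𝕜 F p X) = 0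
  umbilic : ∀ p ∈ O, ∀ X Y,
    secondForm g F p X Y = fderiv 𝕜 F p (conn K p X Y) + K p X Y • H p

/-- The pointwise decomposition of the second fundamental form. -/
lemma CoordImmersion.exists_normal (h : CoordImmersion V g O F K) (hp : p ∈ O)
    (hu : ∃ H : Coord 𝕜 4, ∀ X Y, secondDeriv g F p X Y - K p X Y • H
      ∈ LinearMap.range (fderiv 𝕜 F p).toLinearMap) :
    ∃ H : Coord 𝕜 4, (∀ X, g (F p) H (fderiv 𝕜 F p X) = 0) ∧
      ∀ X Y, secondForm g F p X Y = fderiv 𝕜 F p (conn K p X Y) + K p X Y • H := by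
  obtain ⟨H₀, hH₀⟩ := hu
  have hK := h.induced.nondeg p hp
  -- `t` represents the tangential part of H₀, which is removed; the vector in the hypothesis is
  -- only given modulo tangent vectors.
  set t := (K p).inverse ((g (F p) H₀).comp (fderiv 𝕜 F p)) with ht
  have hKt : ∀ Z, K p t Z = g (F p) H₀ (fderiv 𝕜 F p Z) := by
    intro Z
    rw [ht, hK.apply_inverse]
    rfl
  have hn : ∀ X, g (F p) (H₀ - fderiv 𝕜 F p t) (fderiv 𝕜 F p X) = 0 := by
    intro X
    rw [map_sub, sub_apply, ← h.pull p hp, hKt, sub_self]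
  refine ⟨H₀ - fderiv 𝕜 F p t, hn, fun X Y => ?_⟩
  obtain ⟨a, ha⟩ := hH₀ X Y
  have ha : fderiv 𝕜 F p a = secondForm g F p X Y - K p X Y • H₀ := by
    rw [← h.secondDeriv_eq hp]
    exact ha
  have e : secondForm g F p X Y
      = fderiv 𝕜 F p (a + K p X Y • t) + K p X Y • (H₀ - fderiv 𝕜 F p t) := by
    rw [map_add, map_smul, ha, smul_sub]
    abel
  have e2 : a + K p X Y • t = conn K p X Y := by
    refine h.induced.eq_of_forall hp fun Z => ?_
    rw [← h.metric_secondForm hp, e, map_add (g (F p)), add_apply, ← h.pull p hp, map_smul (g (F p)),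
      smul_apply, hn, smul_zero, add_zero]
  rw [e, e2]

/-- The hypothesis gives a vector at each point, with no regularity. Near p it is recovered from the
second fundamental form on one vector X with K(X, X) ≠ 0, and this formula is smooth; the domain
shrinks to where K(X, X) does not vanish. -/
lemma CoordImmersion.exists_umbilic (h : CoordImmersion V g O F K)
    (hu : ∀ p ∈ O, ∃ H : Coord 𝕜 4, ∀ X Y, secondDeriv g F p X Y - K p X Y • H
      ∈ LinearMap.range (fderiv 𝕜 F p).toLinearMap) (hp : p ∈ O) :
    ∃ O' H, p ∈ O' ∧ O' ⊆ O ∧ CoordUmbilic V g O' F K H := by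
  obtain ⟨f, hf⟩ := exists_isFrame (h.induced.symm p hp) (h.induced.nondeg p hp)
  set X := f 0
  have hcK : ∀ q ∈ O, ContDiffAt 𝕜 ∞ (fun q => K q X X) q :=
    fun q hq => h.induced.contDiffAt_metric_apply hq X X
  have hcont : ContinuousOn (fun q => K q X X) O :=
    fun q hq => (hcK q hq).continuousAt.continuousWithinAt
  set O' := O ∩ (fun q => K q X X) ⁻¹' {0}ᶜ with hO'
  have hopen : IsOpen O' := hcont.isOpen_inter_preimage h.induced.isOpen isOpen_compl_singleton
  have hsub : O' ⊆ O := Set.inter_subset_left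
  have h' : CoordImmersion V g O' F K := ⟨h.metric, ⟨hopen, fun q hq => h.induced.symm q hq.1,
    fun q hq => h.induced.nondeg q hq.1, fun q hq => h.induced.smooth q hq.1⟩,
    fun q hq => h.maps q hq.1, fun q hq => h.smooth q hq.1, fun q hq => h.pull q hq.1⟩
  set H : Coord 𝕜 3 → Coord 𝕜 4 :=
    fun q => (K q X X)⁻¹ • (secondForm g F q X X - fderiv 𝕜 F q (conn K q X X)) with hH
  have key : ∀ q ∈ O', (∀ X, g (F q) (H q) (fderiv 𝕜 F q X) = 0) ∧
      ∀ X Y, secondForm g F q X Y = fderiv 𝕜 F q (conn K q X Y) + K q X Y • H q := by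
    intro q hq
    obtain ⟨H₁, h1, h2⟩ := h.exists_normal hq.1 (hu q hq.1)
    have e : H q = H₁ := by
      simp only [hH]
      rw [h2, add_sub_cancel_left, smul_smul, inv_mul_cancel₀ hq.2, one_smul]
    rw [e]
    exact ⟨h1, h2⟩
  refine ⟨O', H, ⟨hp, hf.ne 0⟩, hsub, h', fun q hq => ?_, fun q hq => (key q hq).1,
    fun q hq => (key q hq).2⟩
  have hF := h.smooth q hq.1
  have c1 := (hcK q hq.1).inv hq.2
  have c2 : ContDiffAt 𝕜 ∞ (fun q => secondForm g F q X X) q :=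
    contDiffAt_alongD hF (h.metric.contDiffAt_conn (h.maps q hq.1))
      ((contDiffAt_fderiv hF).apply_const X) X
  have c3 : ContDiffAt 𝕜 ∞ (fun q => fderiv 𝕜 F q (conn K q X X)) q :=
    (contDiffAt_fderiv hF).clm_apply
      (((h.induced.contDiffAt_conn hq.1).apply_const X).apply_const X)
  exact c1.smul (c2.sub c3)

variable {H : Coord 𝕜 3 → Coord 𝕜 4}

/-- The covariant derivative of the mean curvature vector. -/
def meanDeriv (g : Coord 𝕜 4 → Bilin 𝕜 (Coord 𝕜 4)) (F H : Coord 𝕜 3 → Coord 𝕜 4)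
    (p X : Coord 𝕜 3) : Coord 𝕜 4 :=
  alongD (conn g) F H p X

lemma CoordUmbilic.curvature_eq (h : CoordUmbilic V g O F K H) (hp : p ∈ O) (X Y Z : Coord 𝕜 3) :
    curvature g (F p) (fderiv 𝕜 F p X) (fderiv 𝕜 F p Y) (fderiv 𝕜 F p Z)
      = fderiv 𝕜 F p (curvature K p X Y Z) + K p Y Z • meanDeriv g F H p X
        - K p X Z • meanDeriv g F H p Y := by
  rw [h.metric.curvature_eq_connCurv (h.maps p hp), h.induced.curvature_eq_connCurv hp]
  refine connCurv_along_umbilic (h.smooth p hp) (h.metric.contDiffAt_conn (h.maps p hp))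
    (h.induced.contDiffAt_conn hp) (h.induced.smooth p hp) (h.smooth_mean p hp)
    (h.induced.conn_comm hp) (h.induced.compat hp) ?_ X Y Z
  filter_upwards [h.induced.mem_nhds hp] with q hq using h.umbilic q hq

/-- Differentiate g(H, DF Z) = 0: the tangential part of the derivative of H in the direction X is
-g(H, H) X. -/
lemma CoordUmbilic.metric_meanDeriv (h : CoordUmbilic V g O F K H) (hp : p ∈ O)
    (X Z : Coord 𝕜 3) : g (F p) (meanDeriv g F H p X) (fderiv 𝕜 F p Z)
      = -(K p X Z * g (F p) (H p) (H p)) := by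
  have e : (fun q => g (F q) (H q) (fderiv 𝕜 F q Z)) =ᶠ[𝓝 p] fun _ => 0 := by
    filter_upwards [h.induced.mem_nhds hp] with q hq using h.normal q hq Z
  have h1 := h.fderiv_along hp (diffAt (h.smooth_mean p hp)) (h.differentiableAt_fderiv hp Z) X
  rw [e.fderiv_eq] at h1
  have h2 := h.umbilic p hp X Z
  rw [secondForm] at h2
  rw [h2, map_add, h.normal p hp, map_smul] at h1
  simp only [fderiv_fun_const, Pi.zero_apply, zero_apply, smul_eq_mul, zero_add] at h1
  rw [meanDeriv]
  linear_combination -h1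

lemma CoordUmbilic.fderiv_mean_sq (h : CoordUmbilic V g O F K H) (hp : p ∈ O) (X : Coord 𝕜 3) :
    fderiv 𝕜 (fun q => g (F q) (H q) (H q)) p X
      = 2 * g (F p) (meanDeriv g F H p X) (H p) := by
  rw [h.fderiv_along hp (diffAt (h.smooth_mean p hp)) (diffAt (h.smooth_mean p hp)),
    h.metric.symm _ (h.maps p hp) (H p), meanDeriv]
  ring

/-- The Codazzi equation: the Weyl tensor with one normal argument. -/
lemma CoordUmbilic.weyl_normal (h : CoordUmbilic V g O F K H) (hp : p ∈ O) {ν : Coord 𝕜 4}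
    (hν : ∀ X, g (F p) ν (fderiv 𝕜 F p X) = 0) (X Y Z : Coord 𝕜 3) :
    weyl g (F p) (fderiv 𝕜 F p X) (fderiv 𝕜 F p Y) ν (fderiv 𝕜 F p Z)
      = (g (F p) (meanDeriv g F H p X) ν - schouten g (F p) (fderiv 𝕜 F p X) ν) * K p Y Z
        - (g (F p) (meanDeriv g F H p Y) ν - schouten g (F p) (fderiv 𝕜 F p Y) ν) * K p X Z := by
  have hs := h.metric.symm _ (h.maps p hp)
  have hν' : ∀ X, g (F p) (fderiv 𝕜 F p X) ν = 0 := fun X => by rw [hs, hν]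
  rw [weyl_eq, curvatureForm, h.curvature_eq hp, kn]
  simp only [map_add, map_sub, add_apply, sub_apply, map_smul, smul_apply, hν', smul_eq_mul,
    ← h.pull p hp]
  ring

/-- The Gauss equation. -/
lemma CoordUmbilic.curvatureForm_induced (h : CoordUmbilic V g O F K H) (hp : p ∈ O)
    (X Y Z T : Coord 𝕜 3) : curvatureForm K p X Y Z T
      = curvatureForm g (F p) (fderiv 𝕜 F p X) (fderiv 𝕜 F p Y) (fderiv 𝕜 F p Z) (fderiv 𝕜 F p T)
        + g (F p) (H p) (H p) * (K p X Z * K p Y T - K p X T * K p Y Z) := by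
  rw [curvatureForm, curvatureForm, h.curvature_eq hp, h.pull p hp (curvature K p X Y T)]
  simp only [map_add, map_sub, add_apply, sub_apply, map_smul, smul_apply, smul_eq_mul,
    h.metric_meanDeriv hp]
  ring

/-- Where W = 0 the ambient curvature is the product of h with g, and the correction in the Gauss
equation is the product of ½ g(H, H) K with K. The curvature of the 3-dimensional K is thus a
product with K, and the other factor has to be its Schouten tensor. -/
lemma CoordUmbilic.schouten_induced (h : CoordUmbilic V g O F K H)
    (hW : ∀ p ∈ O, ∀ X Y Z T, weyl g (F p) X Y Z T = 0) (hp : p ∈ O) (X Y : Coord 𝕜 3) :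
    schouten K p X Y = schouten g (F p) (fderiv 𝕜 F p X) (fderiv 𝕜 F p Y)
      + 1 / 2 * g (F p) (H p) (H p) * K p X Y := by
  have hs := h.metric.isSymmForm_schouten (h.maps p hp)
  have hKs := h.induced.symm p hp
  refine h.induced.schouten_eq_of_curvatureForm hp (by norm_num) (by norm_num) (by norm_num)
    (k := fun X Y => schouten g (F p) (fderiv 𝕜 F p X) (fderiv 𝕜 F p Y)
      + 1 / 2 * g (F p) (H p) (H p) * K p X Y)
    ⟨fun Y => ⟨fun X X' => ?_, fun c X => ?_⟩, fun X Y => ?_⟩ (fun X Y Z T => ?_) X Y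
  · simp only [map_add, add_apply, (hs.linear _).map_add]
    ring
  · simp only [map_smul, smul_apply, (hs.linear _).map_smul, smul_eq_mul]
    ring
  · simp only [hKs X Y, hs.symm (fderiv 𝕜 F p X)]
  · have hw := hW p hp (fderiv 𝕜 F p X) (fderiv 𝕜 F p Y) (fderiv 𝕜 F p Z) (fderiv 𝕜 F p T)
    rw [weyl_eq, sub_eq_zero] at hw
    rw [h.curvatureForm_induced hp, hw]
    simp only [kn, ← h.pull p hp]
    ring

/-- The Schouten tensor as a field of continuous bilinear forms. -/
def schoutenForm {n : ℕ} (g : Coord 𝕜 n → Bilin 𝕜 (Coord 𝕜 n)) (p : Coord 𝕜 n) :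
    Bilin 𝕜 (Coord 𝕜 n) :=
  toCLM₂ (schouten g p)

section SchoutenForm

variable {n : ℕ} {V : Set (Coord 𝕜 n)} {g : Coord 𝕜 n → Bilin 𝕜 (Coord 𝕜 n)} {p : Coord 𝕜 n}

lemma CoordMetricOn.schoutenForm_apply (hg : CoordMetricOn V g) (hp : p ∈ V) (X Y : Coord 𝕜 n) :
    schoutenForm g p X Y = schouten g p X Y :=
  toCLM₂_apply (hg.isSymmForm_schouten hp).linear (hg.isSymmForm_schouten hp).linear₂ X Y

lemma CoordMetricOn.contDiffAt_schoutenForm (hg : CoordMetricOn V g) (hp : p ∈ V) :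
    ContDiffAt 𝕜 ∞ (schoutenForm g) p :=
  contDiffAt_toCLM₂ (hg.contDiffAt_schouten hp)

lemma CoordMetricOn.fderiv_schouten (hg : CoordMetricOn V g) (hp : p ∈ V) (X Y Z : Coord 𝕜 n) :
    fderiv 𝕜 (fun q => schouten g q Y Z) p X = fderiv 𝕜 (schoutenForm g) p X Y Z := by
  rw [← fderiv_clm_apply_const₂ (diffAt (hg.contDiffAt_schoutenForm hp))]
  congr 1
  apply EventuallyEq.fderiv_eq
  filter_upwards [hg.mem_nhds hp] with q hq using (hg.schoutenForm_apply hq Y Z).symm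

lemma CoordMetricOn.covSchouten_eq (hg : CoordMetricOn V g) (hp : p ∈ V) (X Y Z : Coord 𝕜 n) :
    covSchouten g p X Y Z = fderiv 𝕜 (schoutenForm g) p X Y Z
      - schoutenForm g p (conn g p X Y) Z - schoutenForm g p Y (conn g p X Z) := by
  rw [covSchouten, hg.fderiv_schouten hp, hg.schoutenForm_apply hp, hg.schoutenForm_apply hp]

lemma CoordMetricOn.isAltForm_cotton (hg : CoordMetricOn V g) (hp : p ∈ V) (Z : Coord 𝕜 n) :
    IsAltForm fun X Y => cotton g p X Y Z := by
  refine ⟨fun Y => ⟨fun X X' => ?_, fun c X => ?_⟩, fun X Y => ?_⟩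
  · simp only [hg.cotton_eq hp, hg.covSchouten_eq hp, map_add, add_apply]
    ring
  · simp only [hg.cotton_eq hp, hg.covSchouten_eq hp, map_smul, smul_apply, smul_eq_mul]
    ring
  · simp only [hg.cotton_eq hp]
    ring

lemma CoordMetricOn.isLinearMap_cotton (hg : CoordMetricOn V g) (hp : p ∈ V) (X Y : Coord 𝕜 n) :
    IsLinearMap 𝕜 fun Z => cotton g p X Y Z := by
  refine ⟨fun Y Y' => ?_, fun c Y => ?_⟩
  · simp only [hg.cotton_eq hp, hg.covSchouten_eq hp, map_add]
    ring
  · simp only [hg.cotton_eq hp, hg.covSchouten_eq hp, map_smul, smul_eq_mul]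
    ring

end SchoutenForm

/-- The terms h(H, ·) arise because ∇_X DF Y has the normal part K(X, Y) H, and the last term is the
derivative of ½ g(H, H). -/
lemma CoordUmbilic.covSchouten_induced (h : CoordUmbilic V g O F K H)
    (hW : ∀ p ∈ O, ∀ X Y Z T, weyl g (F p) X Y Z T = 0) (hp : p ∈ O) (X Y Z : Coord 𝕜 3) :
    covSchouten K p X Y Z
      = covSchouten g (F p) (fderiv 𝕜 F p X) (fderiv 𝕜 F p Y) (fderiv 𝕜 F p Z)
        + K p X Y * schouten g (F p) (H p) (fderiv 𝕜 F p Z)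
        + K p X Z * schouten g (F p) (fderiv 𝕜 F p Y) (H p)
        + g (F p) (meanDeriv g F H p X) (H p) * K p Y Z := by
  have hx := h.maps p hp
  have hF := h.smooth p hp
  have hS := h.metric.contDiffAt_schoutenForm hx
  have hHd := diffAt (h.smooth_mean p hp)
  have hHH : DifferentiableAt 𝕜 (fun q => g (F q) (H q) (H q)) p :=
    differentiableAt_form_along (diffAt hF) (diffAt (h.metric.smooth _ hx)) hHd hHd
  have hKd : DifferentiableAt 𝕜 (fun q => K q Y Z) p :=
    diffAt (h.induced.contDiffAt_metric_apply hp Y Z)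
  have dY := h.differentiableAt_fderiv hp Y
  have dZ := h.differentiableAt_fderiv hp Z
  have e : (fun q => schouten K q Y Z) =ᶠ[𝓝 p] fun q =>
      schoutenForm g (F q) (fderiv 𝕜 F q Y) (fderiv 𝕜 F q Z)
        + 1 / 2 * g (F q) (H q) (H q) * K q Y Z := by
    filter_upwards [h.induced.mem_nhds hp] with q hq
    rw [h.schouten_induced hW hq, h.metric.schoutenForm_apply (h.maps q hq)]
  have hs2 : ∀ X Y, fderiv 𝕜 (fun q => fderiv 𝕜 F q Y) p X
      = fderiv 𝕜 F p (conn K p X Y) + K p X Y • H p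
        - conn g (F p) (fderiv 𝕜 F p X) (fderiv 𝕜 F p Y) := by
    intro X Y
    rw [← h.umbilic p hp, secondForm, alongD]
    abel
  have e1 : fderiv 𝕜 (fun q => schouten K q Y Z) p X
      = fderiv 𝕜 (schoutenForm g) (F p) (fderiv 𝕜 F p X) (fderiv 𝕜 F p Y) (fderiv 𝕜 F p Z)
        + schoutenForm g (F p) (fderiv 𝕜 (fun q => fderiv 𝕜 F q Y) p X) (fderiv 𝕜 F p Z)
        + schoutenForm g (F p) (fderiv 𝕜 F p Y) (fderiv 𝕜 (fun q => fderiv 𝕜 F q Z) p X)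
        + (1 / 2 * g (F p) (H p) (H p) * (K p (conn K p X Y) Z + K p Y (conn K p X Z))
        + g (F p) (meanDeriv g F H p X) (H p) * K p Y Z) := by
    rw [e.fderiv_eq, fderiv_add_half_mul_mul (differentiableAt_form_along (diffAt hF) (diffAt hS)
      dY dZ) hHH hKd, fderiv_form_along (diffAt hF) (diffAt hS) dY dZ, h.fderiv_mean_sq hp,
      fderiv_clm_apply_const₂ (diffAt (h.induced.smooth p hp)), h.induced.compat hp]
    ring
  rw [covSchouten, e1, hs2, hs2, h.metric.covSchouten_eq hx, h.schouten_induced hW hp,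
    h.schouten_induced hW hp]
  simp only [← h.metric.schoutenForm_apply hx, map_add, map_sub, add_apply, sub_apply, map_smul,
    smul_apply, smul_eq_mul]
  ring

/-- The Cotton–York tensor of the hypersurface is the restriction of that of the ambient space. -/
lemma CoordUmbilic.cotton_induced (h : CoordUmbilic V g O F K H)
    (hW : ∀ p ∈ O, ∀ X Y Z T, weyl g (F p) X Y Z T = 0) (hp : p ∈ O) (X Y Z : Coord 𝕜 3) :
    cotton K p X Y Z
      = cotton g (F p) (fderiv 𝕜 F p X) (fderiv 𝕜 F p Y) (fderiv 𝕜 F p Z) := by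
  have hx := h.maps p hp
  have hs := (h.metric.isSymmForm_schouten hx).symm
  -- The excess of one Cotton–York tensor over the other is the Codazzi expression with normal
  -- vector H itself; H may be isotropic or zero.
  have hw := h.weyl_normal hp (h.normal p hp) X Y Z
  rw [hW p hp] at hw
  rw [h.induced.cotton_eq hp, h.metric.cotton_eq hx, h.covSchouten_induced hW hp,
    h.covSchouten_induced hW hp, h.induced.symm p hp Y X]
  linear_combination -hw

end Hypersurface

/-! ### Frames adapted to a hypersurface. -/

section Frames

variable {𝕜 : Type*} [RCLike 𝕜]

lemma exists_perm_eq₃ (i j : Fin 3) (h : i ≠ j) :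
    ∃ σ : Equiv.Perm (Fin 3), σ 0 = i ∧ σ 1 = j := by
  revert i j
  decide

lemma IsFrame.altForm_ext₃ {b : Bilin 𝕜 (Coord 𝕜 3)} {e : Fin 3 → Coord 𝕜 3} (he : IsFrame b e)
    {β γ : Coord 𝕜 3 → Coord 𝕜 3 → 𝕜} (hβ : IsAltForm β) (hγ : IsAltForm γ)
    (h : ∀ σ : Equiv.Perm (Fin 3), β (e (σ 0)) (e (σ 1)) = γ (e (σ 0)) (e (σ 1)))
    (X Y : Coord 𝕜 3) : β X Y = γ X Y := by
  refine he.ext (S := fun X => β X Y) (T := fun X => γ X Y) (hβ.linear Y) (hγ.linear Y)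
    (fun i => ?_) X
  refine he.ext (S := β (e i)) (T := γ (e i)) (hβ.linear₂ _) (hγ.linear₂ _) (fun j => ?_) Y
  by_cases hij : i = j
  · rw [hij, hβ.self, hγ.self]
  · obtain ⟨σ, rfl, rfl⟩ := exists_perm_eq₃ i j hij
    exact h σ

/-- The permutation `0 ↦ 1, 1 ↦ 2, 2 ↦ 0, 3 ↦ 3`. -/
def cycle₀₁₂ : Equiv.Perm (Fin 4) := Equiv.swap 0 1 * Equiv.swap 1 2

variable {g : Coord 𝕜 4 → Bilin 𝕜 (Coord 𝕜 4)} {μ : Coord 𝕜 4 → Coord 𝕜 4 [⋀^Fin 4]→L[𝕜] 𝕜}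
  {p : Coord 𝕜 4}

lemma IsFrame.hodge_apply₁₂ {f : Fin 4 → Coord 𝕜 4} (hf : IsFrame (g p) f) (hg : Nondeg (g p))
    {β : Coord 𝕜 4 → Coord 𝕜 4 → 𝕜} (hβ : IsAltForm β) :
    hodge g μ p β (f 1) (f 2)
      = μ p f * β (f 0) (f 3) / (g p (f 0) (f 0) * g p (f 3) (f 3)) := by
  have h := (hf.comp cycle₀₁₂).hodge_apply hg hβ (μ := μ)
  rw [vol_perm _ _ _ (by decide)] at h
  simpa only [Function.comp_apply, show cycle₀₁₂ 0 = 1 by decide, show cycle₀₁₂ 1 = 2 by decide,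
    show cycle₀₁₂ 2 = 0 by decide, show cycle₀₁₂ 3 = 3 by decide] using h

lemma IsFrame.hodge_apply₂₀ {f : Fin 4 → Coord 𝕜 4} (hf : IsFrame (g p) f) (hg : Nondeg (g p))
    {β : Coord 𝕜 4 → Coord 𝕜 4 → 𝕜} (hβ : IsAltForm β) :
    hodge g μ p β (f 2) (f 0)
      = μ p f * β (f 1) (f 3) / (g p (f 1) (f 1) * g p (f 3) (f 3)) := by
  have h := (hf.comp (cycle₀₁₂ * cycle₀₁₂)).hodge_apply hg hβ (μ := μ)
  rw [vol_perm _ _ _ (by decide)] at h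
  simpa only [Function.comp_apply, show (cycle₀₁₂ * cycle₀₁₂) 0 = 2 by decide,
    show (cycle₀₁₂ * cycle₀₁₂) 1 = 0 by decide, show (cycle₀₁₂ * cycle₀₁₂) 2 = 1 by decide,
    show (cycle₀₁₂ * cycle₀₁₂) 3 = 3 by decide] using h

/-- A tensor invariant under the Hodge operator, in an orthogonal frame. -/
lemma IsFrame.hodge_relations {a b c ν : Coord 𝕜 4} (hf : IsFrame (g p) ![a, b, c, ν])
    (hg : Nondeg (g p)) {S : Coord 𝕜 4 → Coord 𝕜 4 → Coord 𝕜 4 → Coord 𝕜 4 → 𝕜}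
    (hS : IsCurvatureLike S)
    (h : ∀ X Y Z T, hodge g μ p (fun A B => S A B Z T) X Y = S X Y Z T) :
    (∀ Z T, S a b Z T = μ p ![a, b, c, ν] * S c ν Z T / (g p c c * g p ν ν)) ∧
    (∀ Z T, S b c Z T = μ p ![a, b, c, ν] * S a ν Z T / (g p a a * g p ν ν)) ∧
    (∀ Z T, S c a Z T = μ p ![a, b, c, ν] * S b ν Z T / (g p b b * g p ν ν)) :=
  ⟨fun Z T => (h a b Z T).symm.trans (hf.hodge_apply hg (hS.isAltForm Z T)),
    fun Z T => (h b c Z T).symm.trans (hf.hodge_apply₁₂ hg (hS.isAltForm Z T)),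
    fun Z T => (h c a Z T).symm.trans (hf.hodge_apply₂₀ hg (hS.isAltForm Z T))⟩

lemma isFrame_cons {G : Bilin 𝕜 (Coord 𝕜 4)} (hs : Symm G) {K : Bilin 𝕜 (Coord 𝕜 3)}
    {L : Coord 𝕜 3 →L[𝕜] Coord 𝕜 4} (hK : ∀ X Y, K X Y = G (L X) (L Y)) {e : Fin 3 → Coord 𝕜 3}
    (he : IsFrame K e) {ν : Coord 𝕜 4} (hν : ∀ X, G ν (L X) = 0) (hνν : G ν ν ≠ 0) :
    IsFrame G ![L (e 0), L (e 1), L (e 2), ν] := by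
  have hν' : ∀ X, G (L X) ν = 0 := fun X => by rw [hs, hν]
  have ho := he.ortho
  have hn := he.ne
  simp only [hK] at ho hn
  refine ⟨fun i j hij => ?_, fun i => ?_⟩
  · fin_cases i <;> fin_cases j <;>
      first
        | exact absurd rfl hij
        | exact hν _
        | exact hν' _
        | exact ho _ _ (by decide)
  · fin_cases i <;> first | exact hn _ | exact hνν

/-- A hypersurface with nondegenerate induced metric has a nonisotropic normal vector. -/
lemma exists_normal_vector {G : Bilin 𝕜 (Coord 𝕜 4)} (hs : Symm G) (hG : Nondeg G)
    {K : Bilin 𝕜 (Coord 𝕜 3)} (hKn : Nondeg K) {L : Coord 𝕜 3 →L[𝕜] Coord 𝕜 4}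
    (hK : ∀ X Y, K X Y = G (L X) (L Y)) :
    ∃ ν, (∀ X, G ν (L X) = 0) ∧ G ν ν ≠ 0 := by
  -- If all normal vectors were isotropic, polarization would make the metric vanish on normal
  -- vectors. Then u - L(t u) is orthogonal to everything, hence zero, and L would map 𝕜³ onto 𝕜⁴.
  by_contra! hcon
  have hπ : ∀ u, ∃ t, ∀ X, G (u - L t) (L X) = 0 := by
    intro u
    refine ⟨K.inverse ((G u).comp L), fun X => ?_⟩
    rw [map_sub, sub_apply, ← hK, hKn.apply_inverse]
    simp
  choose t ht using hπ
  have hpol : ∀ u w, G (u - L (t u)) (w - L (t w)) = 0 := by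
    intro u w
    have h1 := hcon _ (ht u)
    have h2 := hcon _ (ht w)
    have h3 := hcon ((u - L (t u)) + (w - L (t w)))
      (fun X => by rw [map_add, add_apply, ht, ht, add_zero])
    rw [map_add, map_add, add_apply, add_apply, h1, h2, hs (w - L (t w))] at h3
    have two : (2 : 𝕜) ≠ 0 := two_ne_zero
    apply mul_left_cancel₀ two
    linear_combination h3
  have hsurj : Function.Surjective L := by
    intro u
    refine ⟨t u, ?_⟩
    have : u - L (t u) = 0 := by
      apply hG
      intro w
      have := hpol u w
      rwa [map_sub, ht, sub_zero] at this
    rw [sub_eq_zero] at this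
    exact this.symm
  have hle := LinearMap.finrank_le_finrank_of_surjective (f := L.toLinearMap) hsurj
  simp at hle

end Frames

/-! ### Frame algebra of the Codazzi and Bianchi identities. -/

section Algebra

variable {𝕜 : Type*} [RCLike 𝕜] {G : Bilin 𝕜 (Coord 𝕜 4)}
  {S : Coord 𝕜 4 → Coord 𝕜 4 → Coord 𝕜 4 → Coord 𝕜 4 → 𝕜} {a b c ν : Coord 𝕜 4} {v : 𝕜}

/-- Self-duality and the Codazzi equation force the Weyl tensor to vanish. -/
lemma codazzi_algebra (hS : IsCurvatureLike S) (hb : G b b ≠ 0) (hc : G c c ≠ 0)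
    (hν : G ν ν ≠ 0) (hv : v ≠ 0) {β : 𝕜}
    (hab : ∀ Z T, S a b Z T = v * S c ν Z T / (G c c * G ν ν))
    (hca : ∀ Z T, S c a Z T = v * S b ν Z T / (G b b * G ν ν))
    (h1 : S a b ν c = 0) (h2 : S a b ν b = β * G b b) (h3 : S c a ν c = -(β * G c c)) :
    S c ν ν c = 0 ∧ S b ν ν c = 0 ∧ S c ν ν b = 0 := by
  have e : S c ν ν b = S b ν ν c := by
    rw [← hS.pair, hS.anti, hS.anti']
    ring
  rw [hab] at h1 h2
  rw [hca] at h3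
  -- By `e`, both `h2` and `h3` evaluate v S(b, ν, ν, c), with opposite values ± β G(b, b) G(c, c)
  -- G(ν, ν).
  have h4 : S b ν ν c = 0 := by
    rw [e] at h2
    field_simp at h2 h3
    have : (2 * v) * S b ν ν c = 0 := by linear_combination h2 + h3
    simpa [hv] using this
  refine ⟨?_, h4, e.trans h4⟩
  simpa [hv, hc, hν] using h1

/-- A curvature tensor with the symmetry of a self-dual one vanishes if its values on the mixed
bivectors do. -/
lemma IsCurvatureLike.eq_zero_of_mixed (hS : IsCurvatureLike S) (hf : IsFrame G ![a, b, c, ν])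
    {ka kb kc : 𝕜} (hab : ∀ Z T, S a b Z T = kc * S c ν Z T)
    (hbc : ∀ Z T, S b c Z T = ka * S a ν Z T) (hca : ∀ Z T, S c a Z T = kb * S b ν Z T)
    (h : ∀ X Y, X = a ∨ X = b ∨ X = c → Y = a ∨ Y = b ∨ Y = c → S X ν ν Y = 0)
    (X Y Z T : Coord 𝕜 4) : S X Y Z T = 0 := by
  have zero : ∀ n : ℕ, IsAltForm (fun _ _ : Coord 𝕜 n => (0 : 𝕜)) := fun n =>
    ⟨fun _ => ⟨fun _ _ => by simp, fun _ _ => by simp⟩, fun _ _ => by simp⟩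
  -- Self-duality turns tangent bivectors in the second pair into mixed ones, so S vanishes on X ∧
  -- ν; the same exchange in the first pair finishes.
  have key : ∀ X, X = a ∨ X = b ∨ X = c → ∀ Z T, S X ν Z T = 0 := by
    intro X hX
    have h' : ∀ Y, Y = a ∨ Y = b ∨ Y = c → S X ν Y ν = 0 := fun Y hY => by
      rw [hS.anti', h X Y hX hY, neg_zero]
    have h'' : ∀ Y, Y = a ∨ Y = b ∨ Y = c → S Y ν X ν = 0 := fun Y hY => by
      rw [hS.anti', h Y X hY hX, neg_zero]
    refine hf.altForm_ext_six (hS.isAltForm' X ν) (zero 4) ?_ ?_ ?_ ?_ ?_ ?_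
    · change S X ν a b = 0
      rw [← hS.pair, hab, h'' c (by simp), mul_zero]
    · change S X ν a c = 0
      rw [← hS.pair, hS.anti, hca, h'' b (by simp), mul_zero, neg_zero]
    · exact h' a (by simp)
    · change S X ν b c = 0
      rw [← hS.pair, hbc, h'' a (by simp), mul_zero]
    · exact h' b (by simp)
    · exact h' c (by simp)
  refine hf.altForm_ext_six (hS.isAltForm Z T) (zero 4) ?_ ?_ ?_ ?_ ?_ ?_ X Y
  · change S a b Z T = 0
    rw [hab, key c (by simp), mul_zero]
  · change S a c Z T = 0
    rw [hS.anti, hca, key b (by simp), mul_zero, neg_zero]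
  · exact key a (by simp) Z T
  · change S b c Z T = 0
    rw [hbc, key a (by simp), mul_zero]
  · exact key b (by simp) Z T
  · exact key c (by simp) Z T

/-- The terms of the second Bianchi identity that involve the Cotton–York tensor `C`. -/
def bianchiTerm (G : Bilin 𝕜 (Coord 𝕜 4)) (C : Coord 𝕜 4 → Coord 𝕜 4 → Coord 𝕜 4 → 𝕜)
    (U X Y Z T : Coord 𝕜 4) : 𝕜 :=
  C U X Z * G Y T - C U X T * G Y Z + (C X Y Z * G U T - C X Y T * G U Z)
    + (C Y U Z * G X T - C Y U T * G X Z)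

/-- The second Bianchi identity determines the Cotton–York tensor in terms of the normal derivative
`S` of a self-dual Weyl tensor. -/
lemma bianchi_algebra (hS : IsCurvatureLike S) (hf : IsFrame G ![a, b, c, ν])
    {C : Coord 𝕜 4 → Coord 𝕜 4 → Coord 𝕜 4 → 𝕜} (hC : ∀ X Y Z, C Y X Z = -C X Y Z)
    (hv : v ^ 2 = G a a * G b b * G c c * G ν ν)
    (hab : ∀ Z T, S a b Z T = v * S c ν Z T / (G c c * G ν ν))
    (hbc : ∀ Z T, S b c Z T = v * S a ν Z T / (G a a * G ν ν))
    (hca : ∀ Z T, S c a Z T = v * S b ν Z T / (G b b * G ν ν))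
    (h0 : ∀ Z T, bianchiTerm G C a b c Z T = 0)
    (h1 : ∀ Z T, S a b Z T + bianchiTerm G C ν a b Z T = 0)
    (h2 : ∀ Z T, S b c Z T + bianchiTerm G C ν b c Z T = 0)
    (h3 : ∀ Z T, S c a Z T + bianchiTerm G C ν c a Z T = 0) :
    (G ν ν * C a b a = -S a b a ν ∧ G ν ν * C a b b = -S a b b ν ∧ G ν ν * C a b c = -S a b c ν) ∧
    (v * C c ν a = G c c * G ν ν * C a b a ∧ v * C c ν b = G c c * G ν ν * C a b b ∧
      v * C c ν c = G c c * G ν ν * C a b c) := by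
  have ha := hf.ne 0
  have hb := hf.ne 1
  have hc := hf.ne 2
  have hν := hf.ne 3
  have o01 := hf.ortho 0 1 (by decide)
  have o02 := hf.ortho 0 2 (by decide)
  have o03 := hf.ortho 0 3 (by decide)
  have o10 := hf.ortho 1 0 (by decide)
  have o12 := hf.ortho 1 2 (by decide)
  have o13 := hf.ortho 1 3 (by decide)
  have o20 := hf.ortho 2 0 (by decide)
  have o21 := hf.ortho 2 1 (by decide)
  have o23 := hf.ortho 2 3 (by decide)
  have o30 := hf.ortho 3 0 (by decide)
  have o31 := hf.ortho 3 1 (by decide)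
  have o32 := hf.ortho 3 2 (by decide)
  change G a a ≠ 0 at ha
  change G b b ≠ 0 at hb
  change G c c ≠ 0 at hc
  change G ν ν ≠ 0 at hν
  change G a b = 0 at o01
  change G a c = 0 at o02
  change G a ν = 0 at o03
  change G b a = 0 at o10
  change G b c = 0 at o12
  change G b ν = 0 at o13
  change G c a = 0 at o20
  change G c b = 0 at o21
  change G c ν = 0 at o23
  change G ν a = 0 at o30
  change G ν b = 0 at o31
  change G ν c = 0 at o32
  have two : (2 : 𝕜) ≠ 0 := two_ne_zero
  have e1 := h1 b ν
  have e2 := h3 c ν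
  have e3 := h0 b c
  have e4 := h1 a ν
  have e5 := h2 c ν
  have e6 := h0 a c
  have e7 := h2 a b
  have e8 := h3 b a
  have e9 := h1 a b
  have e10 := h2 b c
  have e11 := h3 c a
  have e12 := h1 c ν
  simp only [bianchiTerm, o01, o02, o03, o10, o12, o13, o20, o21, o23, o30, o31, o32, mul_zero,
    sub_zero, add_zero, zero_sub, zero_add] at e1 e2 e3 e4 e5 e6 e7 e8 e9 e10 e11 e12
  -- Self-duality turns both sides into multiples of the same component S(b, ν, c, ν).
  have sa : S a b b ν * G c c = S c a c ν * G b b := by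
    rw [hab, hca, hS.pair b ν c ν]
    field_simp
  have sb : S a b a ν * G c c = S b c c ν * G a a := by
    rw [hab, hbc, hS.pair a ν c ν]
    field_simp
  -- `e1` and `e2` contain C(ν, a, ν) with opposite signs; `sa` and the purely tangential identity
  -- `e3` match all their other terms.
  have ta : C ν a ν = 0 := by
    have : (2 * G b b * G c c) * C ν a ν = 0 := by
      rw [hC ν a ν] at e2
      linear_combination G b b * e2 - G c c * e1 + G ν ν * e3 + sa
    simpa [hb, hc] using this
  have tb : C ν b ν = 0 := by
    have : (2 * G a a * G c c) * C ν b ν = 0 := by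
      rw [hC ν b ν] at e4
      linear_combination G c c * e4 - G a a * e5 - G ν ν * e6 - sb
    simpa [ha, hc] using this
  rw [ta] at e1
  rw [hC ν a ν, ta] at e2
  rw [hC ν b ν, tb] at e4
  rw [tb] at e5
  -- The identities `d1` to `d5` rewrite components on two tangent bivectors with one mixed
  -- bivector, the kind already expressed through C.
  have d1 : S b c a b * (G c c * G ν ν) = v * S b c c ν := by
    rw [← hS.pair, hab, ← hS.pair b c c ν]
    field_simp
  have d2 : S c a b a * (G c c * G ν ν) = -(v * S c a c ν) := by
    rw [← hS.pair, hS.anti, hab, ← hS.pair c a c ν]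
    field_simp
  have cyc := hS.cyclic a b c ν
  have d3 : S a b a b * (G c c * G ν ν) = v * S a b c ν := by
    rw [hab a b, ← hS.pair a b c ν]
    field_simp
  have d4 : S b c b c * (G a a * G ν ν) = v * S b c a ν := by
    rw [hbc b c, ← hS.pair b c a ν]
    field_simp
  have d5 : S c a c a * (G b b * G ν ν) = v * S c a b ν := by
    rw [hca c a, ← hS.pair c a b ν]
    field_simp
  rw [hC c ν b] at e8
  rw [hC ν b b] at e9
  rw [hC c ν c] at e11
  rw [hC ν a a] at e11
  refine ⟨⟨?_, ?_, ?_⟩, ?_, ?_, ?_⟩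
  · linear_combination e4
  · linear_combination e1
  · linear_combination e12
  · apply mul_left_cancel₀ (mul_ne_zero (mul_ne_zero ha hb) (mul_ne_zero hc hν))
    linear_combination v * G a a * G c c * G ν ν * e7 - v * G a a * d1 - v ^ 2 * G a a * e5
      - v ^ 2 * G ν ν * e6 + G ν ν * G c c * C a b a * hv
  · apply mul_left_cancel₀ (mul_ne_zero (mul_ne_zero ha hb) (mul_ne_zero hc hν))
    linear_combination -v * G b b * G c c * G ν ν * e8 + v * G b b * d2 - v ^ 2 * G b b * e2
      - v ^ 2 * G ν ν * e3 + G ν ν * G c c * C a b b * hv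
  · apply mul_left_cancel₀ (mul_ne_zero two (mul_ne_zero (mul_ne_zero ha hb) hν))
    -- The equations `e9`, `e10`, `e11` couple C(ν, a, a), C(ν, b, b), C(ν, c, c); this combination
    -- isolates the last. The cyclic identity reduces the remaining S-terms to S(a, b, c, ν), which
    -- `e12` evaluates.
    linear_combination -v * G ν ν * (G a a * e10 + G b b * e11 - G c c * e9)
      + v * (d4 + d5 - d3) + v ^ 2 * cyc - 2 * v ^ 2 * e12 + 2 * G ν ν * C a b c * hv

end Algebra

/-! ### The theorem in coordinates. -/

section CoordinateTheorem

variable {𝕜 : Type*} [RCLike 𝕜] {V : Set (Coord 𝕜 4)} {g : Coord 𝕜 4 → Bilin 𝕜 (Coord 𝕜 4)}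
  {μ : Coord 𝕜 4 → Coord 𝕜 4 [⋀^Fin 4]→L[𝕜] 𝕜}
  {O : Set (Coord 𝕜 3)} {F : Coord 𝕜 3 → Coord 𝕜 4} {K : Coord 𝕜 3 → Bilin 𝕜 (Coord 𝕜 3)}
  {H : Coord 𝕜 3 → Coord 𝕜 4} {p : Coord 𝕜 3} {ν : Coord 𝕜 4}

lemma CoordImmersion.isFrame (h : CoordImmersion V g O F K) (hp : p ∈ O) {e : Fin 3 → Coord 𝕜 3}
    (he : IsFrame (K p) e) (hν : ∀ X, g (F p) ν (fderiv 𝕜 F p X) = 0) (hνν : g (F p) ν ν ≠ 0) :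
    IsFrame (g (F p)) ![fderiv 𝕜 F p (e 0), fderiv 𝕜 F p (e 1), fderiv 𝕜 F p (e 2), ν] :=
  isFrame_cons (h.metric.symm _ (h.maps p hp)) (h.pull p hp) he hν hνν

lemma IsFrame.vol_ne_zero {q : Coord 𝕜 4} {f : Fin 4 → Coord 𝕜 4} (hf : IsFrame (g q) f)
    (hμ : ∀ v, μ q v ^ 2 = Matrix.det (Matrix.of fun i j => g q (v i) (v j))) : μ q f ≠ 0 := by
  intro h0
  have h := hf.vol_sq hμ
  rw [h0] at h
  exact mul_ne_zero (mul_ne_zero (mul_ne_zero (hf.ne 0) (hf.ne 1)) (hf.ne 2)) (hf.ne 3)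
    (by rw [← h]; ring)

/-- The Weyl tensor of a self-dual manifold vanishes along umbilic hypersurfaces. -/
theorem CoordUmbilic.weyl_eq_zero (h : CoordUmbilic V g O F K H) (hμ : IsVolOn V g μ)
    (hsd : ∀ q ∈ V, ∀ X Y Z T, weylMinus g μ q X Y Z T = 0) (hp : p ∈ O) (X Y Z T : Coord 𝕜 4) :
    weyl g (F p) X Y Z T = 0 := by
  have hx := h.maps p hp
  have hg := h.metric.nondeg _ hx
  have hW := h.metric.isCurvatureLike_weyl hx
  obtain ⟨e, he⟩ := exists_isFrame (h.induced.symm p hp) (h.induced.nondeg p hp)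
  obtain ⟨ν, hν, hνν⟩ := exists_normal_vector (h.metric.symm _ hx) hg (h.induced.nondeg p hp)
    (h.pull p hp)
  have hf := h.isFrame hp he hν hνν
  have hv := hf.vol_ne_zero (hμ.sq _ hx)
  obtain ⟨hab, hbc, hca⟩ := hf.hodge_relations hg hW (h.metric.hodge_weyl hμ hx (hsd _ hx))
  have ha := hf.ne 0
  have hb := hf.ne 1
  have hc := hf.ne 2
  have o : ∀ i j, i ≠ j → K p (e i) (e j) = 0 := he.ortho
  have cod := fun i j k => h.weyl_normal hp hν (e i) (e j) (e k)
  have cod0 : ∀ i j k, i ≠ k → j ≠ k → weyl g (F p) (fderiv 𝕜 F p (e i)) (fderiv 𝕜 F p (e j)) ν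
      (fderiv 𝕜 F p (e k)) = 0 := by
    intro i j k hik hjk
    rw [cod, o i k hik, o j k hjk]
    ring
  have cod1 : ∀ i j, i ≠ j → weyl g (F p) (fderiv 𝕜 F p (e i)) (fderiv 𝕜 F p (e j)) ν
      (fderiv 𝕜 F p (e j)) = (g (F p) (meanDeriv g F H p (e i)) ν
        - schouten g (F p) (fderiv 𝕜 F p (e i)) ν)
        * g (F p) (fderiv 𝕜 F p (e j)) (fderiv 𝕜 F p (e j)) := by
    intro i j hij
    rw [cod, o i j hij, ← h.pull p hp]
    ring
  have cod2 : ∀ i j, i ≠ j → weyl g (F p) (fderiv 𝕜 F p (e j)) (fderiv 𝕜 F p (e i)) ν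
      (fderiv 𝕜 F p (e j)) = -((g (F p) (meanDeriv g F H p (e i)) ν
        - schouten g (F p) (fderiv 𝕜 F p (e i)) ν)
        * g (F p) (fderiv 𝕜 F p (e j)) (fderiv 𝕜 F p (e j))) := by
    intro i j hij
    rw [hW.anti, cod1 i j hij]
  -- Applied to the three cyclic rotations of the tangent vectors, the lemma yields all nine entries
  -- of W(·, ν, ν, ·).
  obtain ⟨cc, bc, cb⟩ := codazzi_algebra hW hb hc hνν hv hab hca
    (cod0 0 1 2 (by decide) (by decide)) (cod1 0 1 (by decide)) (cod2 0 2 (by decide))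
  obtain ⟨aa, ca, ac⟩ := codazzi_algebra hW hc ha hνν hv hbc hab
    (cod0 1 2 0 (by decide) (by decide)) (cod1 1 2 (by decide)) (cod2 1 0 (by decide))
  obtain ⟨bb, ab, ba⟩ := codazzi_algebra hW ha hb hνν hv hca hbc
    (cod0 2 0 1 (by decide) (by decide)) (cod1 2 0 (by decide)) (cod2 2 1 (by decide))
  refine hW.eq_zero_of_mixed hf (fun Z T => (hab Z T).trans (mul_div_right_comm _ _ _))
    (fun Z T => (hbc Z T).trans (mul_div_right_comm _ _ _))
    (fun Z T => (hca Z T).trans (mul_div_right_comm _ _ _)) ?_ X Y Z T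
  rintro X Y (rfl | rfl | rfl) (rfl | rfl | rfl) <;> assumption

/-- The Weyl tensor is constant along a hypersurface on which it vanishes. -/
lemma CoordImmersion.fderiv_weyl_tangent (h : CoordImmersion V g O F K)
    (hW : ∀ p ∈ O, ∀ X Y Z T, weyl g (F p) X Y Z T = 0) (hp : p ∈ O) (U : Coord 𝕜 3)
    (X Y Z T : Coord 𝕜 4) :
    fderiv 𝕜 (fun q => weyl g q X Y Z T) (F p) (fderiv 𝕜 F p U) = 0 := by
  have e : (fun q => weyl g (F q) X Y Z T) =ᶠ[𝓝 p] fun _ => 0 := by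
    filter_upwards [h.induced.mem_nhds hp] with q hq using hW q hq X Y Z T
  have e' := fderiv_fun_comp (g := fun q => weyl g q X Y Z T) p
    (diffAt (h.metric.contDiffAt_weyl (h.maps p hp) X Y Z T)) (diffAt (h.smooth p hp))
  rw [e.fderiv_eq, fderiv_fun_const] at e'
  exact (congrArg (fun l => l U) e').symm

/-- Each connection term contains a value of S at the point, hence vanishes. -/
lemma covDeriv4_of_eq_zero {n : ℕ} {g : Coord 𝕜 n → Bilin 𝕜 (Coord 𝕜 n)}
    {S : Coord 𝕜 n → Coord 𝕜 n → Coord 𝕜 n → Coord 𝕜 n → Coord 𝕜 n → 𝕜} {q : Coord 𝕜 n}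
    (h : ∀ X Y Z T, S q X Y Z T = 0) (U X Y Z T : Coord 𝕜 n) :
    covDeriv4 g S q U X Y Z T = fderiv 𝕜 (fun q => S q X Y Z T) q U := by
  simp only [covDeriv4, h, sub_zero]

section Bianchi

variable (h : CoordImmersion V g O F K) (hW : ∀ p ∈ O, ∀ X Y Z T, weyl g (F p) X Y Z T = 0)
  (hp : p ∈ O)
include h hW hp

/-- With three tangent directions every derivative of W in the Bianchi identity vanishes, which
leaves a relation on C alone; with one normal direction a single derivative remains. -/
lemma CoordImmersion.bianchi_tangent (U X Y : Coord 𝕜 3) (Z T : Coord 𝕜 4) :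
    bianchiTerm (g (F p)) (cotton g (F p)) (fderiv 𝕜 F p U) (fderiv 𝕜 F p X) (fderiv 𝕜 F p Y) Z T
      = 0 := by
  have hb := h.metric.second_bianchi_weyl (h.maps p hp) (fderiv 𝕜 F p U) (fderiv 𝕜 F p X)
    (fderiv 𝕜 F p Y) Z T
  simp only [covDeriv4_of_eq_zero (hW p hp), h.fderiv_weyl_tangent hW hp, zero_add] at hb
  exact hb

lemma CoordImmersion.bianchi_normal (ν : Coord 𝕜 4) (X Y : Coord 𝕜 3) (Z T : Coord 𝕜 4) :
    fderiv 𝕜 (fun q => weyl g q (fderiv 𝕜 F p X) (fderiv 𝕜 F p Y) Z T) (F p) ν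
      + bianchiTerm (g (F p)) (cotton g (F p)) ν (fderiv 𝕜 F p X) (fderiv 𝕜 F p Y) Z T = 0 := by
  have hb := h.metric.second_bianchi_weyl (h.maps p hp) ν (fderiv 𝕜 F p X) (fderiv 𝕜 F p Y) Z T
  simp only [covDeriv4_of_eq_zero (hW p hp), h.fderiv_weyl_tangent hW hp, add_zero] at hb
  exact hb

variable (hμ : IsVolOn V g μ) (hsd : ∀ q ∈ V, ∀ X Y Z T, weylMinus g μ q X Y Z T = 0)
  (hν : ∀ X, g (F p) ν (fderiv 𝕜 F p X) = 0) (hνν : g (F p) ν ν ≠ 0)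
include hμ hsd hν hνν

/-- The frame algebra applied to the normal derivative of W. It concerns the first two vectors of an
arbitrary frame, so reordering the frame covers all tangent arguments. -/
lemma CoordImmersion.cotton_frame {e : Fin 3 → Coord 𝕜 3} (he : IsFrame (K p) e) (k : Fin 3) :
    g (F p) ν ν * cotton g (F p) (fderiv 𝕜 F p (e 0)) (fderiv 𝕜 F p (e 1)) (fderiv 𝕜 F p (e k))
      = -fderiv 𝕜 (fun q => weyl g q (fderiv 𝕜 F p (e 0)) (fderiv 𝕜 F p (e 1))
          (fderiv 𝕜 F p (e k)) ν) (F p) ν ∧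
    hodge g μ (F p) (fun A B => cotton g (F p) A B (fderiv 𝕜 F p (e k)))
        (fderiv 𝕜 F p (e 0)) (fderiv 𝕜 F p (e 1))
      = cotton g (F p) (fderiv 𝕜 F p (e 0)) (fderiv 𝕜 F p (e 1)) (fderiv 𝕜 F p (e k)) := by
  have hx := h.maps p hp
  have hg := h.metric.nondeg _ hx
  have hf := h.isFrame hp he hν hνν
  have hS := h.metric.isCurvatureLike_fderiv_weyl hx ν
  obtain ⟨hab, hbc, hca⟩ := hf.hodge_relations (μ := μ) hg hS
    (h.metric.hodge_fderiv_weyl hμ hx hsd (hW p hp) ν)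
  have hc : g (F p) (fderiv 𝕜 F p (e 2)) (fderiv 𝕜 F p (e 2)) ≠ 0 := hf.ne 2
  obtain ⟨⟨h1, h2, h3⟩, h4, h5, h6⟩ := bianchi_algebra hS hf (C := cotton g (F p))
    (fun X Y Z => (h.metric.isAltForm_cotton hx Z).anti X Y) (hf.vol_sq (hμ.sq _ hx)) hab hbc hca
    (h.bianchi_tangent hW hp _ _ _) (h.bianchi_normal hW hp ν _ _) (h.bianchi_normal hW hp ν _ _)
    (h.bianchi_normal hW hp ν _ _)
  have key : ∀ Z, μ (F p) ![fderiv 𝕜 F p (e 0), fderiv 𝕜 F p (e 1), fderiv 𝕜 F p (e 2), ν]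
      * cotton g (F p) (fderiv 𝕜 F p (e 2)) ν Z
      = g (F p) (fderiv 𝕜 F p (e 2)) (fderiv 𝕜 F p (e 2)) * g (F p) ν ν
        * cotton g (F p) (fderiv 𝕜 F p (e 0)) (fderiv 𝕜 F p (e 1)) Z →
      hodge g μ (F p) (fun A B => cotton g (F p) A B Z)
        (fderiv 𝕜 F p (e 0)) (fderiv 𝕜 F p (e 1))
      = cotton g (F p) (fderiv 𝕜 F p (e 0)) (fderiv 𝕜 F p (e 1)) Z := by
    intro Z hZ
    refine (hf.hodge_apply hg (h.metric.isAltForm_cotton hx Z)).trans ?_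
    refine (congrArg (fun t => t / _) hZ).trans ?_
    exact mul_div_cancel_left₀ _ (mul_ne_zero hc hνν)
  fin_cases k
  · exact ⟨h1, key _ h4⟩
  · exact ⟨h2, key _ h5⟩
  · exact ⟨h3, key _ h6⟩

/-- The Cotton–York tensor on tangent vectors is the normal derivative of the Weyl tensor. -/
lemma CoordImmersion.cotton_eq_fderiv_weyl (X Y Z : Coord 𝕜 3) :
    g (F p) ν ν * cotton g (F p) (fderiv 𝕜 F p X) (fderiv 𝕜 F p Y) (fderiv 𝕜 F p Z)
      = -fderiv 𝕜 (fun q => weyl g q (fderiv 𝕜 F p X) (fderiv 𝕜 F p Y) (fderiv 𝕜 F p Z) ν)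
        (F p) ν := by
  have hx := h.maps p hp
  have hS := h.metric.isCurvatureLike_fderiv_weyl hx ν
  obtain ⟨e, he⟩ := exists_isFrame (h.induced.symm p hp) (h.induced.nondeg p hp)
  have hC := h.metric.isAltForm_cotton hx (fderiv 𝕜 F p Z)
  refine he.altForm_ext₃
    (β := fun X Y => g (F p) ν ν
      * cotton g (F p) (fderiv 𝕜 F p X) (fderiv 𝕜 F p Y) (fderiv 𝕜 F p Z))
    (γ := fun X Y => -fderiv 𝕜 (fun q => weyl g q (fderiv 𝕜 F p X) (fderiv 𝕜 F p Y)
      (fderiv 𝕜 F p Z) ν) (F p) ν) ?_ ?_ (fun σ => ?_) X Y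
  · refine ⟨fun Y => ⟨fun X X' => ?_, fun c X => ?_⟩, fun X Y => ?_⟩
    · rw [map_add, (hC.linear _).map_add, mul_add]
    · rw [map_smul, (hC.linear _).map_smul, smul_eq_mul, smul_eq_mul, mul_left_comm]
    · rw [hC.anti, mul_neg]
  · refine ⟨fun Y => ⟨fun X X' => ?_, fun c X => ?_⟩, fun X Y => ?_⟩
    · rw [map_add, (hS.linear _ _ _).map_add, neg_add]
    · rw [map_smul, (hS.linear _ _ _).map_smul, smul_neg]
    · rw [hS.anti]
  · have hCl := h.metric.isLinearMap_cotton hx (fderiv 𝕜 F p (e (σ 0))) (fderiv 𝕜 F p (e (σ 1)))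
    refine he.comp σ |>.ext
      (S := fun Z => g (F p) ν ν
        * cotton g (F p) (fderiv 𝕜 F p (e (σ 0))) (fderiv 𝕜 F p (e (σ 1))) (fderiv 𝕜 F p Z))
      (T := fun Z => -fderiv 𝕜 (fun q => weyl g q (fderiv 𝕜 F p (e (σ 0)))
        (fderiv 𝕜 F p (e (σ 1))) (fderiv 𝕜 F p Z) ν) (F p) ν) ?_ ?_ (fun k => ?_) Z
    · refine ⟨fun Z Z' => ?_, fun c Z => ?_⟩
      · rw [map_add, hCl.map_add, mul_add]
      · rw [map_smul, hCl.map_smul, smul_eq_mul, smul_eq_mul, mul_left_comm]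
    · refine ⟨fun Z Z' => ?_, fun c Z => ?_⟩
      · rw [map_add, (hS.linear₃ _ _ _).map_add, neg_add]
      · rw [map_smul, (hS.linear₃ _ _ _).map_smul, smul_neg]
    · exact (h.cotton_frame hW hp hμ hsd hν hνν (he.comp σ) k).1

/-- The Cotton–York tensor is self-dual on tangent vectors. -/
lemma CoordImmersion.hodge_cotton (X Y Z : Coord 𝕜 3) :
    hodge g μ (F p) (fun A B => cotton g (F p) A B (fderiv 𝕜 F p Z))
        (fderiv 𝕜 F p X) (fderiv 𝕜 F p Y)
      = cotton g (F p) (fderiv 𝕜 F p X) (fderiv 𝕜 F p Y) (fderiv 𝕜 F p Z) := by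
  have hx := h.maps p hp
  obtain ⟨e, he⟩ := exists_isFrame (h.induced.symm p hp) (h.induced.nondeg p hp)
  have hC := h.metric.isAltForm_cotton hx (fderiv 𝕜 F p Z)
  have hD := isAltForm_hodge (g := g) (μ := μ) (p := F p)
    (fun A B => cotton g (F p) A B (fderiv 𝕜 F p Z))
  refine he.altForm_ext₃
    (β := fun X Y => hodge g μ (F p) (fun A B => cotton g (F p) A B (fderiv 𝕜 F p Z))
        (fderiv 𝕜 F p X) (fderiv 𝕜 F p Y))
    (γ := fun X Y => cotton g (F p) (fderiv 𝕜 F p X) (fderiv 𝕜 F p Y) (fderiv 𝕜 F p Z))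
    (hD.comp _) (hC.comp _) (fun σ => ?_) X Y
  have hCl := h.metric.isLinearMap_cotton hx
  refine he.comp σ |>.ext
    (S := fun Z => hodge g μ (F p) (fun A B => cotton g (F p) A B (fderiv 𝕜 F p Z))
      (fderiv 𝕜 F p (e (σ 0))) (fderiv 𝕜 F p (e (σ 1))))
    (T := fun Z => cotton g (F p) (fderiv 𝕜 F p (e (σ 0))) (fderiv 𝕜 F p (e (σ 1)))
      (fderiv 𝕜 F p Z)) ?_ ?_ (fun k => ?_) Z
  · refine ⟨fun Z Z' => ?_, fun c Z => ?_⟩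
    · simp only [hodge, map_add, (hCl _ _).map_add, mul_add, Finset.sum_add_distrib]
    · simp only [hodge, map_smul, (hCl _ _).map_smul, smul_eq_mul, Finset.mul_sum]
      exact Finset.sum_congr rfl fun _ _ => Finset.sum_congr rfl fun _ _ => by ring
  · refine ⟨fun Z Z' => ?_, fun c Z => ?_⟩
    · rw [map_add, (hCl _ _).map_add]
    · rw [map_smul, (hCl _ _).map_smul]
  · exact (h.cotton_frame hW hp hμ hsd hν hνν (he.comp σ) k).2

end Bianchi

/-- A curvature tensor that is invariant under the Hodge operator of the ambient space, in terms of
the Hodge operator of a hypersurface. -/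
lemma IsCurvatureLike.apply_hodge {S : Coord 𝕜 4 → Coord 𝕜 4 → Coord 𝕜 4 → Coord 𝕜 4 → 𝕜}
    (hS : IsCurvatureLike S) {k : Bilin 𝕜 (Coord 𝕜 3)} (hs : Symm k) (hk : Nondeg k)
    {L : Coord 𝕜 3 →L[𝕜] Coord 𝕜 4} {m : Coord 𝕜 4 [⋀^Fin 4]→L[𝕜] 𝕜}
    (h : ∀ f, IsFrame k f → ∀ Z T, S (L (f 0)) (L (f 1)) Z T
      = m ![L (f 0), L (f 1), L (f 2), ν] * S (L (f 2)) ν Z T / k (f 2) (f 2))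
    (X Y : Coord 𝕜 4) {A B w : Coord 𝕜 3} (hw : ∀ Z, k w Z = m ![L A, L B, L Z, ν]) :
    S X Y (L A) (L B) = S X Y (L w) ν := by
  have ext : ∀ u v, (∀ Z, k u Z = k v Z) → u = v := fun u v huv =>
    sub_eq_zero.1 (hk _ fun Z => by rw [map_sub, sub_apply, huv, sub_self])
  have hex : ∀ A B, ∃ w, ∀ Z, k w Z = m ![L A, L B, L Z, ν] := by
    intro A B
    set l : Coord 𝕜 3 →L[𝕜] 𝕜 := (LinearMap.toContinuousLinearMap
      ((vol_linear₂ m (L A) (L B) ν).mk' _)).comp L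
    refine ⟨k.inverse l, fun Z => ?_⟩
    rw [hk.apply_inverse]
    rfl
  choose s hs' using hex
  rw [ext w (s A B) fun Z => by rw [hw, hs']]
  have halt : IsAltForm fun A B => S X Y (L (s A B)) ν := by
    refine ⟨fun B => ⟨fun A A' => ?_, fun c A => ?_⟩, fun A B => ?_⟩
    · rw [ext (s (A + A') B) (s A B + s A' B) fun Z => by
        rw [map_add k, add_apply, hs', hs', hs', map_add, (vol_linear₀ _ _ _ _).map_add],
        map_add, (hS.linear₃ _ _ _).map_add]
    · rw [ext (s (c • A) B) (c • s A B) fun Z => by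
        rw [map_smul k, smul_apply, hs', hs', map_smul, (vol_linear₀ _ _ _ _).map_smul],
        map_smul, (hS.linear₃ _ _ _).map_smul]
    · rw [ext (s B A) (-s A B) fun Z => by rw [map_neg k, neg_apply, hs', hs', vol_swap₀₁],
        map_neg, (hS.linear₃ _ _ _).map_neg]
  have key : ∀ f, IsFrame k f → S X Y (L (f 0)) (L (f 1)) = S X Y (L (s (f 0) (f 1))) ν := by
    intro f hf
    have z0 : ∀ a b, m ![a, b, a, ν] = 0 := fun a b => vol_eq_zero m 0 2 (by decide) rfl
    have z1 : ∀ a b, m ![a, b, b, ν] = 0 := fun a b => vol_eq_zero m 1 2 (by decide) rfl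
    -- In a frame the dual of f₀ ∧ f₁ is m(f₀, f₁, f₂, ν) / k(f₂, f₂) times f₂, the factor that
    -- occurs in `h`.
    rw [hf.expand (s (f 0) (f 1)), Fin.sum_univ_three, hs', hs', hs', z0, z1, zero_div, zero_div,
      zero_smul, zero_smul, zero_add, zero_add, map_smul, (hS.linear₃ _ _ _).map_smul, ← hS.pair,
      h f hf, hS.pair X Y (L (f 2)) ν, smul_eq_mul]
    ring
  obtain ⟨e, he⟩ := exists_isFrame hs hk
  exact he.altForm_ext₃ ((hS.isAltForm' X Y).comp L) halt (fun σ => key _ (he.comp σ)) A B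

/-! ### The three assertions in coordinates. -/

section Conclusion

variable (h : CoordUmbilic V g O F K H) (hμ : IsVolOn V g μ)
  (hsd : ∀ q ∈ V, ∀ X Y Z T, weylMinus g μ q X Y Z T = 0) (hp : p ∈ O)
include h hμ hsd hp

theorem CoordUmbilic.weylPlus_eq_zero (X Y Z T : Coord 𝕜 4) : weylPlus g μ (F p) X Y Z T = 0 := by
  have hx := h.maps p hp
  rw [h.metric.weylPlus_eq hμ hx (hsd _ hx), h.weyl_eq_zero hμ hsd hp]

lemma CoordUmbilic.covDeriv4_weylPlus (U X Y Z T : Coord 𝕜 4) :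
    covDeriv4 g (weylPlus g μ) (F p) U X Y Z T
      = fderiv 𝕜 (fun q => weyl g q X Y Z T) (F p) U := by
  rw [covDeriv4_of_eq_zero (h.weylPlus_eq_zero hμ hsd hp)]
  congr 1
  apply EventuallyEq.fderiv_eq
  filter_upwards [h.metric.mem_nhds (h.maps p hp)] with q hq
    using h.metric.weylPlus_eq hμ hq (hsd q hq) X Y Z T

/-- On tangent vectors C is already self-dual, so the projection does nothing, and there C restricts
to the tensor of the induced metric. The normal vector is auxiliary. -/
theorem CoordUmbilic.cottonPlus_eq (X Y Z : Coord 𝕜 3) :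
    cottonPlus g μ (F p) (fderiv 𝕜 F p X) (fderiv 𝕜 F p Y) (fderiv 𝕜 F p Z)
      = cotton K p X Y Z := by
  have hx := h.maps p hp
  have hW : ∀ p ∈ O, ∀ X Y Z T, weyl g (F p) X Y Z T = 0 := fun p hp => h.weyl_eq_zero hμ hsd hp
  obtain ⟨ν, hν, hνν⟩ := exists_normal_vector (h.metric.symm _ hx) (h.metric.nondeg _ hx)
    (h.induced.nondeg p hp) (h.pull p hp)
  rw [cottonPlus, h.hodge_cotton hW hp hμ hsd hν hνν, h.cotton_induced hW hp]
  ring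

/-- With S the normal derivative of W: S(A₁, A₂, B₁, B₂) = S(A₁, A₂, w, ν) by self-duality, and this
is -C(A₁, A₂)(w) by the Bianchi identity. -/
theorem CoordUmbilic.covDeriv4_weylPlus_eq (hν : ∀ X, g (F p) ν (fderiv 𝕜 F p X) = 0)
    (hνν : g (F p) ν ν = 1) (A₁ A₂ B₁ B₂ w : Coord 𝕜 3)
    (hw : ∀ Z, K p w Z = μ (F p) ![fderiv 𝕜 F p B₁, fderiv 𝕜 F p B₂, fderiv 𝕜 F p Z, ν]) :
    covDeriv4 g (weylPlus g μ) (F p) ν (fderiv 𝕜 F p A₁) (fderiv 𝕜 F p A₂) (fderiv 𝕜 F p B₁)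
      (fderiv 𝕜 F p B₂) = -cotton K p A₁ A₂ w := by
  have hx := h.maps p hp
  have hW : ∀ p ∈ O, ∀ X Y Z T, weyl g (F p) X Y Z T = 0 := fun p hp => h.weyl_eq_zero hμ hsd hp
  have hνν' : g (F p) ν ν ≠ 0 := by rw [hνν]; exact one_ne_zero
  have hS := h.metric.isCurvatureLike_fderiv_weyl hx ν
  have hC := h.cotton_eq_fderiv_weyl hW hp hμ hsd hν hνν' A₁ A₂ w
  rw [hνν, one_mul] at hC
  rw [h.covDeriv4_weylPlus hμ hsd hp, h.cotton_induced hW hp, hC, neg_neg]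
  refine hS.apply_hodge (h.induced.symm p hp) (h.induced.nondeg p hp) (fun f hf Z T => ?_) _ _ hw
  obtain ⟨hab, -, -⟩ := (h.isFrame hp hf hν hνν').hodge_relations (μ := μ)
    (h.metric.nondeg _ hx) hS (h.metric.hodge_fderiv_weyl hμ hx hsd (hW p hp) ν)
  have h1 := hab Z T
  rw [hνν, mul_one, ← h.pull p hp] at h1
  exact h1

end Conclusion

end CoordinateTheorem

/-! ### Tensors on a manifold and their chart expressions. -/

section Charts

variable {𝕜 : Type*} [RCLike 𝕜] {n : ℕ} {N : Type*} [TopologicalSpace N]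
  [ChartedSpace (Coord 𝕜 n) N]
  {φ : OpenPartialHomeomorph N (Coord 𝕜 n)}

lemma mdifferentiable_chart (hφ : φ ∈ charts 𝕜 n N) :
    φ.MDifferentiable 𝓘(𝕜, Coord 𝕜 n) 𝓘(𝕜, Coord 𝕜 n) :=
  ⟨(contMDiffOn_of_mem_maximalAtlas hφ).mdifferentiableOn (by simp),
    (contMDiffOn_symm_of_mem_maximalAtlas hφ).mdifferentiableOn (by simp)⟩

lemma dChart_dChartSymm (hφ : φ ∈ charts 𝕜 n N) {p : Coord 𝕜 n} (hp : p ∈ φ.target)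
    (u : Coord 𝕜 n) : dChart (𝕜 := 𝕜) φ (φ.symm p) (dChartSymm φ p u) = u :=
  congrArg (fun l => l u) ((mdifferentiable_chart hφ).comp_symm_deriv hp)

lemma dChartSymm_dChart (hφ : φ ∈ charts 𝕜 n N) {p : Coord 𝕜 n} (hp : p ∈ φ.target)
    (u : Tan 𝕜 n (φ.symm p)) : dChartSymm φ p (dChart φ (φ.symm p) u) = u := by
  have h := (mdifferentiable_chart hφ).symm_comp_deriv (φ.map_target hp)
  rw [φ.right_inv hp] at h
  exact congrArg (fun l => l u) h

lemma dChart_surjective (hφ : φ ∈ charts 𝕜 n N) {x : N} (hx : x ∈ φ.source) :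
    Function.Surjective (dChart (𝕜 := 𝕜) φ x) := by
  obtain ⟨p, hp, rfl⟩ : ∃ p ∈ φ.target, φ.symm p = x := ⟨φ x, φ.map_source hx, φ.left_inv hx⟩
  exact fun u => ⟨_, dChart_dChartSymm hφ hp u⟩

/-- The chart expression of a form, evaluated on the images of tangent vectors. -/
lemma coordForm_dChart (hφ : φ ∈ charts 𝕜 n N) (g : (x : N) → Bilin 𝕜 (Tan 𝕜 n x)) {x : N}
    (hx : x ∈ φ.source) (u v : Tan 𝕜 n x) :
    coordForm φ g (φ x) (dChart φ x u) (dChart φ x v) = g x u v := by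
  obtain ⟨p, hp, rfl⟩ : ∃ p ∈ φ.target, φ.symm p = x := ⟨φ x, φ.map_source hx, φ.left_inv hx⟩
  rw [φ.right_inv hp]
  change g (φ.symm p) (dChartSymm φ p (dChart φ (φ.symm p) u))
    (dChartSymm φ p (dChart φ (φ.symm p) v)) = _
  rw [dChartSymm_dChart hφ hp, dChartSymm_dChart hφ hp]

lemma coordVol_dChart (hφ : φ ∈ charts 𝕜 n N) (μ : (x : N) → Tan 𝕜 n x [⋀^Fin n]→L[𝕜] 𝕜) {x : N}
    (hx : x ∈ φ.source) (v : Fin n → Tan 𝕜 n x) :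
    coordVol φ μ (φ x) (fun i => dChart φ x (v i)) = μ x v := by
  obtain ⟨p, hp, rfl⟩ : ∃ p ∈ φ.target, φ.symm p = x := ⟨φ x, φ.map_source hx, φ.left_inv hx⟩
  rw [φ.right_inv hp]
  change μ (φ.symm p) (fun i => dChartSymm φ p (dChart φ (φ.symm p) (v i))) = _
  simp only [dChartSymm_dChart hφ hp]

lemma IsMetricOn.coordMetricOn {U : Set N} {g : (x : N) → Bilin 𝕜 (Tan 𝕜 n x)}
    (hg : IsMetricOn U g) (hφ : φ ∈ charts 𝕜 n N) :
    CoordMetricOn (φ.target ∩ φ.symm ⁻¹' U) (coordForm φ g) := by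
  have ho : IsOpen (φ.target ∩ φ.symm ⁻¹' U) := φ.isOpen_inter_preimage_symm hg.isOpen
  refine ⟨ho, fun p hp u v => hg.symm _ hp.2 _ _, fun p hp u hu => ?_,
    fun p hp => (hg.smooth φ hφ).contDiffAt (ho.mem_nhds hp)⟩
  have h0 : dChartSymm (𝕜 := 𝕜) φ p u = 0 := by
    refine hg.nondegenerate _ hp.2 _ fun w => ?_
    have h := hu (dChart φ (φ.symm p) w)
    change g (φ.symm p) (dChartSymm φ p u) (dChartSymm φ p (dChart φ (φ.symm p) w)) = 0 at h
    rwa [dChartSymm_dChart hφ hp.1] at h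
  rw [← dChart_dChartSymm hφ hp.1 u, h0, map_zero]

end Charts

/-! ### From umbilic hypersurfaces of manifolds to coordinates. -/

section Transfer

variable {𝕜 : Type*} [RCLike 𝕜] {N : Type*} [TopologicalSpace N] [ChartedSpace (Coord 𝕜 4) N]
  {φ : OpenPartialHomeomorph N (Coord 𝕜 4)}
  {c : ConformalStructure 𝕜 4 N} {U : Set N} {g : (x : N) → Bilin 𝕜 (Tan 𝕜 4 x)}

lemma ConformalStructure.Orientation.isVolOn (o : c.Orientation) (hg : c.IsLocalMetric U g)
    (hφ : φ ∈ charts 𝕜 4 N) :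
    IsVolOn (φ.target ∩ φ.symm ⁻¹' U) (coordForm φ g) (coordVol φ (o.volForm g)) :=
  ⟨fun p hp v => o.vol_sq _ _ (hg.2 _ hp.2) fun i => dChartSymm φ p (v i),
    fun _ hp v => (o.smooth U g hg φ hφ v).contDiffAt
      ((φ.isOpen_inter_preimage_symm hg.1.isOpen).mem_nhds hp)⟩

lemma ConformalStructure.Orientation.IsSelfDual.weylMinus_eq_zero {o : c.Orientation}
    (h : o.IsSelfDual) (hg : c.IsLocalMetric U g) (hφ : φ ∈ charts 𝕜 4 N) {q : Coord 𝕜 4}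
    (hq : q ∈ φ.target ∩ φ.symm ⁻¹' U) (X Y Z T : Coord 𝕜 4) :
    weylMinus (coordForm φ g) (coordVol φ (o.volForm g)) q X Y Z T = 0 := by
  have h := h U g hg φ hφ (φ.symm q) ⟨hq.2, φ.map_target hq.1⟩ X Y Z T
  rwa [φ.right_inv hq.1] at h

variable {M : Type*} [TopologicalSpace M] [ChartedSpace (Coord 𝕜 3) M]
  {ψ : OpenPartialHomeomorph M (Coord 𝕜 3)} {ι : M → N}

lemma IsMetricOn.ne_zero (hg : IsMetricOn U g) {x : N} (hx : x ∈ U) : g x ≠ 0 := by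
  intro h0
  have h1 : (stdVec 0 : Coord 𝕜 4) = 0 := hg.nondegenerate _ hx _ fun v => by rw [h0]; rfl
  have h2 := congrArg (fun v : Coord 𝕜 4 => v 0) h1
  simp [stdVec] at h2

/-- The expression of `ι` in charts. -/
abbrev coordMap (φ : OpenPartialHomeomorph N (Coord 𝕜 4)) (ψ : OpenPartialHomeomorph M (Coord 𝕜 3))
    (ι : M → N) : Coord 𝕜 3 → Coord 𝕜 4 :=
  φ ∘ ι ∘ ψ.symm

/-- The domain of the expression in charts of `ι` on which a metric given on `U` is defined. -/
def coordDomain (φ : OpenPartialHomeomorph N (Coord 𝕜 4))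
    (ψ : OpenPartialHomeomorph M (Coord 𝕜 3)) (ι : M → N) (U : Set N) : Set (Coord 𝕜 3) :=
  ψ.target ∩ ψ.symm ⁻¹' (ι ⁻¹' (U ∩ φ.source))

lemma contDiffAt_coordMap (hι : ContMDiff 𝓘(𝕜, Coord 𝕜 3) 𝓘(𝕜, Coord 𝕜 4) ∞ ι)
    (hφ : φ ∈ charts 𝕜 4 N) (hψ : ψ ∈ charts 𝕜 3 M) {p : Coord 𝕜 3}
    (hp : p ∈ coordDomain φ ψ ι U) : ContDiffAt 𝕜 ∞ (coordMap φ ψ ι) p := by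
  have h1 := contMDiffAt_of_mem_maximalAtlas hφ hp.2.2
  have h2 := contMDiffAt_symm_of_mem_maximalAtlas hψ hp.1
  exact (h1.comp p ((hι _).comp p h2)).contDiffAt

lemma fderiv_coordMap (hι : ContMDiff 𝓘(𝕜, Coord 𝕜 3) 𝓘(𝕜, Coord 𝕜 4) ∞ ι)
    (hφ : φ ∈ charts 𝕜 4 N) (hψ : ψ ∈ charts 𝕜 3 M) {p : Coord 𝕜 3}
    (hp : p ∈ coordDomain φ ψ ι U) (u : Coord 𝕜 3) :
    fderiv 𝕜 (coordMap φ ψ ι) p u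
      = dChart φ (ι (ψ.symm p)) (diff ι (ψ.symm p) (dChartSymm ψ p u)) := by
  have h1 := (mdifferentiable_chart hφ).mdifferentiableAt hp.2.2
  have h2 := (mdifferentiable_chart hψ).mdifferentiableAt_symm hp.1
  have h3 : MDifferentiableAt 𝓘(𝕜, Coord 𝕜 3) 𝓘(𝕜, Coord 𝕜 4) ι (ψ.symm p) :=
    (hι _).mdifferentiableAt (by simp)
  rw [← mfderiv_eq_fderiv, coordMap, mfderiv_comp p h1 (h3.comp p h2), mfderiv_comp p h3 h2]
  rfl

lemma dChart_diff (hι : ContMDiff 𝓘(𝕜, Coord 𝕜 3) 𝓘(𝕜, Coord 𝕜 4) ∞ ι)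
    (hφ : φ ∈ charts 𝕜 4 N) (hψ : ψ ∈ charts 𝕜 3 M) {y : M} (hy : y ∈ ψ.source)
    (hyU : ι y ∈ U ∩ φ.source) (u : Tan 𝕜 3 y) :
    dChart φ (ι y) (diff ι y u) = fderiv 𝕜 (coordMap φ ψ ι) (ψ y) (dChart ψ y u) := by
  obtain ⟨p, hp, rfl⟩ : ∃ p ∈ ψ.target, ψ.symm p = y := ⟨ψ y, ψ.map_source hy, ψ.left_inv hy⟩
  have hp' : p ∈ coordDomain φ ψ ι U := ⟨hp, hyU⟩
  rw [ψ.right_inv hp, fderiv_coordMap hι hφ hψ hp', dChartSymm_dChart hψ hp]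

lemma IsUmbilicHypersurface.coordImmersion (hM : IsUmbilicHypersurface c ι)
    (hg : c.IsLocalMetric U g) (hφ : φ ∈ charts 𝕜 4 N) (hψ : ψ ∈ charts 𝕜 3 M) :
    CoordImmersion (φ.target ∩ φ.symm ⁻¹' U) (coordForm φ g) (coordDomain φ ψ ι U)
      (coordMap φ ψ ι) (coordForm ψ (inducedMetric ι g)) := by
  have hV := hg.1.coordMetricOn hφ
  have ho : IsOpen (coordDomain φ ψ ι U) := ψ.isOpen_inter_preimage_symm
    ((hg.1.isOpen.inter φ.open_source).preimage hM.smooth.continuous)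
  have hmaps : ∀ p ∈ coordDomain φ ψ ι U, coordMap φ ψ ι p ∈ φ.target ∩ φ.symm ⁻¹' U := by
    intro p hp
    refine ⟨φ.map_source hp.2.2, ?_⟩
    change φ.symm (φ (ι (ψ.symm p))) ∈ U
    rw [φ.left_inv hp.2.2]
    exact hp.2.1
  have hsm := fun p (hp : p ∈ coordDomain φ ψ ι U) => contDiffAt_coordMap hM.smooth hφ hψ hp
  have hpull : ∀ p ∈ coordDomain φ ψ ι U, ∀ X Y, coordForm ψ (inducedMetric ι g) p X Y
      = coordForm φ g (coordMap φ ψ ι p) (fderiv 𝕜 (coordMap φ ψ ι) p X)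
        (fderiv 𝕜 (coordMap φ ψ ι) p Y) := by
    intro p hp X Y
    rw [fderiv_coordMap hM.smooth hφ hψ hp, fderiv_coordMap hM.smooth hφ hψ hp]
    exact (coordForm_dChart hφ g hp.2.2 _ _).symm
  refine ⟨hV, ⟨ho, fun p hp X Y => ?_, fun p hp X hX => ?_, fun p hp => ?_⟩, hmaps, hsm, hpull⟩
  · rw [hpull p hp, hpull p hp, hV.symm _ (hmaps p hp)]
  · have hb := hg.1.ne_zero hp.2.1
    have h0 : dChartSymm (𝕜 := 𝕜) ψ p X = 0 := by
      refine hM.nondegenerate _ _ (hg.2 _ hp.2.1) hb _ fun w => ?_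
      have h := hX (dChart ψ (ψ.symm p) w)
      change g _ (diff ι (ψ.symm p) (dChartSymm ψ p X))
        (diff ι (ψ.symm p) (dChartSymm ψ p (dChart ψ (ψ.symm p) w))) = 0 at h
      rwa [dChartSymm_dChart hψ hp.1] at h
    rw [← dChart_dChartSymm hψ hp.1 X, h0, map_zero]
  -- Smoothness of the induced metric is checked on constant vectors, where it equals the pull-back
  -- of the ambient metric by the derivative of the coordinate map.
  · have e : ∀ q, coordForm ψ (inducedMetric ι g) q
        = toCLM₂ fun X Y => coordForm ψ (inducedMetric ι g) q X Y := by
      intro q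
      ext X Y
      rw [toCLM₂_apply]
      · exact fun Y => ⟨fun X X' => by rw [map_add, add_apply], fun c X => by
          rw [map_smul, smul_apply]⟩
      · exact fun X => ⟨fun Y Y' => map_add _ _ _, fun c Y => map_smul _ _ _⟩
    rw [funext e]
    refine contDiffAt_toCLM₂ fun X Y => ?_
    have hF := hsm p hp
    have h1 : ContDiffAt 𝕜 ∞ (fun q => coordForm φ g (coordMap φ ψ ι q)) p :=
      ContDiffAt.comp (𝕜 := 𝕜) p (hV.smooth _ (hmaps p hp)) hF
    have h2 := (h1.clm_apply ((contDiffAt_fderiv hF).apply_const X)).clm_apply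
      ((contDiffAt_fderiv hF).apply_const Y)
    refine h2.congr_of_eventuallyEq ?_
    filter_upwards [ho.mem_nhds hp] with q hq using hpull q hq X Y

lemma IsUmbilicHypersurface.exists_coordUmbilic (hM : IsUmbilicHypersurface c ι)
    (hg : c.IsLocalMetric U g) (hφ : φ ∈ charts 𝕜 4 N) (hψ : ψ ∈ charts 𝕜 3 M) {y : M}
    (hy : y ∈ ψ.source) (hyU : ι y ∈ U ∩ φ.source) :
    ∃ O H, ψ y ∈ O ∧ CoordUmbilic (φ.target ∩ φ.symm ⁻¹' U) (coordForm φ g) O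
      (coordMap φ ψ ι) (coordForm ψ (inducedMetric ι g)) H := by
  have hp : ψ y ∈ coordDomain φ ψ ι U := by
    refine ⟨ψ.map_source hy, ?_⟩
    change ι (ψ.symm (ψ y)) ∈ U ∩ φ.source
    rwa [ψ.left_inv hy]
  obtain ⟨O, H, h1, -, h2⟩ := (hM.coordImmersion hg hφ hψ).exists_umbilic (fun p hp => by
    have h := hM.umbilic U g hg φ hφ ψ hψ (ψ.symm p) (ψ.map_target hp.1) hp.2
    rwa [ψ.right_inv hp.1] at h) hp
  exact ⟨O, H, h1, h2⟩

/-- The defining property of the Hodge operator of a hypersurface. -/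
lemma IsUmbilicHypersurface.apply_hodgeM (hM : IsUmbilicHypersurface c ι)
    (hg : c.IsLocalMetric U g) {y : M} (hy : ι y ∈ U) (μ : Tan 𝕜 4 (ι y) [⋀^Fin 4]→L[𝕜] 𝕜)
    (ν : Tan 𝕜 4 (ι y)) (u v z : Tan 𝕜 3 y) :
    inducedMetric ι g y (hodgeM ι y (g (ι y)) μ ν u v) z
      = μ ![diff ι y u, diff ι y v, diff ι y z, ν] := by
  -- The tangent space is `Coord 𝕜 3` by definition; naming the latter supplies the norm that
  -- `Nondeg` asks for.
  have hn : Nondeg (V := Coord 𝕜 3) (inducedMetric ι g y) := fun u hu =>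
    hM.nondegenerate y _ (hg.2 _ hy) (hg.1.ne_zero hy) u hu
  have h := hn.apply_inverse ((μ.toContinuousMultilinearMap.toContinuousLinearMap
      ![diff ι y u, diff ι y v, 0, ν] 2).comp (diff ι y))
  have e : Function.update ![diff ι y u, diff ι y v, 0, ν] 2 (diff ι y z)
      = ![diff ι y u, diff ι y v, diff ι y z, ν] := by
    ext i : 1
    fin_cases i <;> rfl
  rw [← e]
  exact congrArg (fun l => l z) h

end Transfer

end SelfDualUmbilic

end

/-! ### The theorem on manifolds. -/

theorem theorem1 {𝕜 : Type*} [RCLike 𝕜]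
    {N : Type*} [TopologicalSpace N] [ChartedSpace (SelfDualUmbilic.Coord 𝕜 4) N]
    [IsManifold 𝓘(𝕜, SelfDualUmbilic.Coord 𝕜 4) ∞ N]
    {M : Type*} [TopologicalSpace M] [ChartedSpace (SelfDualUmbilic.Coord 𝕜 3) M]
    [IsManifold 𝓘(𝕜, SelfDualUmbilic.Coord 𝕜 3) ∞ M]
    (c : SelfDualUmbilic.ConformalStructure 𝕜 4 N) (o : c.Orientation) (hN : o.IsSelfDual)
    (ι : M → N) (hM : SelfDualUmbilic.IsUmbilicHypersurface c ι)
    (U : Set N) (g : (x : N) → SelfDualUmbilic.Bilin 𝕜 (SelfDualUmbilic.Tan 𝕜 4 x))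
    (hg : c.IsLocalMetric U g)
    (φ : OpenPartialHomeomorph N (SelfDualUmbilic.Coord 𝕜 4))
    (hφ : φ ∈ SelfDualUmbilic.charts 𝕜 4 N)
    (ψ : OpenPartialHomeomorph M (SelfDualUmbilic.Coord 𝕜 3))
    (hψ : ψ ∈ SelfDualUmbilic.charts 𝕜 3 M)
    (y : M) (hyψ : y ∈ ψ.source) (hyφ : ι y ∈ φ.source) (hyU : ι y ∈ U) :
    (∀ X Y Z T : SelfDualUmbilic.Tan 𝕜 4 (ι y),
      SelfDualUmbilic.weylPlusAt φ o g (ι y) X Y Z T = 0) ∧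
    (∀ ν : SelfDualUmbilic.Tan 𝕜 4 (ι y), g (ι y) ν ν = 1 →
      (∀ u : SelfDualUmbilic.Tan 𝕜 3 y, g (ι y) ν (SelfDualUmbilic.diff ι y u) = 0) →
      ∀ A₁ A₂ B₁ B₂ : SelfDualUmbilic.Tan 𝕜 3 y,
        SelfDualUmbilic.covDerivWeylPlusAt φ o g (ι y) ν
            (SelfDualUmbilic.diff ι y A₁) (SelfDualUmbilic.diff ι y A₂)
            (SelfDualUmbilic.diff ι y B₁) (SelfDualUmbilic.diff ι y B₂)
          = -SelfDualUmbilic.cottonAt ψ (SelfDualUmbilic.inducedMetric ι g) y A₁ A₂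
              (SelfDualUmbilic.hodgeM ι y (g (ι y)) (o.volForm g (ι y)) ν B₁ B₂)) ∧
    (∀ X Y Z : SelfDualUmbilic.Tan 𝕜 3 y,
      SelfDualUmbilic.cottonPlusAt φ o g (ι y)
          (SelfDualUmbilic.diff ι y X) (SelfDualUmbilic.diff ι y Y) (SelfDualUmbilic.diff ι y Z)
        = SelfDualUmbilic.cottonAt ψ (SelfDualUmbilic.inducedMetric ι g) y X Y Z) := by
  have hι := hM.smooth
  have hy : ι y ∈ U ∩ φ.source := ⟨hyU, hyφ⟩
  obtain ⟨O, H, hp, h⟩ := hM.exists_coordUmbilic hg hφ hψ hyψ hy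
  have hμ := o.isVolOn hg hφ
  have hsd := fun q hq => hN.weylMinus_eq_zero (q := q) hg hφ hq
  have hF : SelfDualUmbilic.coordMap φ ψ ι (ψ y) = φ (ι y) := by
    change φ (ι (ψ.symm (ψ y))) = φ (ι y)
    rw [ψ.left_inv hyψ]
  have hd := fun u => SelfDualUmbilic.dChart_diff hι hφ hψ hyψ hy u
  refine ⟨fun X Y Z T => ?_, fun ν hνν hν A₁ A₂ B₁ B₂ => ?_, fun X Y Z => ?_⟩
  · rw [SelfDualUmbilic.weylPlusAt, ← hF]
    exact h.weylPlus_eq_zero hμ hsd hp _ _ _ _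
  -- The coordinate statement tests normality and the Hodge dual on all coordinate vectors, each of
  -- which is the image of a tangent vector.
  · have hsurj : ∀ X, ∃ u : SelfDualUmbilic.Tan 𝕜 3 y, SelfDualUmbilic.dChart ψ y u = X :=
      SelfDualUmbilic.dChart_surjective hψ hyψ
    rw [SelfDualUmbilic.covDerivWeylPlusAt, SelfDualUmbilic.cottonAt, hd, hd, hd, hd, ← hF]
    refine h.covDeriv4_weylPlus_eq hμ hsd hp (fun X => ?_) ?_ _ _ _ _ _ fun Z => ?_
    · obtain ⟨u, rfl⟩ := hsurj X
      rw [← hd, hF, SelfDualUmbilic.coordForm_dChart hφ g hyφ, hν]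
    · rw [hF, SelfDualUmbilic.coordForm_dChart hφ g hyφ, hνν]
    · obtain ⟨u, rfl⟩ := hsurj Z
      rw [SelfDualUmbilic.coordForm_dChart hψ _ hyψ, hM.apply_hodgeM hg hyU,
        ← SelfDualUmbilic.coordVol_dChart hφ _ hyφ, hF, ← hd, ← hd, ← hd]
      congr 1
      ext i : 1
      fin_cases i <;> rfl
  · rw [SelfDualUmbilic.cottonPlusAt, SelfDualUmbilic.cottonAt, hd, hd, hd, ← hF]
    exact h.cottonPlus_eq hμ hsd hp _ _ _
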